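/- Let $\mathcal G$ be the space of Lipschitz functions $f:\mathbb R\to\mathbb R$ with the Borel $\sigma$-algebra of the norm $|f(0)|+L_f$, where $L_f$ is the Lipschitz constant of $f$, and let $\nu$ be a probability measure on $\mathcal G$ such that, for $f$ with law $\nu$, $\mathbf E L_f<\infty$, $\mathbf E\log L_f<0$ (the value $-\infty$ being allowed), and $\mathbf E|f(z)-z|<\infty$ for some $z\in\mathbb R$. Let $\mathcal P$ be a Poisson process on $[0,\infty)\times[0,\infty)\times\mathcal G$ with intensity measure $\mathrm{Leb}\otimes\mathrm{Leb}\otimes\nu$, and fix $z_0\in\mathbb R$. For $x>0$ and $t>0$ let $\zeta_t(x)=f_1\circ\cdots\circ f_n(z_0)$, where $(t_1,x_1,f_1),\dots,(t_n,x_n,f_n)$ are the points $(s,y,f)$ of $\mathcal P$ with $s\le t$ and $y\le x$, listed so that $t_1<\dots<t_n$, and let $\zeta(x)=\lim_{t\to\infty}\zeta_t(x)$. A point $(t,x,f)$ of $\mathcal P$ is called a lower record if $\mathcal P$ has no other point in $[0,t]\times[0,x]\times\mathcal G$. Then: 1. Almost surely, the limit $\zeta(x)$ exists for all $x>0$ simultaneously.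 2. For every fixed $x>0$, the process $\zeta$ is almost surely continuous at $x$. 3. Almost surely, $\zeta$ has càdlàg paths on $(0,\infty)$ (right-continuous with finite left limits). 4. Almost surely, every lower record $(t,x,f)$ satisfies $x>0$ and $\zeta(x)=f(\zeta(x-))$, where $\zeta(x-)$ is the left limit of $\zeta$ at $x$. 5. Suppose moreover that there is no constant $c\in\mathbb R$ with $f(c)=c$ for $\nu$-almost every $f$. Then, almost surely, there is a lower record $(t,x,f)$ with $\zeta(x)\ne\zeta(x-)$; in particular, almost surely, the path of $\zeta$ is not continuous on $(0,\infty)$. Also, almost surely, the path is neither nondecreasing nor nonincreasing on $(0,\infty)$. -/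

import Mathlib

open Set Filter Topology MeasureTheory ProbabilityTheory
open scoped ENNReal NNReal

/-- The Lipschitz constant `L_f = sup_{x ≠ y} |f y - f x| / |y - x|` of a real function,
with values in `[0, ∞]`. -/
noncomputable def lipConst (f : ℝ → ℝ) : ℝ≥0∞ :=
  ⨆ (x : ℝ) (y : ℝ) (_ : x ≠ y), edist (f y) (f x) / edist y x

/-- The space of Lipschitz functions `ℝ → ℝ`. -/
structure LipMap where
  toFun : ℝ → ℝ
  lipschitz : ∃ K : ℝ≥0, LipschitzWith K toFun

namespace LipMap

instance : CoeFun LipMap (fun _ => ℝ → ℝ) := ⟨LipMap.toFun⟩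

/-- The distance of the Lipschitz norm `‖f‖ = |f 0| + L_f`, that is `|f 0 - g 0| + L_{f - g}`. -/
noncomputable instance : PseudoEMetricSpace LipMap where
  edist f g := edist (f 0) (g 0) + lipConst (fun z => f z - g z)
  edist_self f := by
    simp [lipConst]
  edist_comm f g := by
    have h : ∀ x y : ℝ, edist (f y - g y) (f x - g x) = edist (g y - f y) (g x - f x) := by
      intro x y
      rw [← edist_neg_neg (g y - f y) (g x - f x), neg_sub, neg_sub]
    simp only [lipConst, h, edist_comm (f 0) (g 0)]
  edist_triangle f g h := by
    have key : lipConst (fun z => f z - h z)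
        ≤ lipConst (fun z => f z - g z) + lipConst (fun z => g z - h z) := by
      refine iSup_le fun x => iSup_le fun y => iSup_le fun hxy => ?_
      have e : edist (f y - h y) (f x - h x)
          ≤ edist (f y - g y) (f x - g x) + edist (g y - h y) (g x - h x) := by
        have := edist_add_add_le (f y - g y) (g y - h y) (f x - g x) (g x - h x)
        simpa using this
      calc edist (f y - h y) (f x - h x) / edist y x
          ≤ (edist (f y - g y) (f x - g x) + edist (g y - h y) (g x - h x)) / edist y x := by
            gcongr
        _ = edist (f y - g y) (f x - g x) / edist y x
            + edist (g y - h y) (g x - h x) / edist y x := ENNReal.add_div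
        _ ≤ _ := by
            gcongr
            · exact le_iSup_of_le x (le_iSup_of_le y (le_iSup_of_le hxy le_rfl))
            · exact le_iSup_of_le x (le_iSup_of_le y (le_iSup_of_le hxy le_rfl))
    calc edist (f 0) (h 0) + lipConst (fun z => f z - h z)
        ≤ (edist (f 0) (g 0) + edist (g 0) (h 0))
          + (lipConst (fun z => f z - g z) + lipConst (fun z => g z - h z)) :=
          add_le_add (edist_triangle _ _ _) key
      _ = _ := by ring

/-- The Borel `σ`-algebra of the Lipschitz norm. -/
noncomputable instance : MeasurableSpace LipMap := borel LipMap

instance : BorelSpace LipMap := ⟨rfl⟩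

end LipMap

/-- `E L_f < ∞` and `E log L_f < 0` for `f` with law `ν`. Here `log 0 = -∞`, so that
`E log L_f` may be `-∞`; it is the difference of the integrals of the positive part (finite,
because `E L_f < ∞`) and of the negative part of `log L_f`. -/
def IsContractiveInMean (ν : Measure LipMap) : Prop :=
  ∫⁻ f, lipConst f ∂ν < ∞ ∧
  ∫⁻ f, (ENNReal.log (lipConst f)).toENNReal ∂ν
    < ∫⁻ f, (-ENNReal.log (lipConst f)).toENNReal ∂ν

/-- The random set `N` is a Poisson (point) process with intensity measure `m`: the number of
points in a measurable set is a random variable, Poisson distributed with mean `m B` if this is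
finite, and the numbers of points in disjoint sets are independent. -/
structure IsPoissonProcess {Ω E : Type*} [MeasurableSpace Ω] [MeasurableSpace E]
    (P : Measure Ω) (N : Ω → Set E) (m : Measure E) : Prop where
  measurable_count : ∀ B : Set E, MeasurableSet B → Measurable fun ω => (N ω ∩ B).encard
  law_count : ∀ B : Set E, MeasurableSet B → m B ≠ ∞ →
    P.map (fun ω => (N ω ∩ B).encard)
      = (poissonMeasure (m B).toNNReal).map (fun n : ℕ => (n : ℕ∞))
  indep_count : ∀ (n : ℕ) (B : Fin n → Set E), (∀ i, MeasurableSet (B i)) →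
    Pairwise (fun i j => Disjoint (B i) (B j)) →
    iIndepFun (fun i ω => (N ω ∩ B i).encard) P

/-- The intensity measure `Leb ⊗ Leb ⊗ ν` on `[0, ∞) × [0, ∞) × (Lipschitz functions)`. -/
noncomputable def halfLineIntensity (ν : Measure LipMap) : Measure (ℝ × ℝ × LipMap) :=
  (volume.restrict (Ici (0 : ℝ))).prod ((volume.restrict (Ici (0 : ℝ))).prod ν)

section Sieving

variable {X : Type*}

/-- The points `(s, x, f)` of the configuration `S` with `(s, x) ∈ [0, t] × A`. -/
def sievedAtoms (S : Set (ℝ × X × LipMap)) (A : Set X) (t : ℝ) : Set (ℝ × X × LipMap) :=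
  S ∩ Icc 0 t ×ˢ A ×ˢ univ

/-- `l` lists the points of `S` in `[0, t] × A` in strictly increasing order of time. -/
def IsTimeEnumeration (S : Set (ℝ × X × LipMap)) (A : Set X) (t : ℝ)
    (l : List (ℝ × X × LipMap)) : Prop :=
  l.Pairwise (fun p q => p.1 < q.1) ∧ {p | p ∈ l} = sievedAtoms S A t

open Classical in
/-- The sieved backward iteration `ζ_t(A) = f₁ ∘ ⋯ ∘ f_n (z₀)`, where `f₁, …, f_n` are the marks
of the points in `[0, t] × A`, listed by increasing time. (If there are infinitely many such
points, or two with the same time, the value is the irrelevant `z₀`.) -/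
noncomputable def sievedIterate (S : Set (ℝ × X × LipMap)) (z₀ : ℝ) (A : Set X) (t : ℝ) : ℝ :=
  if h : ∃ l, IsTimeEnumeration S A t l then h.choose.foldr (fun p z => p.2.2 z) z₀ else z₀

/-- The time enumeration is unique, so `sievedIterate` can be computed from any of them. -/
theorem sievedIterate_eq {S : Set (ℝ × X × LipMap)} {A : Set X} {t : ℝ}
    {l : List (ℝ × X × LipMap)} (hl : IsTimeEnumeration S A t l) (z₀ : ℝ) :
    sievedIterate S z₀ A t = l.foldr (fun p z => p.2.2 z) z₀ := by
  have h : ∃ l, IsTimeEnumeration S A t l := ⟨l, hl⟩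
  have hc := h.choose_spec
  have hnd : ∀ {l' : List (ℝ × X × LipMap)}, l'.Pairwise (fun p q => p.1 < q.1) → l'.Nodup :=
    fun h' => h'.imp (fun {a b} hab he => by simp [he] at hab)
  have hp : h.choose.Perm l := by
    rw [List.perm_ext_iff_of_nodup (hnd hc.1) (hnd hl.1)]
    intro p
    have := hc.2.trans hl.2.symm
    exact Set.ext_iff.1 this p
  have : h.choose = l :=
    hp.eq_of_pairwise (fun a b _ _ hab hba => absurd hab (lt_asymm hba)) hc.1 hl.1
  rw [sievedIterate, dif_pos h, this]

/-- `ζ(A)`, the limit of the sieved backward iterations `ζ_t(A)` as `t → ∞`. -/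
noncomputable def sievedLimit (S : Set (ℝ × X × LipMap)) (z₀ : ℝ) (A : Set X) : ℝ :=
  limUnder atTop (sievedIterate S z₀ A)

end Sieving

/-- The half-line process `ζ(x) = ζ([0, x])` (of interest for `x > 0`). -/
noncomputable def zetaProcess (S : Set (ℝ × ℝ × LipMap)) (z₀ : ℝ) (x : ℝ) : ℝ :=
  sievedLimit S z₀ (Icc 0 x)

/-- `g` is càdlàg on `(0, ∞)`: right-continuous with finite left limits. -/
def IsCadlagOnPos (g : ℝ → ℝ) : Prop :=
  ∀ x > 0, ContinuousWithinAt g (Ici x) x ∧ ∃ l, Tendsto g (𝓝[<] x) (𝓝 l)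

/-- `p = (t, x, f)` is a lower record of `S`: it is a point of `S`, and `[0, t] × [0, x]`
contains no other point of `S`. -/
def IsLowerRecord (S : Set (ℝ × ℝ × LipMap)) (p : ℝ × ℝ × LipMap) : Prop :=
  sievedAtoms S (Icc 0 p.2.1) p.1 = {p}

/-! Convergence. Since `E log L < 0`, some small power satisfies `E L^θ ≤ α < 1`. Cut time after `T`
into blocks of length `1/s` and consider all sieves `A` between `[0, s]` and `[0, (1+κ)s]` at once.
A new block changes the backward iteration by at most the product of the Lipschitz constants of the
earlier maps times the displacement of `z₀` by the block. Points that may or may not belong to `A`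
contribute the factor `max 1 L`, so one bound, a product over Poisson points, serves every such `A`.
The Poisson formula `E ∏ h = exp ∫ (h - 1)`, needed only as an upper bound, makes its `θ`-moment
decay geometrically in the block number if `κ` is small, with constants independent of `s` and `T`.
Hence the iterations converge uniformly over such sieves.

Paths. Up to a fixed time only finitely many points matter, so the iteration is a step function of
the height; a locally uniform limit of these is càdlàg, and its left limit belongs to the sieve `[0,
x)`. No point has a prescribed height, which gives continuity at fixed `x`. At a lower record the
mark is the outermost map of the sieve `[0, x]` and the other maps are those of `[0, x)`, whence the
record equation.

Jumps. Choose `c` nearly fixed by uniform contractions of positive probability, and a set of maps of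
positive probability that displace `c`. At scale `s`, require contractions at late times and low
heights, then one displacing map at an earlier time and greater height, then contractions at still
earlier times and greater heights. As the height grows, `ζ` is near `c`, then away from it, then
near it again; the displacing point is a lower record with a jump. Along a sparse sequence of scales
the patterns occupy disjoint regions and have probability bounded below, while each tail is harmless
with probability close to one. Thus some scale succeeds almost surely
(`measureReal_iInter_compl_le`, `IsSummableConfig.jump_and_not_monotone`). -/

theorem edist_le_lipConst_mul (f : ℝ → ℝ) (x y : ℝ) :
    edist (f x) (f y) ≤ lipConst f * edist x y := by
  rcases eq_or_ne y x with rfl | h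
  · simp
  · have h1 : edist (f x) (f y) / edist x y ≤ lipConst f :=
      le_iSup_of_le y (le_iSup_of_le x (le_iSup_of_le h le_rfl))
    rwa [ENNReal.div_le_iff (by simpa [edist_eq_zero] using h.symm) (edist_ne_top _ _)] at h1

/-! ### Evaluation and Lipschitz constant as measurable functions of the map -/

namespace LipMap

theorem lipConst_ne_top (f : LipMap) : lipConst f ≠ ∞ := by
  obtain ⟨K, hK⟩ := f.lipschitz
  refine ne_top_of_le_ne_top (ENNReal.coe_ne_top (r := K)) ?_
  refine iSup_le fun x => iSup_le fun y => iSup_le fun _ => ?_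
  exact ENNReal.div_le_of_le_mul (hK y x)

theorem edist_apply_le (f : LipMap) (x y : ℝ) : edist (f x) (f y) ≤ lipConst f * edist x y :=
  edist_le_lipConst_mul _ _ _

theorem continuous_apply (f : LipMap) : Continuous f := f.lipschitz.choose_spec.continuous

/-- The difference at `z` is the difference at `0` plus an increment controlled by the Lipschitz
constant of `f - g`. Evaluation is thereby Lipschitz for the norm, hence Borel. -/
theorem edist_eval_le (f g : LipMap) (z : ℝ) :
    edist (f z) (g z) ≤ (1 + edist z 0) * edist f g := by
  have hdef : edist f g = edist (f 0) (g 0) + lipConst (fun z => f z - g z) := rfl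
  have h1 := edist_le_lipConst_mul (fun z => f z - g z) z 0
  have h2 : edist (f z) (g z) ≤ edist (f 0) (g 0) + edist (f z - g z) (f 0 - g 0) := by
    rw [edist_eq_enorm_sub, edist_eq_enorm_sub, edist_eq_enorm_sub]
    refine le_trans (le_of_eq ?_) (enorm_add_le _ _)
    congr 1; ring
  rw [hdef]
  calc edist (f z) (g z) ≤ _ := h2
    _ ≤ edist (f 0) (g 0) + lipConst (fun z => f z - g z) * edist z 0 := by gcongr
    _ ≤ _ := by
      rw [add_mul, one_mul, mul_add, mul_comm (edist z 0) (lipConst _)]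
      gcongr
      · exact le_self_add
      · exact le_add_self

theorem continuous_eval (z : ℝ) : Continuous fun f : LipMap => f z := by
  have : LipschitzWith (1 + nndist z 0) fun f : LipMap => f z := fun f g => by
    refine (edist_eval_le f g z).trans_eq ?_
    rw [edist_nndist z 0]
    push_cast
    rfl
  exact this.continuous

theorem measurable_eval (z : ℝ) : Measurable fun f : LipMap => f z := (continuous_eval z).measurable

/-- A supremum of continuous functions, even over uncountably many pairs, is lower semicontinuous.
-/
theorem measurable_lipConst : Measurable fun f : LipMap => lipConst f := by
  refine LowerSemicontinuous.measurable ?_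
  refine lowerSemicontinuous_iSup fun x => lowerSemicontinuous_iSup fun y =>
    lowerSemicontinuous_iSup fun h => Continuous.lowerSemicontinuous ?_
  refine ENNReal.continuous_div_const _ (by simpa [edist_eq_zero] using h.symm) |>.comp ?_
  exact (continuous_eval y).edist (continuous_eval x)

theorem measurable_edist_eval (z w : ℝ) : Measurable fun f : LipMap => edist (f z) w :=
  (measurable_eval z).edist measurable_const

end LipMap

/-! ### Products over the points of a configuration -/

section PointProd

variable {E : Type*}

open Classical in
/-- The product of `h` over the points of the configuration `S`, and `0` if `S` is infinite. -/
noncomputable def pointProd (h : E → ℝ≥0∞) (S : Set E) : ℝ≥0∞ :=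
  if hS : S.Finite then ∏ p ∈ hS.toFinset, h p else 0

theorem pointProd_coe (h : E → ℝ≥0∞) (s : Finset E) : pointProd h s = ∏ p ∈ s, h p := by
  rw [pointProd, dif_pos s.finite_toSet]
  simp

theorem pointProd_of_infinite (h : E → ℝ≥0∞) {S : Set E} (hS : ¬ S.Finite) : pointProd h S = 0 :=
  dif_neg hS

theorem pointProd_rpow (h : E → ℝ≥0∞) (S : Set E) {r : ℝ} (hr : 0 < r) :
    pointProd (fun p => h p ^ r) S = pointProd h S ^ r := by
  by_cases hS : S.Finite
  · lift S to Finset E using hS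
    rw [pointProd_coe, pointProd_coe, ENNReal.prod_rpow_of_nonneg hr.le]
  · rw [pointProd_of_infinite _ hS, pointProd_of_infinite _ hS, ENNReal.zero_rpow_of_pos hr]

theorem tendsto_pointProd {h : E → ℝ≥0∞} {g : ℕ → E → ℝ≥0∞} (hfin : ∀ p, h p ≠ ∞)
    (hg : ∀ p, Tendsto (fun n => g n p) atTop (𝓝 (h p))) (S : Set E) :
    Tendsto (fun n => pointProd (g n) S) atTop (𝓝 (pointProd h S)) := by
  by_cases hS : S.Finite
  · lift S to Finset E using hS
    simp only [pointProd_coe]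
    exact ENNReal.tendsto_finsetProd_of_ne_top _ (fun p _ => hg p) (fun p _ => hfin p)
  · simp only [pointProd_of_infinite _ hS, tendsto_const_nhds]

theorem encard_toNat_preimage [MeasurableSpace E] (φ : SimpleFunc E ℝ≥0∞) (s : Finset E)
    (v : ℝ≥0∞) : (((s : Set E) ∩ φ ⁻¹' {v}).encard).toNat = (s.filter fun p => φ p = v).card := by
  have : (s : Set E) ∩ φ ⁻¹' {v} = (s.filter fun p => φ p = v : Finset E) := by
    ext; simp
  rw [this, Set.encard_coe_eq_coe_finsetCard]
  simp

/-- For a simple function the product depends only on the numbers of points in the level sets, the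
data whose joint law a Poisson process prescribes. Infinite configurations are separated because
`toNat` sends `⊤` to `0`. -/
theorem pointProd_simpleFunc [MeasurableSpace E] (φ : SimpleFunc E ℝ≥0∞) (S A : Set E) :
    pointProd φ (S ∩ A) = if (S ∩ A).encard = ⊤ then 0 else
      ∏ v ∈ φ.range, v ^ ((S ∩ (A ∩ φ ⁻¹' {v})).encard).toNat := by
  classical
  simp only [← inter_assoc]
  by_cases hS : (S ∩ A).Finite
  · obtain ⟨s, hs⟩ := hS.exists_finset_coe
    rw [← hs, pointProd_coe, if_neg (by simp)]
    rw [← Finset.prod_fiberwise_of_maps_to (t := φ.range) (g := φ) (fun p _ => φ.mem_range_self p)]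
    refine Finset.prod_congr rfl fun v _ => ?_
    rw [encard_toNat_preimage, Finset.prod_congr rfl (g := fun _ => v)]
    · simp
    · intro p hp
      simpa using (Finset.mem_filter.1 hp).2
  · rw [pointProd_of_infinite _ hS, if_pos (by simpa using hS)]

/-- Counts are assumed measurable only inside `A`, so that the result also applies to the smaller
σ-algebras `countSigma`. -/
theorem measurable_pointProd [MeasurableSpace E] {Ω : Type*} [MeasurableSpace Ω] {N : Ω → Set E}
    {A : Set E} (hA : MeasurableSet A)
    (hN : ∀ B ⊆ A, MeasurableSet B → Measurable fun ω => (N ω ∩ B).encard)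
    {h : E → ℝ≥0∞} (hm : Measurable h) (hfin : ∀ p, h p ≠ ∞) :
    Measurable fun ω => pointProd h (N ω ∩ A) := by
  refine measurable_of_tendsto_metrizable (f := fun n ω => pointProd (SimpleFunc.eapprox h n)
    (N ω ∩ A)) (fun n => ?_) (tendsto_pi_nhds.2 fun ω =>
      tendsto_pointProd hfin (fun p => SimpleFunc.tendsto_eapprox hm p) _)
  simp only [pointProd_simpleFunc]
  refine Measurable.ite ?_ measurable_const ?_
  · exact hN A subset_rfl hA (measurableSet_singleton ⊤)
  · refine Finset.measurable_prod _ fun v _ => ?_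
    refine (measurable_of_countable fun k : ℕ∞ => v ^ k.toNat).comp (hN _ inter_subset_left ?_)
    exact hA.inter ((SimpleFunc.eapprox h n).measurableSet_preimage _)

end PointProd

/-- The events determined by the numbers of points in the measurable subsets of `R`. -/
noncomputable abbrev countSigma {Ω E : Type*} [MeasurableSpace E] (N : Ω → Set E) (R : Set E) :
    MeasurableSpace Ω :=
  ⨆ B ∈ {B : Set E | MeasurableSet B ∧ B ⊆ R},
    MeasurableSpace.comap (fun ω => (N ω ∩ B).encard) inferInstance

theorem measurable_countSigma {Ω E : Type*} [MeasurableSpace E] {N : Ω → Set E} {R B : Set E}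
    (hB : MeasurableSet B) (h : B ⊆ R) :
    Measurable[countSigma N R] fun ω => (N ω ∩ B).encard := by
  rw [measurable_iff_comap_le]
  exact le_biSup (fun B => MeasurableSpace.comap (fun ω => (N ω ∩ B).encard) inferInstance)
    (show B ∈ {B : Set E | MeasurableSet B ∧ B ⊆ R} from ⟨hB, h⟩)

theorem measurable_pointProd_countSigma {Ω E : Type*} [MeasurableSpace E] {N : Ω → Set E}
    {R A : Set E} (hA : MeasurableSet A) (hR : A ⊆ R) {h : E → ℝ≥0∞} (hm : Measurable h)
    (hfin : ∀ p, h p ≠ ∞) : Measurable[countSigma N R] fun ω => pointProd h (N ω ∩ A) :=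
  @measurable_pointProd E _ Ω (countSigma N R) N A hA
    (fun _ hBA hB => measurable_countSigma hB (hBA.trans hR)) h hm hfin

theorem lintegral_pow_poissonMeasure (r : ℝ≥0) {v : ℝ≥0∞} (hv : v ≠ ∞) :
    ∫⁻ n, v ^ n ∂(poissonMeasure r) = ENNReal.ofReal (Real.exp (r * v.toReal - r)) := by
  lift v to ℝ≥0 using hv
  rw [poissonMeasure, lintegral_sum_measure]
  have h : ∀ n : ℕ, ∫⁻ k : ℕ, (v : ℝ≥0∞) ^ k
      ∂(ENNReal.ofReal (Real.exp (-r) * r ^ n / n.factorial) • Measure.dirac n)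
      = ENNReal.ofReal (Real.exp (-r) * ((r * v) ^ n / n.factorial)) := by
    intro n
    rw [lintegral_smul_measure, lintegral_dirac, smul_eq_mul, ← ENNReal.coe_pow,
      ← ENNReal.ofReal_coe_nnreal, ← ENNReal.ofReal_mul (by positivity)]
    congr 1
    push_cast
    ring
  simp only [h]
  have hs : HasSum (fun n : ℕ => Real.exp (-r) * (((r : ℝ) * v) ^ n / n.factorial))
      (Real.exp (-r) * Real.exp (r * v)) := by
    refine HasSum.mul_left _ ?_
    rw [Real.exp_eq_exp_ℝ]
    exact NormedSpace.expSeries_div_hasSum_exp _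
  rw [← ENNReal.ofReal_tsum_of_nonneg (fun n => by positivity) hs.summable, hs.tsum_eq,
    ← Real.exp_add]
  congr 2
  simp only [ENNReal.coe_toReal]
  ring

/-! ### Product moments of a Poisson process -/

namespace IsPoissonProcess

variable {Ω E : Type*} [MeasurableSpace Ω] [MeasurableSpace E] {P : Measure Ω}
  {N : Ω → Set E} {m : Measure E}

theorem countSigma_le (hN : IsPoissonProcess P N m) (R : Set E) :
    countSigma N R ≤ (inferInstance : MeasurableSpace Ω) :=
  iSup₂_le fun B hB => (hN.measurable_count B hB.1).comap_le

theorem lintegral_pow_count (hN : IsPoissonProcess P N m) {B : Set E} (hB : MeasurableSet B)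
    (hB' : m B ≠ ∞) {v : ℝ≥0∞} (hv : v ≠ ∞) :
    ∫⁻ ω, v ^ ((N ω ∩ B).encard).toNat ∂P
      = ENNReal.ofReal (Real.exp ((m B).toReal * v.toReal - (m B).toReal)) := by
  have h := lintegral_map (μ := P) (f := fun k : ℕ∞ => v ^ k.toNat) (measurable_of_countable _)
    (hN.measurable_count B hB)
  rw [← h, hN.law_count B hB hB', lintegral_map (measurable_of_countable _)
    (measurable_of_countable _)]
  simp only [ENat.toNat_natCast]
  rw [lintegral_pow_poissonMeasure _ hv]
  rfl

theorem measure_count_eq (hN : IsPoissonProcess P N m) {B : Set E} (hB : MeasurableSet B)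
    (hB' : m B ≠ ∞) (k : ℕ) :
    P {ω | (N ω ∩ B).encard = k} = ENNReal.ofReal
      (Real.exp (-(m B).toReal) * (m B).toReal ^ k / k.factorial) := by
  have h := congrArg (fun μ => μ {(k : ℕ∞)}) (hN.law_count B hB hB')
  beta_reduce at h
  rw [Measure.map_apply (hN.measurable_count B hB) (measurableSet_singleton _),
    Measure.map_apply (measurable_of_countable _) (measurableSet_singleton _)] at h
  have h2 : (fun n : ℕ => (n : ℕ∞)) ⁻¹' {(k : ℕ∞)} = {k} := by ext; simp
  rw [h2, poissonMeasure_singleton] at h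
  exact h

theorem ae_finite_inter (hN : IsPoissonProcess P N m) {B : Set E} (hB : MeasurableSet B)
    (hB' : m B ≠ ∞) : ∀ᵐ ω ∂P, (N ω ∩ B).Finite := by
  have h := congrArg (fun μ => μ {⊤}) (hN.law_count B hB hB')
  beta_reduce at h
  rw [Measure.map_apply (hN.measurable_count B hB) (measurableSet_singleton _),
    Measure.map_apply (measurable_of_countable _) (measurableSet_singleton _)] at h
  have h2 : (fun n : ℕ => (n : ℕ∞)) ⁻¹' {⊤} = ∅ := by ext; simp
  rw [h2, measure_empty] at h
  refine (ae_iff.2 ?_)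
  convert h using 2
  ext ω
  simp

theorem iIndepFun_count (hN : IsPoissonProcess P N m) {ι : Type*} [Fintype ι] {B : ι → Set E}
    (hB : ∀ i, MeasurableSet (B i)) (hd : Pairwise fun i j => Disjoint (B i) (B j)) :
    iIndepFun (fun i ω => (N ω ∩ B i).encard) P := by
  let e := Fintype.equivFin ι
  have h := hN.indep_count _ (fun j => B (e.symm j)) (fun j => hB _)
    (fun i j hij => hd (e.symm.injective.ne hij))
  simpa using h.precomp e.injective

/-- The generating functional `E ∏ h = exp ∫ (h - 1)`, as an inequality. For simple `h` the level
sets carry independent Poisson counts and the expectation factorizes; Fatou's lemma passes to the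
limit. -/
theorem lintegral_pointProd_le (hN : IsPoissonProcess P N m) {A : Set E} (hA : MeasurableSet A)
    (hA' : m A ≠ ∞) {h : E → ℝ≥0∞} (hm : Measurable h) (hfin : ∀ p, h p ≠ ∞) {b : ℝ} (hb0 : 0 ≤ b)
    (hb : ∫⁻ p in A, h p ∂m ≤ ENNReal.ofReal b) :
    ∫⁻ ω, pointProd h (N ω ∩ A) ∂P ≤ ENNReal.ofReal (Real.exp (b - (m A).toReal)) := by
  have hcount : ∀ B ⊆ A, MeasurableSet B → Measurable fun ω => (N ω ∩ B).encard :=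
    fun B _ hB => hN.measurable_count B hB
  have key : ∀ n, ∫⁻ ω, pointProd (SimpleFunc.eapprox h n) (N ω ∩ A) ∂P
      ≤ ENNReal.ofReal (Real.exp (b - (m A).toReal)) := by
    intro n
    set φ := SimpleFunc.eapprox h n with hφ
    have hms : ∀ v, MeasurableSet (A ∩ φ ⁻¹' {v}) := fun v =>
      hA.inter (φ.measurableSet_preimage _)
    have hfv : ∀ v, m (A ∩ φ ⁻¹' {v}) ≠ ∞ := fun v => measure_ne_top_of_subset inter_subset_left hA'
    have hvt : ∀ v ∈ φ.range, v ≠ ∞ := by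
      intro v hv
      obtain ⟨p, rfl⟩ := SimpleFunc.mem_range.1 hv
      exact (SimpleFunc.eapprox_lt_top h n p).ne
    have hind : iIndepFun (fun (v : φ.range) ω => (N ω ∩ (A ∩ φ ⁻¹' {v.1})).encard) P :=
      hN.iIndepFun_count (fun v => hms v) (fun v w hvw => by
        refine Disjoint.mono inter_subset_right inter_subset_right ?_
        exact (Set.disjoint_singleton.2 fun h => hvw (Subtype.ext h)).preimage φ)
    have hind2 := hind.comp (fun v k => (v.1 : ℝ≥0∞) ^ k.toNat) (fun v => measurable_of_countable _)
    have hprod := lintegral_prod_eq_prod_lintegral_of_indepFun Finset.univ _ hind2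
      (fun v => (measurable_of_countable _).comp (hN.measurable_count _ (hms v)))
    calc ∫⁻ ω, pointProd φ (N ω ∩ A) ∂P
        ≤ ∫⁻ ω, ∏ v : φ.range, (v.1 : ℝ≥0∞) ^ ((N ω ∩ (A ∩ φ ⁻¹' {v.1})).encard).toNat ∂P := by
          refine lintegral_mono fun ω => ?_
          simp only [pointProd_simpleFunc]
          split_ifs
          · exact zero_le
          · rw [← Finset.prod_coe_sort]
      _ = ∏ v : φ.range, ∫⁻ ω, (v.1 : ℝ≥0∞) ^ ((N ω ∩ (A ∩ φ ⁻¹' {v.1})).encard).toNat ∂P := hprod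
      _ = ∏ v : φ.range, ENNReal.ofReal (Real.exp ((m (A ∩ φ ⁻¹' {v.1})).toReal * v.1.toReal
            - (m (A ∩ φ ⁻¹' {v.1})).toReal)) :=
          Finset.prod_congr rfl fun v _ => hN.lintegral_pow_count (hms _) (hfv _) (hvt _ v.2)
      _ = ENNReal.ofReal (Real.exp (∑ v ∈ φ.range, (m (A ∩ φ ⁻¹' {v})).toReal * v.toReal
            - ∑ v ∈ φ.range, (m (A ∩ φ ⁻¹' {v})).toReal)) := by
          rw [← ENNReal.ofReal_prod_of_nonneg (fun _ _ => (Real.exp_pos _).le), ← Real.exp_sum,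
            Finset.sum_sub_distrib, Finset.sum_coe_sort φ.range
              (fun v => (m (A ∩ φ ⁻¹' {v})).toReal * v.toReal),
            Finset.sum_coe_sort φ.range (fun v => (m (A ∩ φ ⁻¹' {v})).toReal)]
      _ ≤ _ := by
          refine ENNReal.ofReal_le_ofReal (Real.exp_le_exp.2 (sub_le_sub ?_ (le_of_eq ?_)))
          · have h1 : ∑ v ∈ φ.range, (m (A ∩ φ ⁻¹' {v})).toReal * v.toReal
                = (∫⁻ p in A, φ p ∂m).toReal := by
              rw [SimpleFunc.lintegral_eq_lintegral, SimpleFunc.lintegral, ENNReal.toReal_sum]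
              · refine Finset.sum_congr rfl fun v _ => ?_
                rw [Measure.restrict_apply (φ.measurableSet_preimage _), ENNReal.toReal_mul,
                  mul_comm, inter_comm]
              · intro v hv
                refine ENNReal.mul_ne_top (hvt v hv) ?_
                rw [Measure.restrict_apply (φ.measurableSet_preimage _), inter_comm]
                exact hfv v
            rw [h1]
            refine ENNReal.toReal_le_of_le_ofReal hb0 (le_trans (lintegral_mono fun p => ?_) hb)
            rw [← SimpleFunc.iSup_eapprox_apply hm p]
            exact le_iSup (fun n => SimpleFunc.eapprox h n p) n
          · rw [← ENNReal.toReal_sum fun v _ => hfv v]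
            congr 1
            have := φ.sum_range_measure_preimage_singleton (m.restrict A)
            rw [Measure.restrict_apply_univ] at this
            rw [← this]
            refine Finset.sum_congr rfl fun v _ => ?_
            rw [Measure.restrict_apply (φ.measurableSet_preimage _), inter_comm]
  calc ∫⁻ ω, pointProd h (N ω ∩ A) ∂P
      = ∫⁻ ω, liminf (fun n => pointProd (SimpleFunc.eapprox h n) (N ω ∩ A)) atTop ∂P := by
        refine lintegral_congr fun ω => ?_
        exact (tendsto_pointProd hfin (fun p => SimpleFunc.tendsto_eapprox hm p) _).liminf_eq.symm
    _ ≤ liminf (fun n => ∫⁻ ω, pointProd (SimpleFunc.eapprox h n) (N ω ∩ A) ∂P) atTop :=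
        lintegral_liminf_le fun n => measurable_pointProd hA hcount (SimpleFunc.measurable _)
          fun p => (SimpleFunc.eapprox_lt_top h n p).ne
    _ ≤ _ := liminf_le_of_frequently_le' (Frequently.of_forall key)

end IsPoissonProcess

/-- The part of `R` whose points lie in exactly those members of the finite family `t` that
belong to `σ`. -/
def cell {E : Type*} (R : Set E) (t : Finset (Set E)) (σ : Set t) : Set E :=
  {e ∈ R | ∀ b : t, e ∈ b.1 ↔ b ∈ σ}

theorem measurableSet_cell {E : Type*} [MeasurableSpace E] {R : Set E} (hR : MeasurableSet R) {t : Finset (Set E)}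
    (ht : ∀ b ∈ t, MeasurableSet b) (σ : Set t) : MeasurableSet (cell R t σ) := by
  classical
  have h : cell R t σ = R ∩ ⋂ b : t, {e | e ∈ b.1 ↔ b ∈ σ} := by
    ext e
    simp [cell]
  rw [h]
  refine hR.inter (MeasurableSet.iInter fun b => ?_)
  by_cases hb : b ∈ σ
  · simpa [hb] using ht b b.2
  · have h' : {e | e ∈ b.1 ↔ b ∈ σ} = b.1ᶜ := by ext; simp [hb]
    rw [h']
    exact (ht b b.2).compl

theorem disjoint_cell {E : Type*} (R : Set E) (t : Finset (Set E)) {σ τ : Set t} (h : σ ≠ τ) :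
    Disjoint (cell R t σ) (cell R t τ) := by
  rw [Set.disjoint_left]
  intro e h1 h2
  exact h (Set.ext fun b => (h1.2 b).symm.trans (h2.2 b))

theorem encard_eq_sum_cell {E : Type*} (S R : Set E) (t : Finset (Set E)) (b : t) (hb : b.1 ⊆ R) :
    (S ∩ b.1).encard = ∑ᶠ σ : {σ : Set t // b ∈ σ}, (S ∩ cell R t σ.1).encard := by
  rw [← Set.encard_iUnion_of_finite]
  · congr 1
    ext e
    simp only [mem_inter_iff, mem_iUnion, cell, mem_ofPred_eq, Subtype.exists, exists_prop]
    constructor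
    · rintro ⟨h1, h2⟩
      exact ⟨{c | e ∈ c.1}, h2, h1, hb h2, fun c => Iff.rfl⟩
    · rintro ⟨σ, h1, h2, h3, h4⟩
      exact ⟨h2, (h4 b).2 h1⟩
  · intro σ τ h
    exact (disjoint_cell R t fun h' => h (Subtype.ext h')).mono inter_subset_right
      inter_subset_right

/-! ### Independence over disjoint regions, and absence of coincidences -/

namespace IsPoissonProcess

variable {Ω E : Type*} [MeasurableSpace Ω] [MeasurableSpace E] {P : Measure Ω}
  {N : Ω → Set E} {m : Measure E}

/-- Independence is postulated only for disjoint sets, whereas the sets generating `countSigma`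
overlap. On the π-system of events involving finitely many sets, these are cut into cells: every
count is a sum of cell counts, and the cells on both sides together form one disjoint family. -/
theorem indep_countSigma [IsProbabilityMeasure P] (hN : IsPoissonProcess P N m) {R R' : Set E}
    (hR : MeasurableSet R) (hR' : MeasurableSet R') (hd : Disjoint R R') :
    Indep (countSigma N R) (countSigma N R') P := by
  classical
  refine IndepSets.indep (hN.countSigma_le R) (hN.countSigma_le R')
    (isPiSystem_piiUnionInter _ (fun B => @MeasurableSpace.isPiSystem_measurableSet _
      (MeasurableSpace.comap (fun ω => (N ω ∩ B).encard) inferInstance)) _)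
    (isPiSystem_piiUnionInter _ (fun B => @MeasurableSpace.isPiSystem_measurableSet _
      (MeasurableSpace.comap (fun ω => (N ω ∩ B).encard) inferInstance)) _)
    (generateFrom_piiUnionInter_measurableSet _ _).symm
    (generateFrom_piiUnionInter_measurableSet _ _).symm ?_
  rw [IndepSets_iff]
  rintro s s' ⟨t, ht, f, hf, rfl⟩ ⟨t', ht', f', hf', rfl⟩
  let F : Set t ⊕ Set t' → Set E := Sum.elim (cell R t) (cell R' t')
  have hF : ∀ i, MeasurableSet (F i) := by
    rintro (σ | σ)
    · exact measurableSet_cell hR (fun b hb => (ht hb).1) σ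
    · exact measurableSet_cell hR' (fun b hb => (ht' hb).1) σ
  have hFd : Pairwise fun i j => Disjoint (F i) (F j) := by
    rintro (σ | σ) (τ | τ) h
    · exact disjoint_cell R t fun h' => h (congrArg _ h')
    · exact hd.mono (sep_subset _ _) (sep_subset _ _)
    · exact hd.symm.mono (sep_subset _ _) (sep_subset _ _)
    · exact disjoint_cell R' t' fun h' => h (congrArg _ h')
  let mF : Set t ⊕ Set t' → MeasurableSpace Ω := fun i =>
    MeasurableSpace.comap (fun ω => (N ω ∩ F i).encard) inferInstance
  have hmF : ∀ i, mF i ≤ (inferInstance : MeasurableSpace Ω) := fun i =>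
    (hN.measurable_count _ (hF i)).comap_le
  have hind : iIndep mF P := hN.iIndepFun_count hF hFd
  have hind2 := indep_iSup_of_disjoint hmF hind (S := range Sum.inl) (T := range Sum.inr)
    (by rw [Set.disjoint_left]; rintro _ ⟨σ, rfl⟩ ⟨τ, h⟩; cases h)
  rw [Indep_iff] at hind2
  refine hind2 _ _ ?_ ?_
  · refine Finset.measurableSet_biInter _ fun B hB => ?_
    refine (measurable_iff_comap_le.1 ?_ : MeasurableSpace.comap
      (fun ω => (N ω ∩ B).encard) inferInstance ≤ _) _ (hf B hB)
    simp_rw [fun ω => encard_eq_sum_cell (N ω) R t ⟨B, hB⟩ (ht hB).2, finsum_eq_sum_of_fintype]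
    refine Finset.measurable_sum _ fun σ _ => ?_
    rw [measurable_iff_comap_le]
    have hσ : (Sum.inl σ.1 : Set t ⊕ Set t') ∈ range (Sum.inl : _ → Set t ⊕ Set t') := ⟨_, rfl⟩
    exact le_biSup mF hσ
  · refine Finset.measurableSet_biInter _ fun B hB => ?_
    refine (measurable_iff_comap_le.1 ?_ : MeasurableSpace.comap
      (fun ω => (N ω ∩ B).encard) inferInstance ≤ _) _ (hf' B hB)
    simp_rw [fun ω => encard_eq_sum_cell (N ω) R' t' ⟨B, hB⟩ (ht' hB).2, finsum_eq_sum_of_fintype]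
    refine Finset.measurable_sum _ fun σ _ => ?_
    rw [measurable_iff_comap_le]
    have hσ : (Sum.inr σ.1 : Set t ⊕ Set t') ∈ range (Sum.inr : _ → Set t ⊕ Set t') := ⟨_, rfl⟩
    exact le_biSup mF hσ

theorem measure_count_zero (hN : IsPoissonProcess P N m) {B : Set E}
    (hB : MeasurableSet B) (hB' : m B ≠ ∞) :
    P {ω | N ω ∩ B = ∅} = ENNReal.ofReal (Real.exp (-(m B).toReal)) := by
  have h := hN.measure_count_eq hB hB' 0
  simpa using h

theorem ae_inter_eq_empty [IsProbabilityMeasure P] (hN : IsPoissonProcess P N m) {B : Set E}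
    (hB : MeasurableSet B) (hB' : m B = 0) : ∀ᵐ ω ∂P, N ω ∩ B = ∅ := by
  have h := hN.measure_count_zero hB (by simp [hB'])
  have hms : MeasurableSet {ω | N ω ∩ B = ∅} := by
    have := hN.measurable_count B hB (measurableSet_singleton 0)
    convert this using 1
    ext; simp
  rw [ae_iff]
  have := (prob_compl_eq_zero_iff hms).2 (by simpa [hB'] using h)
  exact this

/-- With mean `q ≤ r` the probability is `1 - (1 + q) e^{-q}`, and `e^{-q} ≥ 1 - q` bounds it by
`q²`. The square beats the number of strips in `ae_injOn`. -/
theorem measure_two_le_count_le [IsProbabilityMeasure P] (hN : IsPoissonProcess P N m) {B : Set E}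
    (hB : MeasurableSet B) {r : ℝ} (hr : 0 ≤ r) (hB' : m B ≤ ENNReal.ofReal r) :
    P {ω | 1 < (N ω ∩ B).encard} ≤ ENNReal.ofReal (r ^ 2) := by
  have hfin : m B ≠ ∞ := ne_top_of_le_ne_top ENNReal.ofReal_ne_top hB'
  have hle : (m B).toReal ≤ r := ENNReal.toReal_le_of_le_ofReal hr hB'
  set q := (m B).toReal with hq
  have hq0 : 0 ≤ q := ENNReal.toReal_nonneg
  have h0 := hN.measure_count_eq hB hfin 0
  have h1 := hN.measure_count_eq hB hfin 1
  have hm : ∀ k : ℕ, MeasurableSet {ω | (N ω ∩ B).encard = k} := fun k =>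
    hN.measurable_count B hB (measurableSet_singleton _)
  have hu : P ({ω | (N ω ∩ B).encard = (0 : ℕ)} ∪ {ω | (N ω ∩ B).encard = (1 : ℕ)})
      = ENNReal.ofReal (Real.exp (-q) * (1 + q)) := by
    rw [measure_union _ (hm 1), h0, h1, ← ENNReal.ofReal_add (by positivity) (by positivity)]
    · congr 1
      simp
      ring
    · rw [Set.disjoint_left]
      intro ω h h'
      simp only [mem_ofPred_eq] at h h'
      rw [h] at h'
      norm_num at h'
  have hc : {ω | 1 < (N ω ∩ B).encard}
      = ({ω | (N ω ∩ B).encard = (0 : ℕ)} ∪ {ω | (N ω ∩ B).encard = (1 : ℕ)})ᶜ := by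
    ext ω
    simp only [mem_ofPred_eq, mem_compl_iff, mem_union]
    generalize (N ω ∩ B).encard = n
    induction n with
    | top => simp
    | coe n => norm_cast; omega
  rw [hc, prob_compl_eq_one_sub ((hm 0).union (hm 1)), hu, ← ENNReal.ofReal_one,
    ← ENNReal.ofReal_sub _ (by positivity)]
  refine ENNReal.ofReal_le_ofReal ?_
  have := Real.add_one_le_exp (-q)
  have h2 : (-q + 1) * (1 + q) ≤ Real.exp (-q) * (1 + q) := by gcongr
  nlinarith

/-- If the intensity of the strips `u < π ≤ v` is at most `C (v - u)`, then almost surely no two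
points have the same coordinate `π`. -/
theorem ae_injOn [IsProbabilityMeasure P] (hN : IsPoissonProcess P N m) {A : Set E}
    (hA : MeasurableSet A) {π : E → ℝ} (hπ : Measurable π) {C T : ℝ} (hC : 0 ≤ C) (hT : 0 < T)
    (hAT : ∀ p ∈ A, π p ∈ Ioc 0 T)
    (hstrip : ∀ u v : ℝ, 0 ≤ u → u ≤ v →
      m (A ∩ π ⁻¹' Ioc u v) ≤ ENNReal.ofReal (C * (v - u))) :
    ∀ᵐ ω ∂P, InjOn π (N ω ∩ A) := by
  rw [ae_iff]
  have hb : ∀ n : ℕ, P {ω | ¬ InjOn π (N ω ∩ A)}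
      ≤ ENNReal.ofReal ((C * T) ^ 2 * (1 / ((n : ℝ) + 1))) := by
    -- Cut `(0, T]` into `n + 1` equal strips. A coincidence puts two points into one of them, which
    -- has probability at most `(n + 1) (C T / (n + 1))²`.
    intro n
    have hn : (0 : ℝ) < n + 1 := by positivity
    set B : ℕ → Set E := fun i => A ∩ π ⁻¹' Ioc (i * (T / (n + 1))) ((i + 1) * (T / (n + 1)))
      with hB
    have hsub : {ω | ¬ InjOn π (N ω ∩ A)}
        ⊆ ⋃ i ∈ Finset.range (n + 1), {ω | 1 < (N ω ∩ B i).encard} := by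
      intro ω hω
      simp only [mem_ofPred_eq, InjOn, not_forall] at hω
      obtain ⟨p, hp, q, hq, hpq, hne⟩ := hω
      obtain ⟨h0, h1⟩ := hAT p hp.2
      have hpos : 0 < π p / (T / (n + 1)) := by positivity
      -- The strips are open on the left, so the index is the ceiling minus one; the ceiling is
      -- positive because `π p > 0`.
      obtain ⟨i, hi⟩ : ∃ i : ℕ, ⌈π p / (T / (n + 1))⌉₊ = i + 1 :=
        ⟨_, (Nat.succ_pred_eq_of_pos (Nat.ceil_pos.2 hpos)).symm⟩
      have hile : i + 1 ≤ n + 1 := by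
        rw [← hi, Nat.ceil_le, div_le_iff₀ (by positivity)]
        push_cast
        field_simp
        exact h1
      have hmem : π p ∈ Ioc (i * (T / (n + 1))) ((i + 1) * (T / (n + 1))) := by
        constructor
        · have : i < ⌈π p / (T / (n + 1))⌉₊ := by omega
          rw [Nat.lt_ceil, lt_div_iff₀ (by positivity)] at this
          exact this
        · have := Nat.le_ceil (π p / (T / (n + 1)))
          rw [hi, div_le_iff₀ (by positivity)] at this
          exact_mod_cast this
      simp only [mem_iUnion, Finset.mem_range, mem_ofPred_eq, exists_prop]
      refine ⟨i, by omega, Set.one_lt_encard_iff.2 ⟨p, q, ⟨hp.1, hp.2, hmem⟩, ⟨hq.1, hq.2, ?_⟩, hne⟩⟩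
      rw [mem_preimage, ← hpq]
      exact hmem
    calc P {ω | ¬ InjOn π (N ω ∩ A)}
        ≤ ∑ i ∈ Finset.range (n + 1), P {ω | 1 < (N ω ∩ B i).encard} :=
          (measure_mono hsub).trans (measure_biUnion_finset_le _ _)
      _ ≤ ∑ i ∈ Finset.range (n + 1), ENNReal.ofReal ((C * (T / (n + 1))) ^ 2) := by
          refine Finset.sum_le_sum fun i _ => ?_
          refine hN.measure_two_le_count_le (hA.inter (hπ measurableSet_Ioc)) (by positivity) ?_
          refine (hstrip _ _ (by positivity) ?_).trans_eq ?_
          · gcongr; simp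
          · congr 1; ring
      _ = _ := by
          rw [Finset.sum_const, Finset.card_range, nsmul_eq_mul, ← ENNReal.ofReal_natCast,
            ← ENNReal.ofReal_mul (by positivity)]
          congr 1
          push_cast
          field_simp
  have hlim : Tendsto (fun n : ℕ => ENNReal.ofReal ((C * T) ^ 2 * (1 / ((n : ℝ) + 1)))) atTop (𝓝 0) := by
    have := (tendsto_one_div_add_atTop_nhds_zero_nat (𝕜 := ℝ)).const_mul ((C * T) ^ 2)
    rw [mul_zero] at this
    simpa using ENNReal.tendsto_ofReal this
  exact le_antisymm (ge_of_tendsto' hlim hb) zero_le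

end IsPoissonProcess

/-! ### Composition of the marks of a finite set in the order of time -/

section Iteration

/-- `l` lists the points of `Q` in strictly increasing order of time. -/
def IsTimeList (Q : Set (ℝ × ℝ × LipMap)) (l : List (ℝ × ℝ × LipMap)) : Prop :=
  l.Pairwise (fun p q => p.1 < q.1) ∧ {p | p ∈ l} = Q

/-- A finite set of points with distinct times. -/
structure IsTimed (Q : Set (ℝ × ℝ × LipMap)) : Prop where
  finite : Q.Finite
  injOn : InjOn Prod.fst Q

open Classical in
/-- The composition of the marks of the points of `Q` in the order of time, applied to `z`. -/
noncomputable def iter (Q : Set (ℝ × ℝ × LipMap)) (z : ℝ) : ℝ :=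
  if h : ∃ l, IsTimeList Q l then h.choose.foldr (fun p z => p.2.2 z) z else z

theorem sievedIterate_eq_iter (S : Set (ℝ × ℝ × LipMap)) (z₀ : ℝ) (A : Set ℝ) (t : ℝ) :
    sievedIterate S z₀ A t = iter (sievedAtoms S A t) z₀ := rfl

variable {Q Q₁ Q₂ : Set (ℝ × ℝ × LipMap)} {l : List (ℝ × ℝ × LipMap)}

theorem IsTimeList.nodup (hl : IsTimeList Q l) : l.Nodup :=
  hl.1.imp fun {a b} hab he => by simp [he] at hab

theorem IsTimeList.finite (hl : IsTimeList Q l) : Q.Finite := by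
  rw [← hl.2]
  exact l.finite_toSet

theorem IsTimeList.unique {l' : List (ℝ × ℝ × LipMap)} (hl : IsTimeList Q l)
    (hl' : IsTimeList Q l') : l = l' := by
  refine List.Perm.eq_of_pairwise (fun a b _ _ hab hba => absurd hab (lt_asymm hba)) hl.1 hl'.1 ?_
  rw [List.perm_ext_iff_of_nodup hl.nodup hl'.nodup]
  intro p
  exact Set.ext_iff.1 (hl.2.trans hl'.2.symm) p

theorem IsTimeList.iter_eq (hl : IsTimeList Q l) (z : ℝ) :
    iter Q z = l.foldr (fun p z => p.2.2 z) z := by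
  have h : ∃ l, IsTimeList Q l := ⟨l, hl⟩
  rw [iter, dif_pos h, h.choose_spec.unique hl]

theorem IsTimeList.pointProd_eq (hl : IsTimeList Q l) (h : ℝ × ℝ × LipMap → ℝ≥0∞) :
    pointProd h Q = (l.map h).prod := by
  classical
  have : Q = (l.toFinset : Set _) := by
    rw [← hl.2]
    ext p
    simp
  rw [this, pointProd_coe, List.prod_toFinset _ hl.nodup]

theorem IsTimeList.encard_eq (hl : IsTimeList Q l) : Q.encard = l.length := by
  classical
  have : Q = (l.toFinset : Set _) := by
    rw [← hl.2]
    ext p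
    simp
  rw [this, Set.encard_coe_eq_coe_finsetCard, List.toFinset_card_of_nodup hl.nodup]

theorem IsTimed.exists_isTimeList (hQ : IsTimed Q) : ∃ l, IsTimeList Q l := by
  classical
  let l := List.insertionSort (fun p q : ℝ × ℝ × LipMap => p.1 ≤ q.1) hQ.finite.toFinset.toList
  have : Std.Total (fun p q : ℝ × ℝ × LipMap => p.1 ≤ q.1) := ⟨fun p q => le_total p.1 q.1⟩
  have : IsTrans (ℝ × ℝ × LipMap) (fun p q => p.1 ≤ q.1) := ⟨fun _ _ _ => le_trans⟩
  have hperm : l.Perm hQ.finite.toFinset.toList := List.perm_insertionSort _ _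
  have hmem : ∀ p, p ∈ l ↔ p ∈ Q := fun p => by simp [hperm.mem_iff]
  have hnd : l.Nodup := hperm.nodup_iff.2 (Finset.nodup_toList _)
  have hs : l.Pairwise (fun p q => p.1 ≤ q.1) := List.pairwise_insertionSort _ _
  refine ⟨l, ?_, Set.ext hmem⟩
  refine (hs.and hnd).imp_of_mem fun {p q} hp hq h => lt_of_le_of_ne h.1 fun he => h.2 ?_
  exact hQ.injOn ((hmem p).1 hp) ((hmem q).1 hq) he

theorem IsTimed.mono (hQ : IsTimed Q) (h : Q₁ ⊆ Q) : IsTimed Q₁ :=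
  ⟨hQ.finite.subset h, hQ.injOn.mono h⟩

theorem iter_empty (z : ℝ) : iter ∅ z = z :=
  IsTimeList.iter_eq (l := []) ⟨List.Pairwise.nil, by ext; simp⟩ z

theorem iter_singleton (p : ℝ × ℝ × LipMap) (z : ℝ) : iter {p} z = p.2.2 z :=
  IsTimeList.iter_eq (l := [p]) ⟨List.pairwise_singleton _ _, by ext; simp⟩ z

theorem IsTimed.iter_union (h₁ : IsTimed Q₁) (h₂ : IsTimed Q₂)
    (hlt : ∀ p ∈ Q₁, ∀ q ∈ Q₂, p.1 < q.1) (z : ℝ) : iter (Q₁ ∪ Q₂) z = iter Q₁ (iter Q₂ z) := by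
  obtain ⟨l₁, hl₁⟩ := h₁.exists_isTimeList
  obtain ⟨l₂, hl₂⟩ := h₂.exists_isTimeList
  have h : IsTimeList (Q₁ ∪ Q₂) (l₁ ++ l₂) := by
    refine ⟨List.pairwise_append.2 ⟨hl₁.1, hl₂.1, fun p hp q hq => ?_⟩, ?_⟩
    · exact hlt p (hl₁.2 ▸ hp) q (hl₂.2 ▸ hq)
    · rw [← hl₁.2, ← hl₂.2]
      ext p
      simp
  rw [h.iter_eq, hl₁.iter_eq, hl₂.iter_eq, List.foldr_append]

theorem IsTimed.edist_iter_le (hQ : IsTimed Q) (z w : ℝ) :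
    edist (iter Q z) (iter Q w) ≤ pointProd (fun p => lipConst p.2.2) Q * edist z w := by
  obtain ⟨l, hl⟩ := hQ.exists_isTimeList
  rw [hl.iter_eq, hl.iter_eq, hl.pointProd_eq]
  clear hl
  induction l with
  | nil => simp
  | cons p l ih =>
    simp only [List.foldr_cons, List.map_cons, List.prod_cons, mul_assoc]
    exact (p.2.2.edist_apply_le _ _).trans (by gcongr)

/-- Displacements add up, but only products over points have tractable Poisson moments. Adding `1`
makes the estimate multiplicative: with `M = max 1 L`, `1 + M e + d ≤ M (1 + d)(1 + e)`. -/
theorem IsTimed.one_add_edist_iter_le (hQ : IsTimed Q) (z : ℝ) :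
    1 + edist (iter Q z) z
      ≤ pointProd (fun p => max 1 (lipConst p.2.2) * (1 + edist (p.2.2 z) z)) Q := by
  obtain ⟨l, hl⟩ := hQ.exists_isTimeList
  rw [hl.iter_eq, hl.pointProd_eq]
  clear hl
  induction l with
  | nil => simp
  | cons p l ih =>
    simp only [List.foldr_cons, List.map_cons, List.prod_cons]
    refine le_trans ?_ (mul_le_mul_right ih _)
    set w := l.foldr (fun p z => p.2.2 z) z
    set M := max 1 (lipConst p.2.2) with hM
    set d := edist (p.2.2 z) z
    set e := edist w z
    have h1 : (1 : ℝ≥0∞) ≤ M := le_max_left _ _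
    have h2 : edist (p.2.2 w) z ≤ M * e + d :=
      (edist_triangle _ (p.2.2 z) _).trans (add_le_add ((p.2.2.edist_apply_le _ _).trans
        (mul_le_mul_left (le_max_right _ _) _)) le_rfl)
    calc 1 + edist (p.2.2 w) z ≤ 1 + (M * e + d) := by gcongr
      _ ≤ M * 1 + (M * e + M * d) := by
        gcongr
        · simpa using h1
        · exact le_mul_of_one_le_left' h1
      _ ≤ M * 1 + (M * e + M * d) + M * d * e := le_self_add
      _ = _ := by ring

/-- If every mark of `Q` contracts towards `c` up to an error, so does the composition. -/
theorem IsTimed.dist_iter_le (hQ : IsTimed Q) {c ρ η : ℝ} (hρ : 0 ≤ ρ)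
    (h : ∀ p ∈ Q, ∀ z, dist (p.2.2 z) c ≤ ρ * dist z c + (1 - ρ) * η) {k : ℕ}
    (hk : Q.encard = k) (z : ℝ) :
    dist (iter Q z) c ≤ ρ ^ k * dist z c + (1 - ρ ^ k) * η := by
  obtain ⟨l, hl⟩ := hQ.exists_isTimeList
  have hk' : l.length = k := by
    have := hl.encard_eq.symm.trans hk
    exact_mod_cast this
  have h' : ∀ p ∈ l, ∀ z, dist (p.2.2 z) c ≤ ρ * dist z c + (1 - ρ) * η := fun p hp =>
    h p (hl.2 ▸ hp)
  rw [hl.iter_eq, ← hk']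
  clear hl hk' h
  induction l with
  | nil => simp
  | cons p l ih =>
    simp only [List.foldr_cons, List.length_cons]
    refine (h' p (by simp) _).trans ?_
    have := mul_le_mul_of_nonneg_left (ih fun q hq => h' q (by simp [hq])) hρ
    rw [pow_succ]
    linarith

end Iteration

theorem pointProd_union {E : Type*} (h : E → ℝ≥0∞) {Q₁ Q₂ : Set E} (h₁ : Q₁.Finite)
    (h₂ : Q₂.Finite) (hd : Disjoint Q₁ Q₂) :
    pointProd h (Q₁ ∪ Q₂) = pointProd h Q₁ * pointProd h Q₂ := by
  classical
  lift Q₁ to Finset E using h₁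
  lift Q₂ to Finset E using h₂
  rw [← Finset.coe_union, pointProd_coe, pointProd_coe, pointProd_coe,
    Finset.prod_union (by exact_mod_cast hd)]

theorem pointProd_le {E : Type*} {h h' : E → ℝ≥0∞} {Q Q' : Set E} (hQ' : Q'.Finite) (hsub : Q ⊆ Q')
    (hle : ∀ p ∈ Q, h p ≤ h' p) (hone : ∀ p ∈ Q', p ∉ Q → 1 ≤ h' p) :
    pointProd h Q ≤ pointProd h' Q' := by
  classical
  have hQ := hQ'.subset hsub
  lift Q to Finset E using hQ
  lift Q' to Finset E using hQ'
  rw [pointProd_coe, pointProd_coe, ← Finset.prod_sdiff (by exact_mod_cast hsub : Q ⊆ Q')]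
  calc ∏ p ∈ Q, h p ≤ ∏ p ∈ Q, h' p := Finset.prod_le_prod' fun p hp => hle p hp
    _ ≤ _ := le_mul_of_one_le_left' (Finset.one_le_prod' fun p hp => by
      rw [Finset.mem_sdiff] at hp
      exact hone p hp.1 hp.2)

/-- The properties that almost all configurations of the half-line process have. -/
structure IsRegularConfig (S : Set (ℝ × ℝ × LipMap)) : Prop where
  pos : ∀ p ∈ S, 0 < p.1 ∧ 0 < p.2.1
  finite : ∀ t x : ℝ, (S ∩ Icc 0 t ×ˢ Icc 0 x ×ˢ univ).Finite
  injOn_time : InjOn (fun p => p.1) S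
  injOn_height : InjOn (fun p => p.2.1) S

/-- The points of `S` with time in `(s, t]` and height in `A`. -/
def window (S : Set (ℝ × ℝ × LipMap)) (A : Set ℝ) (s t : ℝ) : Set (ℝ × ℝ × LipMap) :=
  S ∩ Ioc s t ×ˢ A ×ˢ univ

theorem mem_window {S : Set (ℝ × ℝ × LipMap)} {A : Set ℝ} {s t : ℝ} {p : ℝ × ℝ × LipMap} :
    p ∈ window S A s t ↔ p ∈ S ∧ (s < p.1 ∧ p.1 ≤ t) ∧ p.2.1 ∈ A := by
  simp [window]

theorem window_self (S : Set (ℝ × ℝ × LipMap)) (A : Set ℝ) (s : ℝ) : window S A s s = ∅ := by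
  simp [window]

theorem window_union (S : Set (ℝ × ℝ × LipMap)) (A : Set ℝ) {s t u : ℝ} (h : s ≤ t) (h' : t ≤ u) :
    window S A s t ∪ window S A t u = window S A s u := by
  rw [window, window, window, ← inter_union_distrib_left, ← union_prod, Ioc_union_Ioc_eq_Ioc h h']

/-- The factor that a point contributes to the bound for the change of the backward iteration in
the `j`-th time block of length `b` after time `T`, uniformly over the sieves between `[0, x₁]`
and a larger interval. -/
noncomputable def blockFactor (z₀ T b x₁ : ℝ) (j : ℕ) (p : ℝ × ℝ × LipMap) : ℝ≥0∞ :=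
  if p.1 ≤ T + j * b then
    (if p.2.1 ≤ x₁ then lipConst p.2.2 else max 1 (lipConst p.2.2))
  else max 1 (lipConst p.2.2) * (1 + edist (p.2.2 z₀) z₀)

/-- The bound for the change of the backward iteration in the `j`-th time block. -/
noncomputable def blockTerm (S : Set (ℝ × ℝ × LipMap)) (z₀ T b x₁ x₃ : ℝ) (j : ℕ) : ℝ≥0∞ :=
  pointProd (blockFactor z₀ T b x₁ j) (S ∩ Ioc T (T + (j + 1) * b) ×ˢ Icc 0 x₃ ×ˢ univ)

/-! ### Convergence of the iterations from summable block bounds -/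

namespace IsRegularConfig

variable {S : Set (ℝ × ℝ × LipMap)} {A : Set ℝ} {z₀ T b x₁ x₃ : ℝ}

theorem isTimed (hS : IsRegularConfig S) {x : ℝ} (hA : A ⊆ Iic x) (s t : ℝ) :
    IsTimed (window S A s t) := by
  refine ⟨(hS.finite t x).subset fun p hp => ?_, hS.injOn_time.mono inter_subset_left⟩
  rw [mem_window] at hp
  obtain ⟨h1, h2, h3⟩ := hp
  have := hS.pos p h1
  exact ⟨h1, ⟨this.1.le, h2.2⟩, ⟨this.2.le, hA h3⟩, mem_univ _⟩

/-- No point has time `0`, so closed time intervals may be replaced by half-open ones, which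
concatenate without overlap. -/
theorem sievedAtoms_eq (hS : IsRegularConfig S) (A : Set ℝ) (t : ℝ) :
    sievedAtoms S A t = window S A 0 t := by
  ext p
  constructor
  · rintro ⟨h1, ⟨h2, h3⟩, h4⟩
    exact ⟨h1, ⟨(hS.pos p h1).1, h3⟩, h4⟩
  · rintro ⟨h1, ⟨h2, h3⟩, h4⟩
    exact ⟨h1, ⟨h2.le, h3⟩, h4⟩

theorem iter_window_split (hS : IsRegularConfig S) {x : ℝ} (hA : A ⊆ Iic x) {s t u : ℝ}
    (h : s ≤ t) (h' : t ≤ u) (z : ℝ) :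
    iter (window S A s u) z = iter (window S A s t) (iter (window S A t u) z) := by
  rw [← window_union S A h h', (hS.isTimed hA s t).iter_union (hS.isTimed hA t u)]
  intro p hp q hq
  exact (mem_window.1 hp).2.1.2.trans_lt (mem_window.1 hq).2.1.1

/-- The maps of the new block are applied first, so they displace `z₀`, and the earlier maps
multiply this displacement by their Lipschitz constants. Points of the large rectangle outside the
sieve or after `t` have factor at least `1`; including them removes the dependence on `A` and `t`.
-/
theorem edist_iter_window_le_blockTerm (hS : IsRegularConfig S) (h₁ : Icc 0 x₁ ⊆ A)
    (h₃ : A ⊆ Icc 0 x₃) (hb : 0 ≤ b) (j : ℕ) {t : ℝ} (ht : T + j * b ≤ t)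
    (ht' : t ≤ T + (j + 1) * b) :
    edist (iter (window S A T t) z₀) (iter (window S A T (T + j * b)) z₀)
      ≤ blockTerm S z₀ T b x₁ x₃ j := by
  have hA : A ⊆ Iic x₃ := fun x hx => (h₃ hx).2
  have hTj : T ≤ T + j * b := le_add_of_nonneg_right (by positivity)
  set W₁ := window S A T (T + j * b) with hW₁
  set W₂ := window S A (T + j * b) t with hW₂
  have t₁ : IsTimed W₁ := hS.isTimed hA _ _
  have t₂ : IsTimed W₂ := hS.isTimed hA _ _
  have hd : Disjoint W₁ W₂ := by
    rw [Set.disjoint_left]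
    intro p h h'
    exact absurd (mem_window.1 h).2.1.2 (not_le.2 (mem_window.1 h').2.1.1)
  rw [hS.iter_window_split hA hTj ht]
  refine (t₁.edist_iter_le _ _).trans ?_
  calc pointProd (fun p => lipConst p.2.2) W₁ * edist (iter W₂ z₀) z₀
      ≤ pointProd (blockFactor z₀ T b x₁ j) W₁ * pointProd (blockFactor z₀ T b x₁ j) W₂ := by
        gcongr
        · refine pointProd_le t₁.finite subset_rfl (fun p hp => ?_) fun p h h' => absurd h h'
          rw [blockFactor, if_pos (mem_window.1 hp).2.1.2]
          split_ifs
          · exact le_rfl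
          · exact le_max_right _ _
        · refine (le_add_self.trans (t₂.one_add_edist_iter_le z₀)).trans ?_
          refine pointProd_le t₂.finite subset_rfl (fun p hp => ?_) fun p h h' => absurd h h'
          rw [blockFactor, if_neg (not_le.2 (mem_window.1 hp).2.1.1)]
    _ = pointProd (blockFactor z₀ T b x₁ j) (W₁ ∪ W₂) := (pointProd_union _ t₁.finite t₂.finite hd).symm
    _ ≤ _ := by
        rw [hW₁, hW₂, window_union S A hTj ht]
        refine pointProd_le (hS.isTimed (fun x hx => hx.2) _ _).finite ?_ (fun p _ => le_rfl) ?_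
        · rintro p ⟨h1, h2, h3, h4⟩
          exact ⟨h1, ⟨h2.1, h2.2.trans ht'⟩, h₃ h3, h4⟩
        · rintro p ⟨h1, h2, h3, h4⟩ hp
          have hone : (1 : ℝ≥0∞) ≤ max 1 (lipConst p.2.2) := le_max_left _ _
          rw [blockFactor]
          split_ifs with h5 h6
          · exact absurd ⟨h1, ⟨h2.1, h5.trans ht⟩, h₁ ⟨h3.1, h6⟩, h4⟩ hp
          · exact hone
          · exact one_le_mul hone le_self_add

theorem edist_iter_window_le_tsum (hS : IsRegularConfig S) (h₁ : Icc 0 x₁ ⊆ A)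
    (h₃ : A ⊆ Icc 0 x₃) (hb : 0 < b) (j : ℕ) {t : ℝ} (ht : T + j * b ≤ t) :
    edist (iter (window S A T t) z₀) (iter (window S A T (T + j * b)) z₀)
      ≤ ∑' i, blockTerm S z₀ T b x₁ x₃ (i + j) := by
  -- The block containing `t`. The blocks from `j` up to `n - 1` are crossed completely and block
  -- `n` only up to `t`.
  obtain ⟨n, hn⟩ : ∃ n : ℕ, n = ⌊(t - T) / b⌋₊ := ⟨_, rfl⟩
  have h0 : 0 ≤ (t - T) / b := div_nonneg (by nlinarith [(Nat.cast_nonneg j : (0 : ℝ) ≤ j)]) hb.le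
  have hle : T + n * b ≤ t := by
    have := Nat.floor_le h0
    rw [← hn, le_div_iff₀ hb] at this
    linarith
  have hlt : t ≤ T + (n + 1) * b := by
    have := (Nat.lt_floor_add_one ((t - T) / b)).le
    rw [← hn, div_le_iff₀ hb] at this
    linarith
  have hjn : j ≤ n := by
    rw [hn, Nat.le_floor_iff h0, le_div_iff₀ hb]
    linarith
  obtain ⟨k, rfl⟩ := Nat.exists_eq_add_of_le hjn
  set f : ℕ → ℝ := fun i => iter (window S A T (T + i * b)) z₀ with hf
  have hstep : ∀ i, edist (f i) (f (i + 1)) ≤ blockTerm S z₀ T b x₁ x₃ i := by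
    intro i
    rw [edist_comm]
    have := hS.edist_iter_window_le_blockTerm (z₀ := z₀) (T := T) h₁ h₃ hb.le i
      (t := T + ((i + 1 : ℕ) : ℝ) * b) (by push_cast; nlinarith) (by push_cast; exact le_rfl)
    exact this
  have hsum : ∀ k, edist (f (j + k)) (f j)
      ≤ ∑ i ∈ Finset.range k, blockTerm S z₀ T b x₁ x₃ (i + j) := by
    intro k
    induction k with
    | zero => simp
    | succ k ih =>
      rw [Finset.sum_range_succ, add_comm (Finset.sum _ _)]
      refine (edist_triangle _ (f (j + k)) _).trans (add_le_add ?_ ih)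
      rw [edist_comm, add_comm k j]
      exact hstep (j + k)
  calc edist (iter (window S A T t) z₀) (f j)
      ≤ edist (iter (window S A T t) z₀) (f (j + k)) + edist (f (j + k)) (f j) :=
        edist_triangle _ _ _
    _ ≤ blockTerm S z₀ T b x₁ x₃ (k + j)
        + ∑ i ∈ Finset.range k, blockTerm S z₀ T b x₁ x₃ (i + j) := by
        refine add_le_add ?_ (hsum k)
        rw [add_comm k j]
        exact hS.edist_iter_window_le_blockTerm h₁ h₃ hb.le (j + k) hle hlt
    _ = ∑ i ∈ Finset.range (k + 1), blockTerm S z₀ T b x₁ x₃ (i + j) := by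
        rw [Finset.sum_range_succ, add_comm]
    _ ≤ _ := ENNReal.sum_le_tsum _

theorem edist_iter_window_start_le (hS : IsRegularConfig S) (h₁ : Icc 0 x₁ ⊆ A)
    (h₃ : A ⊆ Icc 0 x₃) (hb : 0 < b) {t : ℝ} (ht : T ≤ t) :
    edist (iter (window S A T t) z₀) z₀ ≤ ∑' i, blockTerm S z₀ T b x₁ x₃ i := by
  have := hS.edist_iter_window_le_tsum (z₀ := z₀) (T := T) h₁ h₃ hb 0 (t := t) (by simpa)
  simpa [window_self, iter_empty] using this

/-- The Cauchy bound is a tail of a convergent series that does not involve `A`, so the rate is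
common to all sieves between the two intervals. -/
theorem exists_tendsto_iter_window (hS : IsRegularConfig S) (h₁ : Icc 0 x₁ ⊆ A)
    (h₃ : A ⊆ Icc 0 x₃) (hb : 0 < b) (hsum : ∑' i, blockTerm S z₀ T b x₁ x₃ i ≠ ∞) :
    ∃ ℓ, Tendsto (fun t => iter (window S A T t) z₀) atTop (𝓝 ℓ) ∧
      ∀ j : ℕ, ∀ t ≥ T + j * b, edist (iter (window S A T t) z₀) ℓ
        ≤ 2 * ∑' i, blockTerm S z₀ T b x₁ x₃ (i + j) := by
  set F := fun t => iter (window S A T t) z₀ with hF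
  have hpair : ∀ j : ℕ, ∀ t ≥ T + j * b, ∀ u ≥ T + j * b, edist (F t) (F u)
      ≤ 2 * ∑' i, blockTerm S z₀ T b x₁ x₃ (i + j) := by
    intro j t ht u hu
    rw [two_mul]
    refine (edist_triangle_right _ _ (F (T + j * b))).trans (add_le_add ?_ ?_)
    · exact hS.edist_iter_window_le_tsum h₁ h₃ hb j ht
    · exact hS.edist_iter_window_le_tsum h₁ h₃ hb j hu
  have h0 : Tendsto (fun j => 2 * ∑' i, blockTerm S z₀ T b x₁ x₃ (i + j)) atTop (𝓝 0) := by
    have := ENNReal.Tendsto.const_mul (ENNReal.tendsto_sum_nat_add _ hsum)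
      (Or.inr (ENNReal.ofNat_ne_top (n := 2)))
    rwa [mul_zero] at this
  have hc : CauchySeq F := by
    rw [EMetric.cauchySeq_iff]
    intro ε hε
    obtain ⟨j, hj⟩ := (h0.eventually_lt_const hε).exists
    exact ⟨T + j * b, fun t ht u hu => (hpair j t ht u hu).trans_lt hj⟩
  obtain ⟨ℓ, hℓ⟩ := cauchySeq_tendsto_of_complete hc
  refine ⟨ℓ, hℓ, fun j t ht => ?_⟩
  refine le_of_tendsto (tendsto_const_nhds.edist hℓ) ?_
  filter_upwards [eventually_ge_atTop (T + j * b)] with u hu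
  exact hpair j t ht u hu

end IsRegularConfig

/-! ### Intensity of boxes -/

section Intensity

variable {ν : Measure LipMap} [IsProbabilityMeasure ν]

theorem halfLineIntensity_prod (I J : Set ℝ) (U : Set LipMap) :
    halfLineIntensity ν (I ×ˢ J ×ˢ U)
      = volume.restrict (Ici 0) I * (volume.restrict (Ici 0) J * ν U) := by
  rw [halfLineIntensity, Measure.prod_prod, Measure.prod_prod]

theorem volume_restrict_Ici_Ioc {a b : ℝ} (ha : 0 ≤ a) :
    volume.restrict (Ici 0) (Ioc a b) = ENNReal.ofReal (b - a) := by
  rw [Measure.restrict_apply measurableSet_Ioc, inter_eq_left.2 (show Ioc a b ⊆ Ici 0 from fun x hx => ha.trans hx.1.le),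
    Real.volume_Ioc]

theorem volume_restrict_Ici_Icc {a b : ℝ} (ha : 0 ≤ a) :
    volume.restrict (Ici 0) (Icc a b) = ENNReal.ofReal (b - a) := by
  rw [Measure.restrict_apply measurableSet_Icc, inter_eq_left.2 (show Icc a b ⊆ Ici 0 from fun x hx => ha.trans hx.1),
    Real.volume_Icc]

theorem volume_restrict_Ici_Iic_zero : volume.restrict (Ici (0 : ℝ)) (Iic 0) = 0 := by
  rw [Measure.restrict_apply measurableSet_Iic, inter_comm, Ici_inter_Iic, Icc_self]
  exact Real.volume_singleton

theorem setLIntegral_halfLineIntensity {I J : Set ℝ} {g : LipMap → ℝ≥0∞} (hg : Measurable g) :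
    ∫⁻ p in I ×ˢ J ×ˢ univ, g p.2.2 ∂(halfLineIntensity ν)
      = volume.restrict (Ici 0) I * (volume.restrict (Ici 0) J * ∫⁻ f, g f ∂ν) := by
  rw [halfLineIntensity, ← Measure.prod_restrict, ← Measure.prod_restrict, Measure.restrict_univ,
    lintegral_prod (fun p : ℝ × ℝ × LipMap => g p.2.2)
      (hg.comp measurable_snd.snd).aemeasurable]
  simp only [lintegral_const, Measure.restrict_apply_univ]
  rw [lintegral_prod (fun p : ℝ × LipMap => g p.2) (hg.comp measurable_snd).aemeasurable]
  simp only [lintegral_const, Measure.restrict_apply_univ]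
  ring

end Intensity

/-! ### Almost sure regularity of the configuration -/

section Regular

variable {Ω : Type*} [MeasurableSpace Ω] {P : Measure Ω} [IsProbabilityMeasure P]
  {ν : Measure LipMap} [IsProbabilityMeasure ν] {N : Ω → Set (ℝ × ℝ × LipMap)}

theorem IsPoissonProcess.ae_height_ne (hN : IsPoissonProcess P N (halfLineIntensity ν)) (x : ℝ) :
    ∀ᵐ ω ∂P, ∀ p ∈ N ω, p.2.1 ≠ x := by
  filter_upwards [hN.ae_inter_eq_empty (B := univ ×ˢ {x} ×ˢ univ)
    (MeasurableSet.univ.prod ((measurableSet_singleton x).prod MeasurableSet.univ)) (by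
      rw [halfLineIntensity_prod]; simp)] with ω h p hp hx
  have : p ∈ N ω ∩ univ ×ˢ {x} ×ˢ univ := ⟨hp, mem_univ _, hx, mem_univ _⟩
  rw [h] at this
  exact this

theorem IsPoissonProcess.ae_isRegularConfig (hN : IsPoissonProcess P N (halfLineIntensity ν)) :
    ∀ᵐ ω ∂P, IsRegularConfig (N ω) := by
  have htime := hN.ae_inter_eq_empty (B := Iic 0 ×ˢ univ ×ˢ univ)
    (measurableSet_Iic.prod (MeasurableSet.univ.prod MeasurableSet.univ)) (by
      rw [halfLineIntensity_prod, volume_restrict_Ici_Iic_zero, zero_mul])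
  have hheight := hN.ae_inter_eq_empty (B := univ ×ˢ Iic 0 ×ˢ univ)
    (MeasurableSet.univ.prod (measurableSet_Iic.prod MeasurableSet.univ)) (by
      rw [halfLineIntensity_prod, volume_restrict_Ici_Iic_zero, zero_mul, mul_zero])
  have hfin : ∀ᵐ ω ∂P, ∀ n : ℕ, (N ω ∩ Icc 0 (n : ℝ) ×ˢ Icc 0 (n : ℝ) ×ˢ univ).Finite := by
    refine ae_all_iff.2 fun n => hN.ae_finite_inter
      (measurableSet_Icc.prod (measurableSet_Icc.prod MeasurableSet.univ)) ?_
    rw [halfLineIntensity_prod, volume_restrict_Ici_Icc le_rfl]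
    simp [ENNReal.mul_ne_top]
  have hms : ∀ n : ℕ, MeasurableSet (Ioc 0 ((n : ℝ) + 1) ×ˢ Ioc 0 ((n : ℝ) + 1) ×ˢ
      (univ : Set LipMap)) := fun n =>
    measurableSet_Ioc.prod (measurableSet_Ioc.prod MeasurableSet.univ)
  have hinj₁ : ∀ᵐ ω ∂P, ∀ n : ℕ, InjOn (fun p => p.1)
      (N ω ∩ Ioc 0 ((n : ℝ) + 1) ×ˢ Ioc 0 ((n : ℝ) + 1) ×ˢ univ) := by
    refine ae_all_iff.2 fun n => hN.ae_injOn (hms n) measurable_fst (C := n + 1) (T := n + 1)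
      (by positivity) (by positivity) (fun p hp => hp.1) fun u v hu huv => ?_
    refine (measure_mono (t := Ioc u v ×ˢ Ioc 0 ((n : ℝ) + 1) ×ˢ univ)
      fun p hp => ⟨hp.2, hp.1.2⟩).trans_eq ?_
    rw [halfLineIntensity_prod, volume_restrict_Ici_Ioc hu, volume_restrict_Ici_Ioc le_rfl,
      measure_univ, mul_one, ← ENNReal.ofReal_mul (by linarith)]
    congr 1
    ring
  have hinj₂ : ∀ᵐ ω ∂P, ∀ n : ℕ, InjOn (fun p => p.2.1)
      (N ω ∩ Ioc 0 ((n : ℝ) + 1) ×ˢ Ioc 0 ((n : ℝ) + 1) ×ˢ univ) := by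
    refine ae_all_iff.2 fun n => hN.ae_injOn (hms n) measurable_snd.fst (C := n + 1) (T := n + 1)
      (by positivity) (by positivity) (fun p hp => hp.2.1) fun u v hu huv => ?_
    refine (measure_mono (t := Ioc 0 ((n : ℝ) + 1) ×ˢ Ioc u v ×ˢ univ)
      fun p hp => ⟨hp.1.1, hp.2, mem_univ _⟩).trans_eq ?_
    rw [halfLineIntensity_prod, volume_restrict_Ici_Ioc hu, volume_restrict_Ici_Ioc le_rfl,
      measure_univ, mul_one, sub_zero, ← ENNReal.ofReal_mul (by positivity)]
  filter_upwards [htime, hheight, hfin, hinj₁, hinj₂] with ω h₁ h₂ h₃ h₄ h₅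
  have hpos : ∀ p ∈ N ω, 0 < p.1 ∧ 0 < p.2.1 := by
    intro p hp
    constructor
    · by_contra! h
      exact (h₁ ▸ (⟨hp, h, mem_univ _, mem_univ _⟩ : p ∈ N ω ∩ Iic 0 ×ˢ univ ×ˢ univ) :
        p ∈ (∅ : Set _))
    · by_contra! h
      exact (h₂ ▸ (⟨hp, mem_univ _, h, mem_univ _⟩ : p ∈ N ω ∩ univ ×ˢ Iic 0 ×ˢ univ) :
        p ∈ (∅ : Set _))
  have hbig : ∀ p ∈ N ω, ∀ q ∈ N ω, ∃ n : ℕ,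
      p ∈ N ω ∩ Ioc 0 ((n : ℝ) + 1) ×ˢ Ioc 0 ((n : ℝ) + 1) ×ˢ univ ∧
      q ∈ N ω ∩ Ioc 0 ((n : ℝ) + 1) ×ˢ Ioc 0 ((n : ℝ) + 1) ×ˢ univ := by
    intro p hp q hq
    obtain ⟨n, hn⟩ := exists_nat_ge (max (max p.1 p.2.1) (max q.1 q.2.1))
    simp only [max_le_iff] at hn
    obtain ⟨⟨a1, a2⟩, a3, a4⟩ := hn
    exact ⟨n, ⟨hp, ⟨(hpos p hp).1, by linarith⟩, ⟨(hpos p hp).2, by linarith⟩, mem_univ _⟩,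
      ⟨hq, ⟨(hpos q hq).1, by linarith⟩, ⟨(hpos q hq).2, by linarith⟩, mem_univ _⟩⟩
  refine ⟨hpos, fun t x => ?_, fun p hp q hq h => ?_, fun p hp q hq h => ?_⟩
  · obtain ⟨n, hn⟩ := exists_nat_ge (max t x)
    simp only [max_le_iff] at hn
    exact (h₃ n).subset (inter_subset_inter_right _ (prod_mono (Icc_subset_Icc_right hn.1)
      (prod_mono (Icc_subset_Icc_right hn.2) subset_rfl)))
  · obtain ⟨n, hp', hq'⟩ := hbig p hp q hq
    exact h₄ n hp' hq' h
  · obtain ⟨n, hp', hq'⟩ := hbig p hp q hq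
    exact h₅ n hp' hq' h

end Regular

/-! ### A fractional moment below one -/

section Moments

/-- Truncating the negative part of `log ℓ` at `n` gives a real exponent `u` with `ℓ ≤ e^u ≤ 1 + ℓ`,
also for `ℓ = 0`. So `u` can replace `log ℓ` without infinite values or loss of integrability. -/
theorem log_pos_neg_part_bounds (ℓ : ℝ≥0∞) (hℓ : ℓ ≠ ∞) (n : ℕ) :
    (ENNReal.log ℓ).toENNReal ≤ ℓ ∧
    ℓ ≤ ENNReal.ofReal (Real.exp ((ENNReal.log ℓ).toENNReal.toReal
      - (min (-ENNReal.log ℓ).toENNReal n).toReal)) ∧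
    Real.exp ((ENNReal.log ℓ).toENNReal.toReal - (min (-ENNReal.log ℓ).toENNReal n).toReal)
      ≤ 1 + ℓ.toReal := by
  rcases eq_or_ne ℓ 0 with rfl | h0
  · simp
  obtain ⟨s, rfl⟩ : ∃ s : ℝ, ℓ = ENNReal.ofReal (Real.exp s) :=
    ⟨Real.log ℓ.toReal, by rw [Real.exp_log (ENNReal.toReal_pos h0 hℓ), ENNReal.ofReal_toReal hℓ]⟩
  have hlog : ENNReal.log (ENNReal.ofReal (Real.exp s)) = s := by
    simp [ENNReal.log_ofReal, Real.exp_pos]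
  have hn : ((n : ℝ≥0∞)) = ENNReal.ofReal n := by simp
  have hneg : -(s : EReal) = ((-s : ℝ) : EReal) := by simp
  rw [hlog, hneg, EReal.toENNReal_of_ne_top (EReal.coe_ne_top _),
    EReal.toENNReal_of_ne_top (EReal.coe_ne_top _), EReal.toReal_coe, EReal.toReal_coe, hn, ← ENNReal.ofReal_min,
    ENNReal.toReal_ofReal', ENNReal.toReal_ofReal', ENNReal.toReal_ofReal (Real.exp_pos s).le]
  have hs : s ≤ Real.exp s := by linarith [Real.add_one_le_exp s]
  refine ⟨ENNReal.ofReal_le_ofReal hs, ENNReal.ofReal_le_ofReal (Real.exp_le_exp.2 ?_), ?_⟩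
  · have : max (min (-s) (n : ℝ)) 0 ≤ max (-s) 0 := max_le_max_right _ (min_le_left _ _)
    have h2 : max s 0 - max (-s) 0 = s := by
      rcases le_total s 0 with h | h
      · rw [max_eq_right h, max_eq_left (by linarith)]; ring
      · rw [max_eq_left h, max_eq_right (by linarith)]; ring
    linarith
  · have h1 : 0 ≤ max (min (-s) (n : ℝ)) 0 := le_max_right _ _
    refine (Real.exp_le_exp.2 (sub_le_self _ h1)).trans ?_
    rcases le_total s 0 with h | h
    · rw [max_eq_right h, Real.exp_zero]
      linarith [Real.exp_pos s]
    · rw [max_eq_left h]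
      linarith

/-- Convexity of `exp` places the quotient between `u` and `e^u`, a domination independent of `θ`.
-/
theorem abs_exp_sub_one_div_le (u : ℝ) {θ : ℝ} (h0 : 0 < θ) (h1 : θ ≤ 1) :
    |(Real.exp (θ * u) - 1) / θ| ≤ |u| + Real.exp u := by
  have hlow : u ≤ (Real.exp (θ * u) - 1) / θ := by
    rw [le_div_iff₀ h0]
    linarith [Real.add_one_le_exp (θ * u)]
  have hconv := convexOn_exp.2 (mem_univ u) (mem_univ 0) h0.le (by linarith : (0 : ℝ) ≤ 1 - θ)
    (by ring)
  simp only [smul_eq_mul, mul_zero, add_zero, Real.exp_zero, mul_one] at hconv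
  have hup : (Real.exp (θ * u) - 1) / θ ≤ Real.exp u := by
    rw [div_le_iff₀ h0]
    linarith
  rw [abs_le]
  constructor
  · linarith [neg_abs_le u, Real.exp_pos u]
  · linarith [abs_nonneg u]

theorem tendsto_exp_sub_one_div (u : ℝ) :
    Tendsto (fun k : ℕ => (Real.exp ((1 / ((k : ℝ) + 1) / 2) * u) - 1) / (1 / ((k : ℝ) + 1) / 2))
      atTop (𝓝 u) := by
  have h : HasDerivAt (fun θ : ℝ => Real.exp (θ * u)) u 0 := by
    have := ((hasDerivAt_id (0 : ℝ)).mul_const u).exp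
    simpa using this
  rw [hasDerivAt_iff_tendsto_slope_zero] at h
  have ht : Tendsto (fun k : ℕ => 1 / ((k : ℝ) + 1) / 2) atTop (𝓝[≠] 0) := by
    refine tendsto_nhdsWithin_iff.2 ⟨?_, Eventually.of_forall fun k => ?_⟩
    · simpa using (tendsto_one_div_add_atTop_nhds_zero_nat (𝕜 := ℝ)).div_const 2
    · have : (0 : ℝ) < 1 / ((k : ℝ) + 1) / 2 := by positivity
      exact this.ne'
  refine (h.comp ht).congr fun k => ?_
  simp only [Function.comp, zero_add, zero_mul, Real.exp_zero, smul_eq_mul]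
  exact (div_eq_inv_mul _ _).symm

variable {ν : Measure LipMap} [IsProbabilityMeasure ν]

/-- The difference quotients of `θ ↦ E e^{θu}` at `0` tend to `E u < 0`, so this moment is below `1`
for some small `θ`. Here `u` is the truncated logarithm, and `L ≤ e^u`. The restriction `θ ≤ 1/2`
serves `lintegral_max_mul_rpow_ne_top`. -/
theorem IsContractiveInMean.exists_rpow_lt_one (hν : IsContractiveInMean ν) :
    ∃ θ : ℝ, 0 < θ ∧ θ ≤ 1 / 2 ∧ ∃ α : ℝ, 0 ≤ α ∧ α < 1 ∧
      ∫⁻ f, lipConst f ^ θ ∂ν ≤ ENNReal.ofReal α := by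
  obtain ⟨hfin, hlog⟩ := hν
  have hmL := LipMap.measurable_lipConst
  have hmlog : Measurable fun f : LipMap => ENNReal.log (lipConst f) :=
    ENNReal.measurable_log.comp hmL
  have hm₁ : Measurable fun f : LipMap => (ENNReal.log (lipConst f)).toENNReal :=
    hmlog.ereal_toENNReal
  have hm₂ : Measurable fun f : LipMap => (-ENNReal.log (lipConst f)).toENNReal :=
    hmlog.neg.ereal_toENNReal
  -- By monotone convergence, truncation at a high enough level keeps the strict inequality while
  -- making the negative part integrable.
  obtain ⟨n, hn⟩ : ∃ n : ℕ, ∫⁻ f, (ENNReal.log (lipConst f)).toENNReal ∂ν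
      < ∫⁻ f, min (-ENNReal.log (lipConst f)).toENNReal (n : ℝ≥0∞) ∂ν := by
    have h1 : ∫⁻ f : LipMap, (-ENNReal.log (lipConst f)).toENNReal ∂ν
        = ⨆ n : ℕ, ∫⁻ f : LipMap, min (-ENNReal.log (lipConst f)).toENNReal (n : ℝ≥0∞) ∂ν := by
      rw [← lintegral_iSup (fun n => hm₂.min measurable_const)]
      · refine lintegral_congr fun f => ?_
        have := (ENNReal.iSup_natCast)
        rw [← inf_iSup_eq, this, inf_top_eq]
      · intro i j hij f
        exact min_le_min_left _ (by exact_mod_cast hij)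
    rw [h1] at hlog
    exact lt_iSup_iff.1 hlog
  set a : LipMap → ℝ≥0∞ := fun f => (ENNReal.log (lipConst f)).toENNReal with ha
  set c : LipMap → ℝ≥0∞ := fun f => min (-ENNReal.log (lipConst f)).toENNReal (n : ℝ≥0∞) with hc
  have hmc : Measurable c := hm₂.min measurable_const
  have hafin : ∫⁻ f, a f ∂ν ≠ ∞ := ((lintegral_mono fun f =>
    (log_pos_neg_part_bounds _ f.lipConst_ne_top n).1).trans_lt hfin).ne
  have hcfin : ∫⁻ f, c f ∂ν ≠ ∞ := by
    refine ((lintegral_mono (g := fun _ => (n : ℝ≥0∞)) fun f => min_le_right _ _).trans_lt ?_).ne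
    simp
  have hia : Integrable (fun f => (a f).toReal) ν := integrable_toReal_of_lintegral_ne_top
    hm₁.aemeasurable hafin
  have hic : Integrable (fun f => (c f).toReal) ν := integrable_toReal_of_lintegral_ne_top
    hmc.aemeasurable hcfin
  set u : LipMap → ℝ := fun f => (a f).toReal - (c f).toReal with hu
  have hmu : Measurable u := hm₁.ennreal_toReal.sub hmc.ennreal_toReal
  have hiu : Integrable u ν := hia.sub hic
  have hneg : ∫ f, u f ∂ν < 0 := by
    have hat : ∀ᵐ f ∂ν, a f < ∞ := ae_lt_top hm₁ hafin
    have hct : ∀ᵐ f ∂ν, c f < ∞ := ae_lt_top hmc hcfin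
    rw [hu, integral_sub hia hic, integral_toReal hm₁.aemeasurable hat,
      integral_toReal hmc.aemeasurable hct, sub_neg]
    exact (ENNReal.toReal_lt_toReal hafin hcfin).2 hn
  have hiL : Integrable (fun f : LipMap => (lipConst f).toReal) ν :=
    integrable_toReal_of_lintegral_ne_top hmL.aemeasurable hfin.ne
  have hie : Integrable (fun f => Real.exp (u f)) ν := by
    refine ((integrable_const (1 : ℝ)).add hiL).mono' hmu.exp.aestronglyMeasurable
      (Eventually.of_forall fun f => ?_)
    rw [Real.norm_eq_abs, abs_of_pos (Real.exp_pos _)]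
    exact (log_pos_neg_part_bounds _ f.lipConst_ne_top n).2.2
  have hlim : Tendsto (fun k : ℕ => ∫ f, (Real.exp ((1 / ((k : ℝ) + 1) / 2) * u f) - 1)
      / (1 / ((k : ℝ) + 1) / 2) ∂ν) atTop (𝓝 (∫ f, u f ∂ν)) := by
    refine tendsto_integral_of_dominated_convergence (fun f => |u f| + Real.exp (u f))
      (fun k => ?_) (hiu.abs.add hie) (fun k => Eventually.of_forall fun f => ?_)
      (Eventually.of_forall fun f => tendsto_exp_sub_one_div (u f))
    · exact (((hmu.const_mul _).exp.sub_const _).div_const _).aestronglyMeasurable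
    · refine abs_exp_sub_one_div_le _ (by positivity) ?_
      rw [div_div, div_le_one (by positivity)]
      linarith [(Nat.cast_nonneg k : (0 : ℝ) ≤ k)]
  obtain ⟨k, hk⟩ := (hlim.eventually_lt_const hneg).exists
  set θ : ℝ := 1 / ((k : ℝ) + 1) / 2 with hθ
  have hθ0 : 0 < θ := by positivity
  have hθ1 : θ ≤ 1 / 2 := by
    rw [hθ]
    refine div_le_div_of_nonneg_right ?_ zero_le_two
    rw [div_le_one (by positivity)]
    linarith [(Nat.cast_nonneg k : (0 : ℝ) ≤ k)]
  have hieθ : Integrable (fun f => Real.exp (θ * u f)) ν := by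
    refine ((integrable_const (1 : ℝ)).add hie).mono' (hmu.const_mul _).exp.aestronglyMeasurable
      (Eventually.of_forall fun f => ?_)
    rw [Real.norm_eq_abs, abs_of_pos (Real.exp_pos _)]
    simp only [Pi.add_apply]
    rcases le_total (u f) 0 with h | h
    · have : Real.exp (θ * u f) ≤ 1 := Real.exp_le_one_iff.2 (by nlinarith)
      linarith [Real.exp_pos (u f)]
    · have : Real.exp (θ * u f) ≤ Real.exp (u f) := Real.exp_le_exp.2 (by nlinarith)
      linarith
  refine ⟨θ, hθ0, hθ1, ∫ f, Real.exp (θ * u f) ∂ν, integral_nonneg fun f => (Real.exp_pos _).le,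
    ?_, ?_⟩
  · rw [integral_div, integral_sub hieθ (integrable_const _), div_neg_iff] at hk
    rcases hk with hk | hk
    · linarith [hk.2]
    · simpa using hk.1
  · rw [ofReal_integral_eq_lintegral_ofReal hieθ (Eventually.of_forall fun f => (Real.exp_pos _).le)]
    refine lintegral_mono fun f => ?_
    rw [mul_comm, Real.exp_mul, ← ENNReal.ofReal_rpow_of_pos (Real.exp_pos _)]
    exact ENNReal.rpow_le_rpow (log_pos_neg_part_bounds _ f.lipConst_ne_top n).2.1 hθ0.le

theorem lintegral_max_one_rpow_ne_top (hν : ∫⁻ f : LipMap, lipConst f ∂ν ≠ ∞) {θ : ℝ}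
    (h1 : θ ≤ 1) : ∫⁻ f : LipMap, max 1 (lipConst f) ^ θ ∂ν ≠ ∞ := by
  refine ne_top_of_le_ne_top (b := ∫⁻ f : LipMap, (1 + lipConst f) ∂ν) ?_
    (lintegral_mono fun f => ?_)
  · rw [lintegral_add_left measurable_const]
    simpa using hν
  · refine (ENNReal.rpow_le_rpow_of_exponent_le (le_max_left _ _) h1).trans ?_
    rw [ENNReal.rpow_one]
    exact max_le le_self_add le_add_self

theorem lintegral_edist_self_ne_top (hν : ∫⁻ f : LipMap, lipConst f ∂ν ≠ ∞) {z : ℝ}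
    (hz : ∫⁻ f : LipMap, edist (f z) z ∂ν < ∞) (z₀ : ℝ) :
    ∫⁻ f : LipMap, edist (f z₀) z₀ ∂ν ≠ ∞ := by
  refine ne_top_of_le_ne_top (b := ∫⁻ f : LipMap, (lipConst f * edist z₀ z + edist (f z) z
    + edist z z₀) ∂ν) ?_ (lintegral_mono fun f => ?_)
  · rw [lintegral_add_right _ measurable_const, lintegral_add_right _
      (LipMap.measurable_edist_eval z z), lintegral_mul_const _ LipMap.measurable_lipConst]
    simp [ENNReal.mul_ne_top hν (edist_ne_top _ _), hz.ne]
  · exact (edist_triangle4 _ (f z) z _).trans (by gcongr; exact f.edist_apply_le _ _)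

/-- The two factors are dependent and have only first moments; `(x y)^{1/2} ≤ max x y` is the reason
for the exponent `1/2`. -/
theorem lintegral_max_mul_rpow_ne_top (hν : ∫⁻ f : LipMap, lipConst f ∂ν ≠ ∞) {z₀ : ℝ}
    (hz : ∫⁻ f : LipMap, edist (f z₀) z₀ ∂ν ≠ ∞) {θ : ℝ} (h1 : θ ≤ 1 / 2) :
    ∫⁻ f : LipMap, (max 1 (lipConst f) * (1 + edist (f z₀) z₀)) ^ θ ∂ν ≠ ∞ := by
  refine ne_top_of_le_ne_top (b := ∫⁻ f : LipMap, ((1 + lipConst f) + (1 + edist (f z₀) z₀)) ∂ν) ?_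
    (lintegral_mono fun f => ?_)
  · rw [lintegral_add_left (f := fun f : LipMap => 1 + lipConst f)
        (measurable_const.add LipMap.measurable_lipConst),
      lintegral_add_left measurable_const, lintegral_add_left measurable_const]
    simp [hν, hz]
  · set x := max 1 (lipConst f)
    set y := 1 + edist (f z₀) z₀
    have hx : 1 ≤ x := le_max_left _ _
    have hy : 1 ≤ y := le_self_add
    calc (x * y) ^ θ ≤ (x * y) ^ (1 / 2 : ℝ) :=
          ENNReal.rpow_le_rpow_of_exponent_le (one_le_mul hx hy) h1
      _ ≤ ((max x y) ^ (2 : ℝ)) ^ (1 / 2 : ℝ) := by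
          refine ENNReal.rpow_le_rpow ?_ (by norm_num)
          rw [ENNReal.rpow_two, sq]
          exact mul_le_mul' (le_max_left _ _) (le_max_right _ _)
      _ = max x y := by rw [← ENNReal.rpow_mul]; norm_num
      _ ≤ _ := max_le ((max_le le_self_add le_add_self).trans le_self_add) le_add_self

end Moments

/-- Each `a j ^ θ` is at most `K`, hence `a j ≤ a j ^ θ * K ^ (1/θ - 1)`; then sum. This turns
bounds on `θ`-moments into summability of the block terms. -/
theorem ENNReal.tsum_rpow_le_rpow_tsum {a : ℕ → ℝ≥0∞} {θ : ℝ} (h0 : 0 < θ) (h1 : θ ≤ 1) {K : ℝ≥0∞}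
    (h : ∑' j, a j ^ θ ≤ K) : ∑' j, a j ≤ K ^ (1 / θ) := by
  have hle : ∀ j, a j ≤ a j ^ θ * K ^ (1 / θ - 1) := by
    intro j
    have h2 : a j ^ θ ≤ K := (ENNReal.le_tsum j).trans h
    have h3 : 0 ≤ 1 / θ - 1 := sub_nonneg.2 ((one_le_div h0).2 h1)
    calc a j = (a j ^ θ) ^ (1 / θ) := by
          rw [← ENNReal.rpow_mul, mul_one_div_cancel h0.ne', ENNReal.rpow_one]
      _ = (a j ^ θ) ^ (1 + (1 / θ - 1)) := by congr 1; ring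
      _ = (a j ^ θ) * (a j ^ θ) ^ (1 / θ - 1) := by
          rw [ENNReal.rpow_add_of_nonneg _ _ zero_le_one h3, ENNReal.rpow_one]
      _ ≤ _ := by gcongr
  calc ∑' j, a j ≤ ∑' j, a j ^ θ * K ^ (1 / θ - 1) := ENNReal.tsum_le_tsum hle
    _ = (∑' j, a j ^ θ) * K ^ (1 / θ - 1) := ENNReal.tsum_mul_right
    _ ≤ K * K ^ (1 / θ - 1) := by gcongr
    _ = K ^ (1 / θ) := by
        have h3 : 0 ≤ 1 / θ - 1 := sub_nonneg.2 ((one_le_div h0).2 h1)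
        nth_rewrite 1 [← ENNReal.rpow_one K]
        rw [← ENNReal.rpow_add_of_nonneg _ _ zero_le_one h3]
        congr 1
        ring

theorem measurable_blockFactor (z₀ T b x₁ : ℝ) (j : ℕ) : Measurable (blockFactor z₀ T b x₁ j) := by
  have hL : Measurable fun p : ℝ × ℝ × LipMap => lipConst p.2.2 :=
    LipMap.measurable_lipConst.comp measurable_snd.snd
  have hd : Measurable fun p : ℝ × ℝ × LipMap => edist (p.2.2 z₀) z₀ :=
    (LipMap.measurable_edist_eval z₀ z₀).comp measurable_snd.snd
  refine Measurable.ite (measurableSet_le measurable_fst measurable_const)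
    (Measurable.ite (measurableSet_le measurable_snd.fst measurable_const) hL
      (measurable_const.max hL)) ?_
  exact (measurable_const.max hL).mul (measurable_const.add hd)

theorem blockFactor_ne_top (z₀ T b x₁ : ℝ) (j : ℕ) (p : ℝ × ℝ × LipMap) :
    blockFactor z₀ T b x₁ j p ≠ ∞ := by
  have hL := p.2.2.lipConst_ne_top
  have hM : max 1 (lipConst p.2.2) ≠ ∞ := by simp [hL]
  rw [blockFactor]
  split_ifs
  · exact hL
  · exact hM
  · exact ENNReal.mul_ne_top hM (by simp [edist_ne_top])

theorem measurableSet_slab (I J : Set ℝ) (hI : MeasurableSet I) (hJ : MeasurableSet J) :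
    MeasurableSet (I ×ˢ J ×ˢ (univ : Set LipMap)) := hI.prod (hJ.prod MeasurableSet.univ)

theorem measurable_blockTerm_countSigma {Ω : Type*} {N : Ω → Set (ℝ × ℝ × LipMap)}
    {z₀ T b x₁ x₃ : ℝ} {j : ℕ} {R : Set (ℝ × ℝ × LipMap)}
    (hR : Ioc T (T + (j + 1) * b) ×ˢ Icc 0 x₃ ×ˢ univ ⊆ R) :
    Measurable[countSigma N R] fun ω => blockTerm (N ω) z₀ T b x₁ x₃ j :=
  measurable_pointProd_countSigma (measurableSet_slab _ _ measurableSet_Ioc measurableSet_Icc) hR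
    (measurable_blockFactor _ _ _ _ _) (blockFactor_ne_top _ _ _ _ _)

/-! ### Geometric decay of the moments of the block terms -/

section MomentBound

variable {Ω : Type*} [MeasurableSpace Ω] {P : Measure Ω}
  {ν : Measure LipMap} [IsProbabilityMeasure ν] {N : Ω → Set (ℝ × ℝ × LipMap)}

/-- The rectangle splits into the earlier blocks at heights in every sieve (factor `α`), the earlier
blocks at the undecided heights (`β`), and the last block (`γ`). -/
theorem setLIntegral_blockFactor_rpow_le {z₀ T b x₁ x₃ θ : ℝ} {α β γ : ℝ} (hT : 0 ≤ T)
    (hb : 0 ≤ b) (hx₁ : 0 ≤ x₁) (hx₃ : x₁ ≤ x₃) (hα : 0 ≤ α) (hβ : 0 ≤ β) (hγ : 0 ≤ γ)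
    (hLα : ∫⁻ f, lipConst f ^ θ ∂ν ≤ ENNReal.ofReal α)
    (hLβ : ∫⁻ f : LipMap, max 1 (lipConst f) ^ θ ∂ν ≤ ENNReal.ofReal β)
    (hLγ : ∫⁻ f : LipMap, (max 1 (lipConst f) * (1 + edist (f z₀) z₀)) ^ θ ∂ν ≤ ENNReal.ofReal γ)
    (j : ℕ) :
    ∫⁻ p in Ioc T (T + (j + 1) * b) ×ˢ Icc 0 x₃ ×ˢ univ, blockFactor z₀ T b x₁ j p ^ θ
      ∂(halfLineIntensity ν)
      ≤ ENNReal.ofReal (j * b * x₁ * α + j * b * (x₃ - x₁) * β + b * x₃ * γ) := by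
  have hjb : 0 ≤ j * b := by positivity
  have hL := LipMap.measurable_lipConst
  have hM : Measurable fun f : LipMap => max 1 (lipConst f) := measurable_const.max hL
  have hx₃' : 0 ≤ x₃ := hx₁.trans hx₃
  set A₁ : Set (ℝ × ℝ × LipMap) := Ioc T (T + j * b) ×ˢ Icc 0 x₁ ×ˢ univ
  set A₂ : Set (ℝ × ℝ × LipMap) := Ioc T (T + j * b) ×ˢ Ioc x₁ x₃ ×ˢ univ
  set A₃ : Set (ℝ × ℝ × LipMap) := Ioc (T + j * b) (T + (j + 1) * b) ×ˢ Icc 0 x₃ ×ˢ univ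
  have hsub : Ioc T (T + (j + 1) * b) ×ˢ Icc 0 x₃ ×ˢ (univ : Set LipMap) ⊆ A₁ ∪ (A₂ ∪ A₃) := by
    rintro p ⟨⟨h1, h2⟩, ⟨h3, h4⟩, h5⟩
    rcases le_or_gt p.1 (T + j * b) with h | h
    · rcases le_or_gt p.2.1 x₁ with h' | h'
      · exact Or.inl ⟨⟨h1, h⟩, ⟨h3, h'⟩, h5⟩
      · exact Or.inr (Or.inl ⟨⟨h1, h⟩, ⟨h', h4⟩, h5⟩)
    · exact Or.inr (Or.inr ⟨⟨h, h2⟩, ⟨h3, h4⟩, h5⟩)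
  have e₁ : ∫⁻ p in A₁, blockFactor z₀ T b x₁ j p ^ θ ∂(halfLineIntensity ν)
      ≤ ENNReal.ofReal (j * b * x₁ * α) := by
    rw [setLIntegral_congr_fun (g := fun p => lipConst p.2.2 ^ θ)
      (measurableSet_slab _ _ measurableSet_Ioc measurableSet_Icc) fun p hp => by
        simp only [blockFactor]
        rw [if_pos hp.1.2, if_pos hp.2.1.2],
      setLIntegral_halfLineIntensity (hL.pow_const θ), volume_restrict_Ici_Ioc hT,
      volume_restrict_Ici_Icc le_rfl, ENNReal.ofReal_mul (by positivity),
      ENNReal.ofReal_mul hjb, mul_assoc]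
    gcongr <;> simp
  have e₂ : ∫⁻ p in A₂, blockFactor z₀ T b x₁ j p ^ θ ∂(halfLineIntensity ν)
      ≤ ENNReal.ofReal (j * b * (x₃ - x₁) * β) := by
    rw [setLIntegral_congr_fun (g := fun p => max 1 (lipConst p.2.2) ^ θ)
      (measurableSet_slab _ _ measurableSet_Ioc measurableSet_Ioc) fun p hp => by
        simp only [blockFactor]
        rw [if_pos hp.1.2, if_neg (not_le.2 hp.2.1.1)],
      setLIntegral_halfLineIntensity (hM.pow_const θ), volume_restrict_Ici_Ioc hT,
      volume_restrict_Ici_Ioc hx₁,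
      ENNReal.ofReal_mul (mul_nonneg hjb (sub_nonneg.2 hx₃)),
      ENNReal.ofReal_mul hjb, mul_assoc]
    gcongr
    simp
  have e₃ : ∫⁻ p in A₃, blockFactor z₀ T b x₁ j p ^ θ ∂(halfLineIntensity ν)
      ≤ ENNReal.ofReal (b * x₃ * γ) := by
    rw [setLIntegral_congr_fun
      (g := fun p => (max 1 (lipConst p.2.2) * (1 + edist (p.2.2 z₀) z₀)) ^ θ)
      (measurableSet_slab _ _ measurableSet_Ioc measurableSet_Icc) fun p hp => by
        simp only [blockFactor]
        rw [if_neg (not_le.2 hp.1.1)],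
      setLIntegral_halfLineIntensity
        (g := fun f => (max 1 (lipConst f) * (1 + edist (f z₀) z₀)) ^ θ)
        ((hM.mul (measurable_const.add (LipMap.measurable_edist_eval z₀ z₀))).pow_const θ),
      volume_restrict_Ici_Ioc (by positivity), volume_restrict_Ici_Icc le_rfl,
      ENNReal.ofReal_mul (by positivity), ENNReal.ofReal_mul hb, mul_assoc]
    gcongr
    · linarith
    · simp
  calc _ ≤ ∫⁻ p in A₁ ∪ (A₂ ∪ A₃), blockFactor z₀ T b x₁ j p ^ θ ∂(halfLineIntensity ν) :=
        lintegral_mono_set hsub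
    _ ≤ ENNReal.ofReal (j * b * x₁ * α) + (ENNReal.ofReal (j * b * (x₃ - x₁) * β)
        + ENNReal.ofReal (b * x₃ * γ)) :=
        (lintegral_union_le _ _ _).trans (add_le_add e₁ ((lintegral_union_le _ _ _).trans
          (add_le_add e₂ e₃)))
    _ = _ := by
        have h2 : 0 ≤ x₃ - x₁ := sub_nonneg.2 hx₃
        rw [← ENNReal.ofReal_add (by positivity) (by positivity),
          ← ENNReal.ofReal_add (by positivity) (by positivity), add_assoc]

/-- Blocks of length `1/s` and heights of order `s` give masses free of `s` and `T`, hence one `K`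
for all scales. The exponent is `jα + jκβ + (1+κ)γ - (j+1)(1+κ)`, at most `-j(1-α)/2 + (1+κ)γ`. -/
theorem IsPoissonProcess.exists_lintegral_tsum_blockTerm_le
    (hN : IsPoissonProcess P N (halfLineIntensity ν)) (hν : IsContractiveInMean ν)
    (hz : ∃ z : ℝ, ∫⁻ f, edist (f z) z ∂ν < ∞) (z₀ : ℝ) :
    ∃ θ : ℝ, 0 < θ ∧ θ ≤ 1 ∧ ∃ κ : ℝ, 0 < κ ∧ ∃ K : ℝ≥0∞, K ≠ ∞ ∧ ∀ s > 0, ∀ T ≥ 0,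
      ∫⁻ ω, ∑' j, blockTerm (N ω) z₀ T (1 / s) s ((1 + κ) * s) j ^ θ ∂P ≤ K := by
  obtain ⟨θ, hθ0, hθ1, α, hα0, hα1, hα⟩ := hν.exists_rpow_lt_one
  obtain ⟨z, hz⟩ := hz
  have hd := lintegral_edist_self_ne_top hν.1.ne hz z₀
  have hβ := lintegral_max_one_rpow_ne_top hν.1.ne (θ := θ) (by linarith)
  have hγ := lintegral_max_mul_rpow_ne_top hν.1.ne hd hθ1
  set β := (∫⁻ f : LipMap, max 1 (lipConst f) ^ θ ∂ν).toReal
  set γ := (∫⁻ f : LipMap, (max 1 (lipConst f) * (1 + edist (f z₀) z₀)) ^ θ ∂ν).toReal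
  have hβ0 : 0 ≤ β := ENNReal.toReal_nonneg
  have hγ0 : 0 ≤ γ := ENNReal.toReal_nonneg
  -- Chosen so that `κβ ≤ (1-α)/2`: the undecided heights use up at most half of the contraction.
  set κ := (1 - α) / 2 / (β + 1) with hκ
  have hκ0 : 0 < κ := by
    have : 0 < 1 - α := by linarith
    positivity
  have hκβ : κ * β ≤ (1 - α) / 2 := by
    rw [hκ, div_mul_eq_mul_div, div_le_iff₀ (by positivity)]
    nlinarith
  set q := Real.exp (-((1 - α) / 2)) with hq
  have hq1 : ENNReal.ofReal q < 1 := by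
    rw [← ENNReal.ofReal_one]
    exact (ENNReal.ofReal_lt_ofReal_iff zero_lt_one).2 (Real.exp_zero ▸ Real.exp_lt_exp.2 (by linarith))
  refine ⟨θ, hθ0, by linarith, κ, hκ0,
    ∑' j : ℕ, ENNReal.ofReal q ^ j * ENNReal.ofReal (Real.exp ((1 + κ) * γ)), ?_, ?_⟩
  · rw [ENNReal.tsum_mul_right, ENNReal.tsum_geometric]
    exact ENNReal.mul_ne_top (ENNReal.inv_ne_top.2 (tsub_pos_of_lt hq1).ne') ENNReal.ofReal_ne_top
  intro s hs T hT
  have hmeas : ∀ j, Measurable fun ω => blockTerm (N ω) z₀ T (1 / s) s ((1 + κ) * s) j := fun j =>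
    (measurable_blockTerm_countSigma (subset_univ _)).mono (hN.countSigma_le univ) le_rfl
  rw [lintegral_tsum fun j => ((hmeas j).pow_const θ).aemeasurable]
  refine ENNReal.tsum_le_tsum fun j => ?_
  have hs' : s ≤ (1 + κ) * s := by nlinarith
  have hint := setLIntegral_blockFactor_rpow_le (z₀ := z₀) hT (b := 1 / s) (by positivity) hs.le hs'
    hα0 hβ0 hγ0 hα (ENNReal.ofReal_toReal hβ).ge (ENNReal.ofReal_toReal hγ).ge j
  have hslab := measurableSet_slab (Ioc T (T + (j + 1) * (1 / s))) (Icc 0 ((1 + κ) * s))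
    measurableSet_Ioc measurableSet_Icc
  have hmA : halfLineIntensity ν (Ioc T (T + (j + 1) * (1 / s)) ×ˢ Icc 0 ((1 + κ) * s) ×ˢ univ)
      = ENNReal.ofReal ((j + 1) * (1 + κ)) := by
    rw [halfLineIntensity_prod, volume_restrict_Ici_Ioc hT, volume_restrict_Ici_Icc le_rfl,
      measure_univ, mul_one, sub_zero, add_sub_cancel_left, ← ENNReal.ofReal_mul (by positivity)]
    congr 1
    field_simp
  have hsub : 0 ≤ (1 + κ) * s - s := by linarith
  have hprod := hN.lintegral_pointProd_le hslab (by rw [hmA]; exact ENNReal.ofReal_ne_top)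
    ((measurable_blockFactor z₀ T (1 / s) s j).pow_const θ)
    (fun p => ENNReal.rpow_ne_top_of_nonneg hθ0.le (blockFactor_ne_top _ _ _ _ _ _))
    (by positivity) hint
  simp only [blockTerm]
  simp only [pointProd_rpow _ _ hθ0] at hprod
  refine hprod.trans ?_
  rw [hmA, ENNReal.toReal_ofReal (by positivity), ← ENNReal.ofReal_pow (Real.exp_pos _).le,
    ← ENNReal.ofReal_mul (by positivity), ← Real.exp_nat_mul, ← Real.exp_add]
  refine ENNReal.ofReal_le_ofReal (Real.exp_le_exp.2 ?_)
  have e1 : (j : ℝ) * (1 / s) * s * α = j * α := by field_simp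
  have e2 : (j : ℝ) * (1 / s) * ((1 + κ) * s - s) * β = j * (κ * β) := by field_simp; ring
  have e3 : 1 / s * ((1 + κ) * s) * γ = (1 + κ) * γ := by field_simp
  rw [e1, e2, e3]
  have hj : (0 : ℝ) ≤ j := Nat.cast_nonneg j
  have := mul_le_mul_of_nonneg_left hκβ hj
  nlinarith [mul_nonneg hj hκ0.le]

end MomentBound

/-- A regular configuration for which the block bounds are summable at all rational scales. -/
structure IsSummableConfig (S : Set (ℝ × ℝ × LipMap)) (z₀ κ : ℝ) : Prop
    extends IsRegularConfig S where
  tsum_ne_top : ∀ s : ℚ, 0 < s →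
    ∑' j, blockTerm S z₀ 0 (1 / (s : ℝ)) s ((1 + κ) * s) j ≠ ∞

/-- The intervals `(s, (1+κ)s)` with rational `s` cover the positive axis, so countably many almost
sure events handle all heights simultaneously. -/
theorem exists_rat_scale {κ x : ℝ} (hκ : 0 < κ) (hx : 0 < x) :
    ∃ s : ℚ, 0 < s ∧ (s : ℝ) < x ∧ x < (1 + κ) * s := by
  obtain ⟨s, h1, h2⟩ := exists_rat_btwn (show x / (1 + κ) < x from
    div_lt_self hx (by linarith))
  rw [div_lt_iff₀ (by linarith)] at h1
  have h3 : (0 : ℝ) < s := by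
    by_contra! h
    nlinarith
  exact ⟨s, by exact_mod_cast h3, h2, by linarith⟩

/-! ### Existence of the limit and uniform convergence in the height -/

namespace IsSummableConfig

variable {S : Set (ℝ × ℝ × LipMap)} {z₀ κ : ℝ}

theorem tendsto_sievedIterate (hS : IsSummableConfig S z₀ κ) {s : ℚ} (hs : 0 < s) {A : Set ℝ}
    (h₁ : Icc 0 (s : ℝ) ⊆ A) (h₃ : A ⊆ Icc 0 ((1 + κ) * s)) :
    Tendsto (sievedIterate S z₀ A) atTop (𝓝 (sievedLimit S z₀ A)) ∧
      ∀ j : ℕ, ∀ t ≥ j * (1 / (s : ℝ)), edist (sievedIterate S z₀ A t) (sievedLimit S z₀ A)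
        ≤ 2 * ∑' i, blockTerm S z₀ 0 (1 / (s : ℝ)) s ((1 + κ) * s) (i + j) := by
  have hs' : (0 : ℝ) < s := by exact_mod_cast hs
  obtain ⟨ℓ, h, h'⟩ := hS.exists_tendsto_iter_window (z₀ := z₀) (T := 0) h₁ h₃
    (b := 1 / (s : ℝ)) (by positivity) (hS.tsum_ne_top s hs)
  have he : sievedIterate S z₀ A = fun t => iter (window S A 0 t) z₀ := by
    funext t
    rw [sievedIterate_eq_iter, hS.sievedAtoms_eq]
  have hlim : sievedLimit S z₀ A = ℓ := by
    rw [sievedLimit, he]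
    exact h.limUnder_eq
  rw [hlim, he]
  exact ⟨h, fun j t ht => h' j t (by simpa using ht)⟩

theorem tendsto_zetaProcess (hS : IsSummableConfig S z₀ κ) (hκ : 0 < κ) {x : ℝ} (hx : 0 < x) :
    Tendsto (sievedIterate S z₀ (Icc 0 x)) atTop (𝓝 (zetaProcess S z₀ x)) := by
  obtain ⟨s, hs, h1, h2⟩ := exists_rat_scale hκ hx
  exact (hS.tendsto_sievedIterate hs (Icc_subset_Icc_right h1.le) (Icc_subset_Icc_right h2.le)).1

theorem tendsto_sievedLimit_Ico (hS : IsSummableConfig S z₀ κ) (hκ : 0 < κ) {x : ℝ} (hx : 0 < x) :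
    Tendsto (sievedIterate S z₀ (Ico 0 x)) atTop (𝓝 (sievedLimit S z₀ (Ico 0 x))) := by
  obtain ⟨s, hs, h1, h2⟩ := exists_rat_scale hκ hx
  exact (hS.tendsto_sievedIterate hs (Icc_subset_Ico_right h1)
    (Ico_subset_Icc_self.trans (Icc_subset_Icc_right h2.le))).1

theorem tendstoUniformlyOnFilter (hS : IsSummableConfig S z₀ κ) (hκ : 0 < κ) {x : ℝ}
    (hx : 0 < x) : TendstoUniformlyOnFilter (fun t x => sievedIterate S z₀ (Icc 0 x) t)
      (zetaProcess S z₀) atTop (𝓝 x) := by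
  obtain ⟨s, hs, h1, h2⟩ := exists_rat_scale hκ hx
  have hu : TendstoUniformlyOn (fun t x => sievedIterate S z₀ (Icc 0 x) t)
      (zetaProcess S z₀) atTop (Icc (s : ℝ) ((1 + κ) * s)) := by
    rw [EMetric.tendstoUniformlyOn_iff]
    intro ε hε
    have h0 : Tendsto (fun j => 2 * ∑' i, blockTerm S z₀ 0 (1 / (s : ℝ)) s ((1 + κ) * s) (i + j))
        atTop (𝓝 0) := by
      have := ENNReal.Tendsto.const_mul (ENNReal.tendsto_sum_nat_add _ (hS.tsum_ne_top s hs))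
        (Or.inr (ENNReal.ofNat_ne_top (n := 2)))
      rwa [mul_zero] at this
    obtain ⟨j, hj⟩ := (h0.eventually_lt_const hε).exists
    filter_upwards [eventually_ge_atTop (j * (1 / (s : ℝ)))] with t ht y hy
    rw [edist_comm]
    exact ((hS.tendsto_sievedIterate hs (Icc_subset_Icc_right hy.1)
      (Icc_subset_Icc_right hy.2)).2 j t ht).trans_lt hj
  exact hu.tendstoUniformlyOnFilter.mono_right (le_principal_iff.2 (Icc_mem_nhds h1 h2))

end IsSummableConfig

/-! ### At a fixed time the sieve is locally constant on each side of a height -/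

namespace IsRegularConfig

variable {S : Set (ℝ × ℝ × LipMap)}

/-- Only finitely many points are concerned, so every height below `x` is eventually passed by `y`;
points of height exactly `x` stay excluded, which leaves `[0, x)`. -/
theorem eventually_sievedAtoms_left (hS : IsRegularConfig S) (t x : ℝ) :
    ∀ᶠ y in 𝓝[<] x, sievedAtoms S (Icc 0 y) t = sievedAtoms S (Ico 0 x) t := by
  have h : ∀ᶠ y in 𝓝[<] x, ∀ p ∈ S ∩ Icc 0 t ×ˢ Icc 0 x ×ˢ univ, p.2.1 < x → p.2.1 ≤ y := by
    rw [eventually_all_finite (hS.finite t x)]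
    intro p _
    by_cases hp : p.2.1 < x
    · filter_upwards [Ioo_mem_nhdsLT hp] with y hy _ using hy.1.le
    · exact Eventually.of_forall fun y h => absurd h hp
  filter_upwards [h, self_mem_nhdsWithin] with y hy hyx
  ext p
  constructor
  · rintro ⟨h1, h2, h3, h4⟩
    exact ⟨h1, h2, ⟨h3.1, h3.2.trans_lt hyx⟩, h4⟩
  · rintro ⟨h1, h2, h3, h4⟩
    exact ⟨h1, h2, ⟨h3.1, hy p ⟨h1, h2, ⟨h3.1, h3.2.le⟩, h4⟩ h3.2⟩, h4⟩

theorem eventually_sievedAtoms_right (hS : IsRegularConfig S) (t x : ℝ) :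
    ∀ᶠ y in 𝓝[≥] x, sievedAtoms S (Icc 0 y) t = sievedAtoms S (Icc 0 x) t := by
  have h : ∀ᶠ y in 𝓝[≥] x, ∀ p ∈ S ∩ Icc 0 t ×ˢ Icc 0 (x + 1) ×ˢ univ, x < p.2.1 → y < p.2.1 := by
    rw [eventually_all_finite (hS.finite t (x + 1))]
    intro p _
    by_cases hp : x < p.2.1
    · filter_upwards [Ico_mem_nhdsGE hp] with y hy _ using hy.2
    · exact Eventually.of_forall fun y h => absurd h hp
  filter_upwards [h, Ico_mem_nhdsGE (lt_add_one x)] with y hy hyx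
  ext p
  constructor
  · rintro ⟨h1, h2, h3, h4⟩
    refine ⟨h1, h2, ⟨h3.1, ?_⟩, h4⟩
    by_contra! hlt
    exact (hy p ⟨h1, h2, ⟨h3.1, h3.2.trans hyx.2.le⟩, h4⟩ hlt).not_ge h3.2
  · rintro ⟨h1, h2, h3, h4⟩
    exact ⟨h1, h2, ⟨h3.1, h3.2.trans hyx.1⟩, h4⟩

end IsRegularConfig

/-! ### Path properties and the record equation -/

namespace IsSummableConfig

variable {S : Set (ℝ × ℝ × LipMap)} {z₀ κ : ℝ}

/-- Uniform convergence near `x` permits exchanging `y ↑ x` with `t → ∞`. The left limit is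
identified explicitly because the record equation refers to it. -/
theorem tendsto_zetaProcess_left (hS : IsSummableConfig S z₀ κ) (hκ : 0 < κ) {x : ℝ}
    (hx : 0 < x) : Tendsto (zetaProcess S z₀) (𝓝[<] x) (𝓝 (sievedLimit S z₀ (Ico 0 x))) := by
  refine ((hS.tendstoUniformlyOnFilter hκ hx).mono_right
    nhdsWithin_le_nhds).tendsto_of_eventually_tendsto (Eventually.of_forall fun t => ?_)
    (hS.tendsto_sievedLimit_Ico hκ hx)
  refine tendsto_const_nhds.congr' ?_
  filter_upwards [hS.eventually_sievedAtoms_left t x] with y hy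
  rw [sievedIterate_eq_iter, sievedIterate_eq_iter, hy]

theorem continuousWithinAt_zetaProcess (hS : IsSummableConfig S z₀ κ) (hκ : 0 < κ) {x : ℝ}
    (hx : 0 < x) : ContinuousWithinAt (zetaProcess S z₀) (Ici x) x := by
  refine ((hS.tendstoUniformlyOnFilter hκ hx).mono_right
    nhdsWithin_le_nhds).tendsto_of_eventually_tendsto (Eventually.of_forall fun t => ?_)
    (hS.tendsto_zetaProcess hκ hx)
  refine tendsto_const_nhds.congr' ?_
  filter_upwards [hS.eventually_sievedAtoms_right t x] with y hy
  rw [sievedIterate_eq_iter, sievedIterate_eq_iter, hy]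

theorem isCadlagOnPos (hS : IsSummableConfig S z₀ κ) (hκ : 0 < κ) :
    IsCadlagOnPos (zetaProcess S z₀) := fun _ hx =>
  ⟨hS.continuousWithinAt_zetaProcess hκ hx, _, hS.tendsto_zetaProcess_left hκ hx⟩

theorem continuousAt_zetaProcess (hS : IsSummableConfig S z₀ κ) (hκ : 0 < κ) {x : ℝ}
    (hx : 0 < x) (hne : ∀ p ∈ S, p.2.1 ≠ x) : ContinuousAt (zetaProcess S z₀) x := by
  have he : sievedIterate S z₀ (Ico 0 x) = sievedIterate S z₀ (Icc 0 x) := by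
    funext t
    rw [sievedIterate_eq_iter, sievedIterate_eq_iter]
    congr 1
    ext p
    constructor
    · rintro ⟨h1, h2, h3, h4⟩
      exact ⟨h1, h2, Ico_subset_Icc_self h3, h4⟩
    · rintro ⟨h1, h2, h3, h4⟩
      exact ⟨h1, h2, ⟨h3.1, lt_of_le_of_ne h3.2 (hne p h1)⟩, h4⟩
  have hlim : sievedLimit S z₀ (Ico 0 x) = zetaProcess S z₀ x := by
    rw [zetaProcess, sievedLimit, sievedLimit, he]
  rw [continuousAt_iff_continuous_left'_right']
  constructor
  · have := hS.tendsto_zetaProcess_left hκ hx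
    rwa [hlim] at this
  · exact (hS.continuousWithinAt_zetaProcess hκ hx).mono Ioi_subset_Ici_self

/-- Every other point of the sieve `[0, x]` comes later, and is lower because heights are distinct.
Hence the mark of `p` is the outermost map, applied to the iteration over `[0, x)`; its continuity
passes this to the limit. -/
theorem zetaProcess_lowerRecord (hS : IsSummableConfig S z₀ κ) (hκ : 0 < κ)
    {p : ℝ × ℝ × LipMap} (hp : IsLowerRecord S p) :
    0 < p.2.1 ∧ zetaProcess S z₀ p.2.1 = p.2.2 (sievedLimit S z₀ (Ico 0 p.2.1)) := by
  have hmem : ∀ q, q ∈ sievedAtoms S (Icc 0 p.2.1) p.1 ↔ q = p := fun q => by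
    rw [IsLowerRecord] at hp
    rw [hp, mem_singleton_iff]
  have hpS : p ∈ S := ((hmem p).2 rfl).1
  obtain ⟨ht, hx⟩ := hS.pos p hpS
  refine ⟨hx, tendsto_nhds_unique (hS.tendsto_zetaProcess hκ hx) ?_⟩
  refine ((p.2.2.continuous_apply.tendsto _).comp (hS.tendsto_sievedLimit_Ico hκ hx)).congr' ?_
  filter_upwards [eventually_ge_atTop p.1] with u hu
  simp only [Function.comp]
  rw [sievedIterate_eq_iter, sievedIterate_eq_iter, hS.sievedAtoms_eq, hS.sievedAtoms_eq]
  have h1 : window S (Ico 0 p.2.1) 0 u = window S (Ico 0 p.2.1) p.1 u := by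
    ext q
    simp only [mem_window]
    refine ⟨fun h => ⟨h.1, ⟨?_, h.2.1.2⟩, h.2.2⟩, fun h => ⟨h.1, ⟨ht.trans h.2.1.1, h.2.1.2⟩, h.2.2⟩⟩
    by_contra! hle
    have := (hmem q).1 ⟨h.1, ⟨h.2.1.1.le, hle⟩, Ico_subset_Icc_self h.2.2, mem_univ _⟩
    rw [this] at h
    exact lt_irrefl _ h.2.2.2
  have h2 : window S (Icc 0 p.2.1) 0 u = {p} ∪ window S (Ico 0 p.2.1) p.1 u := by
    ext q
    simp only [mem_window, mem_union, mem_singleton_iff]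
    constructor
    · rintro ⟨h3, h4, h5⟩
      by_cases hq : q = p
      · exact Or.inl hq
      · refine Or.inr ⟨h3, ⟨?_, h4.2⟩, h5.1, lt_of_le_of_ne h5.2 fun he =>
          hq (hS.injOn_height h3 hpS he)⟩
        by_contra! hle
        exact hq ((hmem q).1 ⟨h3, ⟨h4.1.le, hle⟩, h5, mem_univ _⟩)
    · rintro (rfl | ⟨h3, h4, h5⟩)
      · exact ⟨hpS, ⟨ht, hu⟩, hx.le, le_rfl⟩
      · exact ⟨h3, ⟨ht.trans h4.1, h4.2⟩, Ico_subset_Icc_self h5⟩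
  rw [h1, h2, IsTimed.iter_union ⟨finite_singleton p, injOn_singleton _ _⟩
    (hS.isTimed (fun y hy => hy.2.le) _ _), iter_singleton]
  rintro q rfl r hr
  exact (mem_window.1 hr).2.1.1

end IsSummableConfig

theorem IsPoissonProcess.ae_isSummableConfig {Ω : Type*} [MeasurableSpace Ω] {P : Measure Ω}
    [IsProbabilityMeasure P] {ν : Measure LipMap} [IsProbabilityMeasure ν]
    {N : Ω → Set (ℝ × ℝ × LipMap)} (hN : IsPoissonProcess P N (halfLineIntensity ν))
    {z₀ θ κ : ℝ} (hθ : 0 < θ) (hθ1 : θ ≤ 1) {K : ℝ≥0∞} (hK : K ≠ ∞)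
    (h : ∀ s > 0, ∀ T ≥ 0,
      ∫⁻ ω, ∑' j, blockTerm (N ω) z₀ T (1 / s) s ((1 + κ) * s) j ^ θ ∂P ≤ K) :
    ∀ᵐ ω ∂P, IsSummableConfig (N ω) z₀ κ := by
  have hsum : ∀ᵐ ω ∂P, ∀ s : ℚ, 0 < s →
      ∑' j, blockTerm (N ω) z₀ 0 (1 / (s : ℝ)) s ((1 + κ) * s) j ≠ ∞ := by
    refine ae_all_iff.2 fun s => ?_
    by_cases hs : 0 < s
    swap
    · exact Eventually.of_forall fun _ h => absurd h hs
    have hmeas : ∀ j, Measurable fun ω =>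
        blockTerm (N ω) z₀ 0 (1 / (s : ℝ)) s ((1 + κ) * s) j := fun j =>
      (measurable_blockTerm_countSigma (subset_univ _)).mono (hN.countSigma_le univ) le_rfl
    filter_upwards [ae_lt_top (Measurable.tsum fun j => (hmeas j).pow_const θ)
      (ne_top_of_le_ne_top hK (h s (by exact_mod_cast hs) 0 le_rfl))] with ω hω _
    exact ne_top_of_le_ne_top (ENNReal.rpow_ne_top_of_nonneg (by positivity) hω.ne)
      (ENNReal.tsum_rpow_le_rpow_tsum hθ hθ1 le_rfl)
  filter_upwards [hN.ae_isRegularConfig, hsum] with ω h₁ h₂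
  exact ⟨h₁, h₂⟩

/-! ### Contracting and displacing maps of positive probability -/

section Marks

variable {ν : Measure LipMap}

/-- Otherwise `L ≥ 1` almost surely, contradicting `E L^θ < 1`. -/
theorem IsContractiveInMean.exists_measure_lipConst_le_pos [IsProbabilityMeasure ν]
    (hν : IsContractiveInMean ν) :
    ∃ ρ : ℝ, 0 ≤ ρ ∧ ρ < 1 ∧ ν {f : LipMap | lipConst f ≤ ENNReal.ofReal ρ} ≠ 0 := by
  by_contra! hcon
  obtain ⟨θ, hθ, -, α, -, hα1, hα⟩ := hν.exists_rpow_lt_one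
  have hae : ∀ᵐ (f : LipMap) ∂ν, (1 : ℝ≥0∞) ≤ lipConst f ^ θ := by
    have h : ∀ n : ℕ, ∀ᵐ (f : LipMap) ∂ν, ¬ lipConst f ≤ ENNReal.ofReal (1 - 1 / ((n : ℝ) + 1)) := fun n => by
      have h1 : 0 < 1 / ((n : ℝ) + 1) := by positivity
      have h2 : 1 / ((n : ℝ) + 1) ≤ 1 := by
        rw [div_le_one (by positivity)]
        linarith [(Nat.cast_nonneg n : (0 : ℝ) ≤ n)]
      exact measure_eq_zero_iff_ae_notMem.1 (hcon _ (by linarith) (by linarith))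
    filter_upwards [ae_all_iff.2 h] with f hf
    refine ENNReal.one_le_rpow ?_ hθ
    refine le_of_tendsto' (f := fun n : ℕ => ENNReal.ofReal (1 - 1 / ((n : ℝ) + 1))) (x := atTop) ?_
      fun n => (not_le.1 (hf n)).le
    have := ENNReal.tendsto_ofReal
      ((tendsto_one_div_add_atTop_nhds_zero_nat (𝕜 := ℝ)).const_sub 1)
    simpa using this
  have h1 : (1 : ℝ≥0∞) ≤ ∫⁻ f, lipConst f ^ θ ∂ν := by
    calc (1 : ℝ≥0∞) = ∫⁻ _, 1 ∂ν := by simp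
      _ ≤ _ := lintegral_mono_ae hae
  have h2 := h1.trans hα
  rw [ENNReal.one_le_ofReal] at h2
  linarith

/-- Some point is, up to an arbitrarily small error, a fixed point of uniformly contracting maps
of positive probability. -/
theorem IsContractiveInMean.exists_center [IsProbabilityMeasure ν] (hν : IsContractiveInMean ν) :
    ∃ ρ : ℝ, 0 ≤ ρ ∧ ρ < 1 ∧ ∃ c : ℝ, ∀ η > 0,
      ν {f : LipMap | lipConst f ≤ ENNReal.ofReal ρ ∧ edist (f c) c ≤ ENNReal.ofReal η} ≠ 0 := by
  obtain ⟨ρ, hρ0, hρ1, hρ⟩ := hν.exists_measure_lipConst_le_pos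
  refine ⟨ρ, hρ0, hρ1, ?_⟩
  by_contra! hcon
  choose η hη hη' using hcon
  -- If every `c` failed with some error `η c`, countably many of the balls of radius `η c / 2`
  -- would cover the line. The fixed point of a contraction lies in one of them and the centre moves
  -- by at most twice its distance to it, so all contractions lie in a countable union of null sets.
  obtain ⟨s, hs, hcov⟩ := TopologicalSpace.countable_cover_nhds
    (f := fun c => Metric.ball c (η c / 2)) fun c => Metric.ball_mem_nhds c (half_pos (hη c))
  refine hρ (measure_mono_null (t := ⋃ c ∈ s, {f : LipMap | lipConst f ≤ ENNReal.ofReal ρ ∧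
    edist (f c) c ≤ ENNReal.ofReal (η c)}) ?_ ((measure_biUnion_null_iff hs).2 fun c _ => hη' c))
  intro f hf
  have hf' : lipConst f ≤ ENNReal.ofReal ρ := hf
  have hlip : LipschitzWith ρ.toNNReal f := fun x y => (f.edist_apply_le x y).trans
    (mul_le_mul_left hf' _)
  have hc : ContractingWith ρ.toNNReal f := ⟨by simpa using hρ1, hlip⟩
  set x := ContractingWith.fixedPoint f hc
  have hx : f x = x := hc.fixedPoint_isFixedPt
  obtain ⟨c, hcs, hxc⟩ : ∃ c ∈ s, x ∈ Metric.ball c (η c / 2) := by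
    have := mem_univ x
    rw [← hcov] at this
    simpa using this
  simp only [mem_iUnion]
  refine ⟨c, hcs, hf', ?_⟩
  rw [edist_dist]
  refine ENNReal.ofReal_le_ofReal ?_
  have h1 : dist (f c) (f x) ≤ dist c x := by
    have := hlip.dist_le_mul c x
    rw [Real.coe_toNNReal _ hρ0] at this
    nlinarith [dist_nonneg (x := c) (y := x)]
  rw [Metric.mem_ball, dist_comm] at hxc
  calc dist (f c) c ≤ dist (f c) (f x) + dist (f x) c := dist_triangle _ _ _
    _ ≤ dist c x + dist c x := by
        rw [hx, dist_comm x c]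
        rw [hx] at h1
        gcongr
    _ ≤ η c := by linarith

/-- The maps moving `c` are the union over `n` of those with displacement in `[1/(n+1), n]` and
Lipschitz constant at most `n`; if all these were null, `c` would be a common fixed point. -/
theorem exists_measure_displacement_pos {c : ℝ} (hc : ¬ ∀ᵐ f ∂ν, f c = c) :
    ∃ δ : ℝ, 0 < δ ∧ ∃ ℓ : ℝ, 0 ≤ ℓ ∧
      ν {f : LipMap | ENNReal.ofReal δ ≤ edist (f c) c ∧ edist (f c) c ≤ ENNReal.ofReal ℓ ∧
        lipConst f ≤ ENNReal.ofReal ℓ} ≠ 0 := by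
  by_contra! hcon
  refine hc ?_
  have h : ∀ n : ℕ, ∀ᵐ (f : LipMap) ∂ν, ¬ (ENNReal.ofReal (1 / ((n : ℝ) + 1)) ≤ edist (f c) c ∧
      edist (f c) c ≤ ENNReal.ofReal n ∧ lipConst f ≤ ENNReal.ofReal n) := fun n =>
    measure_eq_zero_iff_ae_notMem.1 (hcon _ (by positivity) _ n.cast_nonneg)
  filter_upwards [ae_all_iff.2 h] with f hf
  by_contra hne
  have hpos : 0 < dist (f c) c := dist_pos.2 hne
  obtain ⟨n₁, h₁⟩ := exists_nat_one_div_lt hpos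
  obtain ⟨n₂, h₂⟩ := exists_nat_ge (max (dist (f c) c) (lipConst f).toReal)
  rw [max_le_iff] at h₂
  set n := max n₁ n₂
  have hn₁ : (n₁ : ℝ) ≤ n := by exact_mod_cast le_max_left n₁ n₂
  have hn₂ : (n₂ : ℝ) ≤ n := by exact_mod_cast le_max_right n₁ n₂
  refine hf n ⟨?_, ?_, ?_⟩
  · rw [edist_dist]
    refine ENNReal.ofReal_le_ofReal (le_trans ?_ h₁.le)
    exact one_div_le_one_div_of_le (by positivity) (by linarith)
  · rw [edist_dist]
    exact ENNReal.ofReal_le_ofReal (h₂.1.trans hn₂)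
  · rw [← ENNReal.ofReal_toReal f.lipConst_ne_top]
    exact ENNReal.ofReal_le_ofReal (h₂.2.trans hn₂)

end Marks

/-! ### A finite pattern forcing a jump and an excursion -/

section Pattern

/-- The disjoint regions of the pattern at scale `s`: contracting marks at late times and low
heights, one displacing mark, contracting marks at early times and great heights, and the rest of
the rectangle `(0, 3 / s] × (l, (1 + κ) s]`. -/
def patternBox (κ s l : ℝ) (U V : Set LipMap) : Fin 4 → Set (ℝ × ℝ × LipMap) :=
  ![Ioc (2 / s) (3 / s) ×ˢ Ioc l s ×ˢ U,
    Ioc (1 / s) (2 / s) ×ˢ Ioc s ((1 + κ / 2) * s) ×ˢ V,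
    Ioc 0 (1 / s) ×ˢ Ioc ((1 + κ / 2) * s) ((1 + κ) * s) ×ˢ U,
    (Ioc 0 (3 / s) ×ˢ Ioc l ((1 + κ) * s) ×ˢ univ) \
      (Ioc (2 / s) (3 / s) ×ˢ Ioc l s ×ˢ U ∪
        Ioc (1 / s) (2 / s) ×ˢ Ioc s ((1 + κ / 2) * s) ×ˢ V ∪
        Ioc 0 (1 / s) ×ˢ Ioc ((1 + κ / 2) * s) ((1 + κ) * s) ×ˢ U)]

/-- The numbers of points in the regions `patternBox`. -/
def HasPattern (S : Set (ℝ × ℝ × LipMap)) (κ s l : ℝ) (U V : Set LipMap) (k : ℕ) : Prop :=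
  ∀ i, (S ∩ patternBox κ s l U V i).encard = ((![k, 1, k, 0] i : ℕ) : ℕ∞)

variable {S : Set (ℝ × ℝ × LipMap)} {z₀ κ s l c ρ η δ ℓ R : ℝ} {U V : Set LipMap} {k : ℕ}

theorem IsRegularConfig.isTimed_of_subset (hS : IsRegularConfig S) {Q : Set (ℝ × ℝ × LipMap)}
    (hQ : Q ⊆ S) (t x : ℝ) (h : ∀ p ∈ Q, p.1 ≤ t ∧ p.2.1 ≤ x) : IsTimed Q := by
  refine ⟨(hS.finite t x).subset fun p hp => ?_, hS.injOn_time.mono hQ⟩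
  have h1 := hS.pos p (hQ hp)
  exact ⟨hQ hp, ⟨h1.1.le, (h p hp).1⟩, ⟨h1.2.le, (h p hp).2⟩, mem_univ _⟩

/-- Later times are composed further inside. The tail after `3/s` stays within `R` of `z₀`, the low
contractions bring it within `2η` of `c`, the mark of `q` sends it near `f c`, and the high
contractions, outermost, return it to `c`. So `ζ` is near `c` at `s`, near `f c` at `x₂`, near `c`
at `x₃`; the assumption on `δ` separates `f c` from `c` by more than the errors. -/
theorem IsSummableConfig.jump_and_not_monotone (hS : IsSummableConfig S z₀ κ) (hκ : 0 < κ)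
    (hs : 0 < s) (hρ0 : 0 ≤ ρ) (hη : 0 ≤ η) (hℓ : 0 ≤ ℓ) (hR : 0 ≤ R)
    (hU : ∀ f ∈ U, ∀ z, dist (f z) c ≤ ρ * dist z c + (1 - ρ) * η)
    (hV : ∀ f ∈ V, δ ≤ dist (f c) c ∧ dist (f c) c ≤ ℓ ∧ ∀ z w, dist (f z) (f w) ≤ ℓ * dist z w)
    (hpat : HasPattern S κ s l U V k)
    (hempty : S ∩ Ioc 0 (3 / s) ×ˢ Ioc 0 l ×ˢ univ = ∅)
    (htail : ∑' j, blockTerm S z₀ (3 / s) (1 / s) s ((1 + κ) * s) j ≤ ENNReal.ofReal R)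
    (hk₁ : ρ ^ k * (R + dist z₀ c) ≤ η) (hk₂ : ρ ^ k * (ℓ * (2 * η) + ℓ) ≤ η)
    (hδ : ℓ * (2 * η) + 2 * η < δ) :
    (∃ t x f, IsLowerRecord S (t, x, f) ∧ ∃ v : ℝ, Tendsto (zetaProcess S z₀) (𝓝[<] x) (𝓝 v) ∧
      zetaProcess S z₀ x ≠ v) ∧
    ¬ MonotoneOn (zetaProcess S z₀) (Ioi 0) ∧ ¬ AntitoneOn (zetaProcess S z₀) (Ioi 0) := by
  set x₂ := (1 + κ / 2) * s with hx₂
  set x₃ := (1 + κ) * s with hx₃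
  have hs₂ : s < x₂ := by rw [hx₂]; nlinarith
  have h₂₃ : x₂ < x₃ := by rw [hx₂, hx₃]; nlinarith
  have ht1 : 0 < 1 / s := by positivity
  have ht2 : 1 / s < 2 / s := by gcongr; norm_num
  have ht3 : 2 / s < 3 / s := by gcongr; norm_num
  set T := 3 / s with hT
  have hT0 : 0 < T := by positivity
  have p0 := hpat 0
  have p1 := hpat 1
  have p2 := hpat 2
  have p3 := hpat 3
  simp only [patternBox, Matrix.cons_val, ← hx₂, ← hx₃, ← hT] at p0 p1 p2 p3
  set b₁ : Set (ℝ × ℝ × LipMap) := Ioc (2 / s) T ×ˢ Ioc l s ×ˢ U with hb₁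
  set b₂ : Set (ℝ × ℝ × LipMap) := Ioc (1 / s) (2 / s) ×ˢ Ioc s x₂ ×ˢ V with hb₂
  set b₃ : Set (ℝ × ℝ × LipMap) := Ioc 0 (1 / s) ×ˢ Ioc x₂ x₃ ×ˢ U with hb₃
  obtain ⟨q, hq⟩ := Set.encard_eq_one.1 (by simpa using p1)
  have hq' : q ∈ S ∩ b₂ := hq ▸ mem_singleton q
  have hqS : q ∈ S := hq'.1
  obtain ⟨⟨hqt, hqt'⟩, ⟨hqx, hqx'⟩, hqV⟩ := hq'.2
  obtain ⟨hqδ, hqℓ, hqL⟩ := hV _ hqV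
  -- The fourth region and the low strip are empty, so the early part of the configuration consists
  -- of the two groups of contractions and `q`.
  have hin : ∀ p ∈ S, p.1 ≤ T → p.2.1 ≤ x₃ → p ∈ b₁ ∨ p = q ∨ p ∈ b₃ := by
    intro p hp h1 h2
    have hpos := hS.pos p hp
    have hlp : l < p.2.1 := by
      by_contra! h
      exact (hempty ▸ (⟨hp, ⟨hpos.1, h1⟩, ⟨hpos.2, h⟩, mem_univ _⟩ :
        p ∈ S ∩ Ioc 0 T ×ˢ Ioc 0 l ×ˢ univ) : p ∈ (∅ : Set _))
    by_contra! h
    have h3 : p ∉ b₂ := fun h' => h.2.1 (by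
      have : p ∈ S ∩ b₂ := ⟨hp, h'⟩
      rwa [hq] at this)
    have h4 := Set.encard_eq_zero.1 (by simpa using p3)
    exact (h4 ▸ (⟨hp, ⟨⟨hpos.1, h1⟩, ⟨hlp, h2⟩, mem_univ _⟩, by
      rintro ((h' | h') | h')
      exacts [h.1 h', h3 h', h.2.2 h']⟩ :
        p ∈ S ∩ (Ioc 0 T ×ˢ Ioc l x₃ ×ˢ univ \ (b₁ ∪ b₂ ∪ b₃))) : p ∈ (∅ : Set _))
  set W₁ := S ∩ b₁ with hW₁
  set W₃ := S ∩ b₃ with hW₃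
  have hW₁t : IsTimed W₁ := hS.isTimed_of_subset inter_subset_left T s fun p hp =>
    ⟨hp.2.1.2, hp.2.2.1.2⟩
  have hW₃t : IsTimed W₃ := hS.isTimed_of_subset inter_subset_left (1 / s) x₃ fun p hp =>
    ⟨hp.2.1.2, hp.2.2.1.2⟩
  have hqW : IsTimed ({q} : Set (ℝ × ℝ × LipMap)) := ⟨finite_singleton q, injOn_singleton _ _⟩
  -- Stated for general `A` because it is used both for `[0, s]` and for `[0, x)` with `x` the
  -- height of `q`, the latter for the left limit.
  have hw₁ : ∀ A : Set ℝ, Icc 0 s ⊆ A → A ⊆ Icc 0 x₂ → q.2.1 ∉ A → window S A 0 T = W₁ := by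
    intro A h1 h2 h3
    ext p
    rw [mem_window]
    constructor
    · rintro ⟨a1, a2, a3⟩
      rcases hin p a1 a2.2 ((h2 a3).2.trans h₂₃.le) with h | rfl | h
      · exact ⟨a1, h⟩
      · exact absurd a3 h3
      · exact absurd (h2 a3).2 (not_le.2 h.2.1.1)
    · rintro ⟨a1, a2, a3, a4⟩
      exact ⟨a1, ⟨(hS.pos p a1).1, a2.2⟩, h1 ⟨(hS.pos p a1).2.le, a3.2⟩⟩
  have hw₂ : window S (Icc 0 x₂) 0 T = {q} ∪ W₁ := by
    ext p
    rw [mem_window, mem_union, mem_singleton_iff]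
    constructor
    · rintro ⟨a1, a2, a3⟩
      rcases hin p a1 a2.2 (a3.2.trans h₂₃.le) with h | rfl | h
      · exact Or.inr ⟨a1, h⟩
      · exact Or.inl rfl
      · exact absurd a3.2 (not_le.2 h.2.1.1)
    · rintro (rfl | ⟨a1, a2, a3, a4⟩)
      · exact ⟨hqS, ⟨ht1.trans hqt, hqt'.trans ht3.le⟩, (hs.trans hqx).le, hqx'⟩
      · exact ⟨a1, ⟨(hS.pos p a1).1, a2.2⟩, (hS.pos p a1).2.le, a3.2.trans hs₂.le⟩
  have hw₃ : window S (Icc 0 x₃) 0 T = W₃ ∪ ({q} ∪ W₁) := by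
    ext p
    rw [mem_window, mem_union, mem_union, mem_singleton_iff]
    constructor
    · rintro ⟨a1, a2, a3⟩
      rcases hin p a1 a2.2 a3.2 with h | rfl | h
      · exact Or.inr (Or.inr ⟨a1, h⟩)
      · exact Or.inr (Or.inl rfl)
      · exact Or.inl ⟨a1, h⟩
    · rintro (⟨a1, a2, a3, a4⟩ | rfl | ⟨a1, a2, a3, a4⟩)
      · exact ⟨a1, ⟨a2.1, a2.2.trans (ht2.trans ht3).le⟩, (hS.pos p a1).2.le, a3.2⟩
      · exact ⟨hqS, ⟨ht1.trans hqt, hqt'.trans ht3.le⟩, (hs.trans hqx).le, hqx'.trans h₂₃.le⟩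
      · exact ⟨a1, ⟨(hS.pos p a1).1, a2.2⟩, (hS.pos p a1).2.le, a3.2.trans (hs₂.trans h₂₃).le⟩
  have hsplit : ∀ A ⊆ Icc 0 x₃, ∀ t ≥ T, sievedIterate S z₀ A t
      = iter (window S A 0 T) (iter (window S A T t) z₀) := by
    intro A hA t ht
    rw [sievedIterate_eq_iter, hS.sievedAtoms_eq]
    exact hS.iter_window_split (fun x hx => (hA hx).2) hT0.le ht z₀
  have hnear : ∀ A, Icc 0 s ⊆ A → A ⊆ Icc 0 x₃ → ∀ t ≥ T,
      dist (iter W₁ (iter (window S A T t) z₀)) c ≤ 2 * η := by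
    intro A h1 h3 t ht
    have hr : dist (iter (window S A T t) z₀) z₀ ≤ R := by
      have := (hS.edist_iter_window_start_le (z₀ := z₀) h1 h3 (b := 1 / s) ht1 ht).trans htail
      rwa [edist_dist, ENNReal.ofReal_le_ofReal_iff hR] at this
    have h4 := hW₁t.dist_iter_le hρ0 (fun p hp => hU _ hp.2.2.2) p0
      (iter (window S A T t) z₀)
    have h5 : ρ ^ k * dist (iter (window S A T t) z₀) c ≤ ρ ^ k * (R + dist z₀ c) := by
      gcongr
      exact (dist_triangle _ z₀ _).trans (by gcongr)
    have h6 : 0 ≤ ρ ^ k * η := by positivity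
    linarith
  have e₁ : dist (zetaProcess S z₀ s) c ≤ 2 * η := by
    refine le_of_tendsto ((hS.tendsto_zetaProcess hκ hs).dist tendsto_const_nhds) ?_
    filter_upwards [eventually_ge_atTop T] with t ht
    have hA : Icc 0 s ⊆ Icc 0 x₃ := Icc_subset_Icc_right (hs₂.trans h₂₃).le
    rw [hsplit _ hA t ht, hw₁ _ subset_rfl (Icc_subset_Icc_right hs₂.le) fun h => not_le.2 hqx h.2]
    exact hnear _ subset_rfl hA t ht
  have e₀ : dist (sievedLimit S z₀ (Ico 0 q.2.1)) c ≤ 2 * η := by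
    refine le_of_tendsto ((hS.tendsto_sievedLimit_Ico hκ (hs.trans hqx)).dist
      tendsto_const_nhds) ?_
    filter_upwards [eventually_ge_atTop T] with t ht
    have hA₁ : Icc 0 s ⊆ Ico 0 q.2.1 := Icc_subset_Ico_right hqx
    have hA₂ : Ico 0 q.2.1 ⊆ Icc 0 x₂ := Ico_subset_Icc_self.trans (Icc_subset_Icc_right hqx')
    have hA₃ : Ico 0 q.2.1 ⊆ Icc 0 x₃ := hA₂.trans (Icc_subset_Icc_right h₂₃.le)
    rw [hsplit _ hA₃ t ht, hw₁ _ hA₁ hA₂ fun h => lt_irrefl _ h.2]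
    exact hnear _ hA₁ hA₃ t ht
  have hqW₁ : ∀ z, iter ({q} ∪ W₁) z = q.2.2 (iter W₁ z) := by
    intro z
    rw [hqW.iter_union hW₁t, iter_singleton]
    rintro p rfl r hr
    exact hqt'.trans_lt hr.2.1.1
  have hfq : ∀ A, Icc 0 s ⊆ A → A ⊆ Icc 0 x₃ → ∀ t ≥ T,
      dist (q.2.2 (iter W₁ (iter (window S A T t) z₀))) (q.2.2 c) ≤ ℓ * (2 * η) := fun A h1 h3 t ht =>
    (hqL _ _).trans (mul_le_mul_of_nonneg_left (hnear A h1 h3 t ht) hℓ)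
  have e₂ : dist (zetaProcess S z₀ x₂) (q.2.2 c) ≤ ℓ * (2 * η) := by
    refine le_of_tendsto ((hS.tendsto_zetaProcess hκ (hs.trans hs₂)).dist tendsto_const_nhds) ?_
    filter_upwards [eventually_ge_atTop T] with t ht
    have hA : Icc 0 x₂ ⊆ Icc 0 x₃ := Icc_subset_Icc_right h₂₃.le
    rw [hsplit _ hA t ht, hw₂, hqW₁]
    exact hfq _ (Icc_subset_Icc_right hs₂.le) hA t ht
  have e₃ : dist (zetaProcess S z₀ x₃) c ≤ 2 * η := by
    refine le_of_tendsto ((hS.tendsto_zetaProcess hκ (hs.trans (hs₂.trans h₂₃))).dist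
      tendsto_const_nhds) ?_
    filter_upwards [eventually_ge_atTop T] with t ht
    have hA : Icc 0 s ⊆ Icc 0 x₃ := Icc_subset_Icc_right (hs₂.trans h₂₃).le
    have hunion : IsTimed ({q} ∪ W₁) := hS.isTimed_of_subset
      (union_subset (singleton_subset_iff.2 hqS) inter_subset_left) T x₂ (by
        rintro p (rfl | hp)
        · exact ⟨hqt'.trans ht3.le, hqx'⟩
        · exact ⟨hp.2.1.2, hp.2.2.1.2.trans hs₂.le⟩)
    rw [hsplit _ subset_rfl t ht, hw₃, hW₃t.iter_union hunion, hqW₁]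
    · have h4 := hW₃t.dist_iter_le hρ0 (fun p hp => hU _ hp.2.2.2) p2
        (q.2.2 (iter W₁ (iter (window S (Icc 0 x₃) T t) z₀)))
      have h5 : ρ ^ k * dist (q.2.2 (iter W₁ (iter (window S (Icc 0 x₃) T t) z₀))) c
          ≤ ρ ^ k * (ℓ * (2 * η) + ℓ) := by
        gcongr
        exact (dist_triangle _ (q.2.2 c) _).trans (add_le_add (hfq _ hA subset_rfl t ht) hqℓ)
      have h6 : 0 ≤ ρ ^ k * η := by positivity
      linarith
    · rintro p hp r (rfl | hr)
      · exact hp.2.1.2.trans_lt hqt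
      · exact hp.2.1.2.trans_lt (ht2.trans hr.2.1.1)
  have hrec : IsLowerRecord S q := by
    rw [IsLowerRecord]
    ext p
    rw [mem_singleton_iff]
    constructor
    · rintro ⟨a1, a2, a3, a4⟩
      rcases hin p a1 (a2.2.trans (hqt'.trans ht3.le)) (a3.2.trans (hqx'.trans h₂₃.le))
        with h | h | h
      · exact absurd (a2.2.trans hqt') (not_le.2 h.1.1)
      · exact h
      · exact absurd (a3.2.trans hqx') (not_le.2 h.2.1.1)
    · rintro rfl
      exact ⟨hqS, ⟨(ht1.trans hqt).le, le_rfl⟩, ⟨(hs.trans hqx).le, le_rfl⟩, mem_univ _⟩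
  obtain ⟨hq0, hqz⟩ := hS.zetaProcess_lowerRecord hκ hrec
  refine ⟨⟨q.1, q.2.1, q.2.2, hrec, _, hS.tendsto_zetaProcess_left hκ hq0, ?_⟩, ?_, ?_⟩
  · intro he
    rw [hqz] at he
    have h1 := (hqL (sievedLimit S z₀ (Ico 0 q.2.1)) c).trans (mul_le_mul_of_nonneg_left e₀ hℓ)
    rw [he] at h1
    have h2 := dist_triangle_left (q.2.2 c) c (sievedLimit S z₀ (Ico 0 q.2.1))
    linarith
  all_goals
    intro hmono
    have m₁ := hmono (mem_Ioi.2 hs) (mem_Ioi.2 (hs.trans hs₂)) hs₂.le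
    have m₂ := hmono (mem_Ioi.2 (hs.trans hs₂)) (mem_Ioi.2 (hs.trans (hs₂.trans h₂₃))) h₂₃.le
    rw [Real.dist_eq, abs_le] at e₁ e₂ e₃
    rw [Real.dist_eq] at hqδ
    -- A monotone path would keep `ζ x₂` between `ζ s` and `ζ x₃`, both near `c`, whichever side of
    -- `c` the value `f c` lies on.
    rcases le_abs.1 hqδ with h | h <;> linarith [e₁.1, e₁.2, e₂.1, e₂.2, e₃.1, e₃.2]

end Pattern

/-- If the events `A n` have probability at least `p`, the events `C n` have probability at least
`1 - e`, and `A n` is independent of `C n` and of what happened before, then one of the events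
`A n ∩ C n` occurs with probability at least `1 - e`. -/
theorem measureReal_iInter_compl_le {Ω : Type*} [MeasurableSpace Ω] {P : Measure Ω}
    [IsProbabilityMeasure P] {A C : ℕ → Set Ω} (hA : ∀ n, MeasurableSet (A n)) {p e : ℝ}
    (he : 0 ≤ e) (hpA : ∀ n, p ≤ P.real (A n)) (heC : ∀ n, P.real (C n)ᶜ ≤ e)
    (hind₁ : ∀ n, P.real (A n ∩ (C n)ᶜ) = P.real (A n) * P.real (C n)ᶜ)
    (hind₂ : ∀ n, P.real ((A n)ᶜ ∩ ⋂ j ∈ Finset.range n, (A j ∩ C j)ᶜ)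
      = P.real (A n)ᶜ * P.real (⋂ j ∈ Finset.range n, (A j ∩ C j)ᶜ)) (n : ℕ) :
    P.real (⋂ j ∈ Finset.range n, (A j ∩ C j)ᶜ) ≤ e + (1 - p) ^ n := by
  have hp1 : p ≤ 1 := (hpA 0).trans measureReal_le_one
  induction n with
  | zero =>
    simp only [pow_zero]
    linarith [measureReal_le_one (μ := P) (s := ⋂ j ∈ Finset.range 0, (A j ∩ C j)ᶜ)]
  | succ n ih =>
    set H := ⋂ j ∈ Finset.range n, (A j ∩ C j)ᶜ with hH
    -- Failure at all stages means that `A n` occurs without `C n`, or that `A n` fails after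
    -- earlier failures. With `a = P (A n)` the recursion gives `a e + (1-a)(e + (1-p)^n) = e +
    -- (1-a)(1-p)^n`; no independence among the `C n` enters.
    have hsub : ⋂ j ∈ Finset.range (n + 1), (A j ∩ C j)ᶜ ⊆ (A n ∩ (C n)ᶜ) ∪ ((A n)ᶜ ∩ H) := by
      intro ω hω
      simp only [mem_iInter, Finset.mem_range] at hω
      by_cases h : ω ∈ A n
      · exact Or.inl ⟨h, fun h' => hω n (by omega) ⟨h, h'⟩⟩
      · refine Or.inr ⟨h, ?_⟩
        simp only [hH, mem_iInter, Finset.mem_range]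
        exact fun j hj => hω j (by omega)
    calc P.real (⋂ j ∈ Finset.range (n + 1), (A j ∩ C j)ᶜ)
        ≤ P.real (A n ∩ (C n)ᶜ) + P.real ((A n)ᶜ ∩ H) :=
          (measureReal_mono hsub).trans (measureReal_union_le _ _)
      _ = P.real (A n) * P.real (C n)ᶜ + (1 - P.real (A n)) * P.real H := by
          rw [hind₁, hind₂, probReal_compl_eq_one_sub (hA n)]
      _ ≤ P.real (A n) * e + (1 - P.real (A n)) * (e + (1 - p) ^ n) := by
          have h1 : 0 ≤ 1 - P.real (A n) := sub_nonneg.2 measureReal_le_one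
          have h2 : 0 ≤ P.real (A n) := measureReal_nonneg
          exact add_le_add (mul_le_mul_of_nonneg_left (heC n) h2)
            (mul_le_mul_of_nonneg_left ih h1)
      _ ≤ e + (1 - p) ^ (n + 1) := by
          have h3 : 0 ≤ (1 - p) ^ n := pow_nonneg (by linarith) n
          have h4 := mul_le_mul_of_nonneg_right (sub_le_sub_left (hpA n) 1) h3
          rw [pow_succ]
          linarith

/-! ### Probability of the pattern, uniformly in the scale -/

section PatternProbability

variable {κ s l : ℝ} {U V : Set LipMap} {k : ℕ}

theorem measurableSet_patternBox (hU : MeasurableSet U) (hV : MeasurableSet V) (i : Fin 4) :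
    MeasurableSet (patternBox κ s l U V i) := by
  have h1 := (measurableSet_Ioc (a := 2 / s) (b := 3 / s)).prod
    ((measurableSet_Ioc (a := l) (b := s)).prod hU)
  have h2 := (measurableSet_Ioc (a := 1 / s) (b := 2 / s)).prod
    ((measurableSet_Ioc (a := s) (b := (1 + κ / 2) * s)).prod hV)
  have h3 := (measurableSet_Ioc (a := 0) (b := 1 / s)).prod
    ((measurableSet_Ioc (a := (1 + κ / 2) * s) (b := (1 + κ) * s)).prod hU)
  fin_cases i
  · exact h1
  · exact h2
  · exact h3
  · exact (measurableSet_slab _ _ measurableSet_Ioc measurableSet_Ioc).diff ((h1.union h2).union h3)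

theorem disjoint_patternBox : Pairwise fun i j =>
    Disjoint (patternBox κ s l U V i) (patternBox κ s l U V j) := by
  set b₁ : Set (ℝ × ℝ × LipMap) := Ioc (2 / s) (3 / s) ×ˢ Ioc l s ×ˢ U
  set b₂ : Set (ℝ × ℝ × LipMap) := Ioc (1 / s) (2 / s) ×ˢ Ioc s ((1 + κ / 2) * s) ×ˢ V
  set b₃ : Set (ℝ × ℝ × LipMap) := Ioc 0 (1 / s) ×ˢ Ioc ((1 + κ / 2) * s) ((1 + κ) * s) ×ˢ U
  have h12 : Disjoint b₁ b₂ := Set.disjoint_left.2 fun p h h' => not_le.2 h.1.1 h'.1.2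
  have h23 : Disjoint b₂ b₃ := Set.disjoint_left.2 fun p h h' => not_le.2 h.1.1 h'.1.2
  have h13 : Disjoint b₁ b₃ := Set.disjoint_left.2 fun p h h' => by
    have a1 := h.1.1.trans_le h'.1.2
    have a2 := h'.1.1.trans_le h'.1.2
    have a3 : 2 / s = 2 * (1 / s) := by ring
    rw [a3] at a1
    linarith
  have hr : ∀ b ⊆ b₁ ∪ b₂ ∪ b₃, Disjoint b
      ((Ioc 0 (3 / s) ×ˢ Ioc l ((1 + κ) * s) ×ˢ univ) \ (b₁ ∪ b₂ ∪ b₃)) := fun b hb =>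
    disjoint_sdiff_right.mono_left hb
  have hr1 := hr b₁ (subset_union_left.trans subset_union_left)
  have hr2 := hr b₂ (subset_union_right.trans subset_union_left)
  have hr3 := hr b₃ subset_union_right
  intro i j hij
  fin_cases i <;> fin_cases j
  exacts [absurd rfl hij, h12, h13, hr1, h12.symm, absurd rfl hij, h23, hr2, h13.symm, h23.symm,
    absurd rfl hij, hr3, hr1.symm, hr2.symm, hr3.symm, absurd rfl hij]

theorem patternBox_subset (hκ : 0 < κ) (hs : 0 < s) (hl : l ≤ s) (i : Fin 4) :
    patternBox κ s l U V i ⊆ Ioc 0 (3 / s) ×ˢ Ioc l ((1 + κ) * s) ×ˢ univ := by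
  have ht1 : 0 ≤ 1 / s := by positivity
  have ht2 : 1 / s ≤ 2 / s := by gcongr; norm_num
  have ht3 : 2 / s ≤ 3 / s := by gcongr; norm_num
  have h1 : s ≤ (1 + κ / 2) * s := by nlinarith
  have h2 : (1 + κ / 2) * s ≤ (1 + κ) * s := by nlinarith
  fin_cases i
  · exact prod_mono (Ioc_subset_Ioc (ht1.trans ht2) le_rfl)
      (prod_mono (Ioc_subset_Ioc le_rfl (h1.trans h2)) (subset_univ _))
  · exact prod_mono (Ioc_subset_Ioc ht1 ht3) (prod_mono (Ioc_subset_Ioc hl h2) (subset_univ _))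
  · exact prod_mono (Ioc_subset_Ioc le_rfl (ht2.trans ht3))
      (prod_mono (Ioc_subset_Ioc (hl.trans h1) le_rfl) (subset_univ _))
  · exact sdiff_subset

theorem measurableSet_hasPattern {Ω : Type*} {N : Ω → Set (ℝ × ℝ × LipMap)} (hκ : 0 < κ)
    (hs : 0 < s) (hl : l ≤ s) (hU : MeasurableSet U) (hV : MeasurableSet V)
    {R : Set (ℝ × ℝ × LipMap)} (hR : Ioc 0 (3 / s) ×ˢ Ioc l ((1 + κ) * s) ×ˢ univ ⊆ R) :
    MeasurableSet[countSigma N R] {ω | HasPattern (N ω) κ s l U V k} := by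
  have h : {ω | HasPattern (N ω) κ s l U V k} = ⋂ i, (fun ω =>
      (N ω ∩ patternBox κ s l U V i).encard) ⁻¹' {((![k, 1, k, 0] i : ℕ) : ℕ∞)} := by
    ext ω
    simp [HasPattern]
  rw [h]
  exact MeasurableSet.iInter fun i => measurable_countSigma (measurableSet_patternBox hU hV i)
    ((patternBox_subset hκ hs hl i).trans hR) (measurableSet_singleton _)

variable {Ω : Type*} [MeasurableSpace Ω] {P : Measure Ω} {ν : Measure LipMap}
  {N : Ω → Set (ℝ × ℝ × LipMap)}

theorem IsPoissonProcess.measureReal_count_eq {E : Type*} [MeasurableSpace E] {M : Ω → Set E}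
    {m : Measure E} (hM : IsPoissonProcess P M m) {B : Set E} (hB : MeasurableSet B)
    (hB' : m B ≠ ∞) (k : ℕ) : P.real {ω | (M ω ∩ B).encard = k}
      = Real.exp (-(m B).toReal) * (m B).toReal ^ k / k.factorial := by
  rw [measureReal_def, hM.measure_count_eq hB hB', ENNReal.toReal_ofReal (by positivity)]

theorem IsPoissonProcess.measureReal_hasPattern [IsProbabilityMeasure P]
    (hN : IsPoissonProcess P N (halfLineIntensity ν)) (hU : MeasurableSet U)
    (hV : MeasurableSet V) : P.real {ω | HasPattern (N ω) κ s l U V k}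
      = ∏ i, P.real {ω | (N ω ∩ patternBox κ s l U V i).encard = ((![k, 1, k, 0] i : ℕ) : ℕ∞)} := by
  have h := (hN.indep_count 4 (patternBox κ s l U V) (measurableSet_patternBox hU hV)
    disjoint_patternBox).measure_inter_preimage_eq_mul (S := Finset.univ)
    (sets := fun i => {((![k, 1, k, 0] i : ℕ) : ℕ∞)}) fun i _ => measurableSet_singleton _
  have h' : {ω | HasPattern (N ω) κ s l U V k} = ⋂ i ∈ Finset.univ, (fun ω =>
      (N ω ∩ patternBox κ s l U V i).encard) ⁻¹' {((![k, 1, k, 0] i : ℕ) : ℕ∞)} := by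
    ext ω
    simp [HasPattern]
  rw [measureReal_def, h', h, ENNReal.toReal_prod]
  rfl

/-- Times scale like `1/s` and heights like `s`, so the intensities of the three marked boxes do not
depend on `s`; that of the remainder is at most `3(1+κ)`. The four counts are independent. -/
theorem IsPoissonProcess.le_measureReal_hasPattern [IsProbabilityMeasure P]
    [IsProbabilityMeasure ν]
    (hN : IsPoissonProcess P N (halfLineIntensity ν)) (hU : MeasurableSet U)
    (hV : MeasurableSet V) (hκ : 0 < κ) (hs : 0 < s) {q : ℝ} (hq0 : 0 ≤ q) (hq : q ≤ 1)
    (hl : l = q * s) {u v : ℝ} (hu : u = ν.real U) (hv : v = ν.real V) :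
    Real.exp (-((1 - q) * u)) * ((1 - q) * u) ^ k / k.factorial
      * (Real.exp (-(κ / 2 * v)) * (κ / 2 * v))
      * (Real.exp (-(κ / 2 * u)) * (κ / 2 * u) ^ k / k.factorial)
      * Real.exp (-(3 * (1 + κ))) ≤ P.real {ω | HasPattern (N ω) κ s l U V k} := by
  have hbox : ∀ (a b x y : ℝ) (W : Set LipMap), 0 ≤ a → 0 ≤ x → a ≤ b → x ≤ y →
      (halfLineIntensity ν (Ioc a b ×ˢ Ioc x y ×ˢ W)) ≠ ∞ ∧
      (halfLineIntensity ν (Ioc a b ×ˢ Ioc x y ×ˢ W)).toReal = (b - a) * ((y - x) * ν.real W) := by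
    intro a b x y W ha hx hab hxy
    rw [halfLineIntensity_prod, volume_restrict_Ici_Ioc ha, volume_restrict_Ici_Ioc hx]
    refine ⟨ENNReal.mul_ne_top ENNReal.ofReal_ne_top (ENNReal.mul_ne_top ENNReal.ofReal_ne_top
      (measure_ne_top _ _)), ?_⟩
    rw [ENNReal.toReal_mul, ENNReal.toReal_mul, ENNReal.toReal_ofReal (sub_nonneg.2 hab),
      ENNReal.toReal_ofReal (sub_nonneg.2 hxy), measureReal_def]
  have hl0 : 0 ≤ l := by rw [hl]; positivity
  have hls : l ≤ s := by rw [hl]; nlinarith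
  have ht1 : 0 ≤ 1 / s := by positivity
  have ht2 : 1 / s ≤ 2 / s := by gcongr; norm_num
  have ht3 : 2 / s ≤ 3 / s := by gcongr; norm_num
  have h1 : s ≤ (1 + κ / 2) * s := by nlinarith
  have h2 : (1 + κ / 2) * s ≤ (1 + κ) * s := by nlinarith
  obtain ⟨f₀, m₀⟩ := hbox (2 / s) (3 / s) l s U (ht1.trans ht2) hl0 ht3 hls
  obtain ⟨f₁, m₁⟩ := hbox (1 / s) (2 / s) s ((1 + κ / 2) * s) V ht1 hs.le ht2 h1
  obtain ⟨f₂, m₂⟩ := hbox 0 (1 / s) ((1 + κ / 2) * s) ((1 + κ) * s) U le_rfl (hs.le.trans h1) ht1 h2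
  obtain ⟨f₃, m₃⟩ := hbox 0 (3 / s) l ((1 + κ) * s) univ le_rfl hl0 (ht1.trans (ht2.trans ht3))
    (hls.trans (h1.trans h2))
  rw [← hu] at m₀ m₂
  rw [← hv] at m₁
  have m₀' : (3 / s - 2 / s) * ((s - l) * u) = (1 - q) * u := by rw [hl]; field_simp; ring
  have m₁' : (2 / s - 1 / s) * (((1 + κ / 2) * s - s) * v) = κ / 2 * v := by field_simp; ring
  have m₂' : (1 / s - 0) * (((1 + κ) * s - (1 + κ / 2) * s) * u) = κ / 2 * u := by field_simp; ring
  have hms := fun i => measurableSet_patternBox (κ := κ) (s := s) (l := l) hU hV i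
  have p₀ := hN.measureReal_count_eq (hms 0) f₀ k
  have p₁ := hN.measureReal_count_eq (hms 1) f₁ 1
  have p₂ := hN.measureReal_count_eq (hms 2) f₂ k
  have f₃' : halfLineIntensity ν (patternBox κ s l U V 3) ≠ ∞ :=
    measure_ne_top_of_subset sdiff_subset f₃
  have p₃ := hN.measureReal_count_eq (hms 3) f₃' 0
  have m₃' : (halfLineIntensity ν (patternBox κ s l U V 3)).toReal ≤ 3 * (1 + κ) := by
    refine (ENNReal.toReal_mono f₃ (measure_mono sdiff_subset)).trans ?_
    rw [m₃, probReal_univ, hl]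
    have : (3 / s - 0) * (((1 + κ) * s - q * s) * 1) = 3 * (1 + κ) - 3 * q := by field_simp; ring
    rw [this]
    linarith
  have e₀ : (halfLineIntensity ν (patternBox κ s l U V 0)).toReal = (1 - q) * u := m₀.trans m₀'
  have e₁ : (halfLineIntensity ν (patternBox κ s l U V 1)).toReal = κ / 2 * v := m₁.trans m₁'
  have e₂ : (halfLineIntensity ν (patternBox κ s l U V 2)).toReal = κ / 2 * u := m₂.trans m₂'
  rw [e₀] at p₀
  rw [e₁, pow_one, Nat.factorial_one, Nat.cast_one (R := ℝ), div_one] at p₁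
  rw [e₂] at p₂
  rw [pow_zero, mul_one, Nat.factorial_zero, Nat.cast_one (R := ℝ), div_one] at p₃
  have hu0 : 0 ≤ u := hu ▸ measureReal_nonneg
  have hv0 : 0 ≤ v := hv ▸ measureReal_nonneg
  have hq' : 0 ≤ 1 - q := by linarith
  rw [hN.measureReal_hasPattern hU hV, Fin.prod_univ_four]
  simp only [Matrix.cons_val]
  rw [p₀, p₁, p₂, p₃]
  gcongr

end PatternProbability

/-! ### Almost surely some scale is good -/

section GoodScale

variable {Ω : Type*} [MeasurableSpace Ω] {P : Measure Ω} [IsProbabilityMeasure P]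
  {ν : Measure LipMap} [IsProbabilityMeasure ν] {N : Ω → Set (ℝ × ℝ × LipMap)}

/-- The configuration `S` has no points at low heights and early times at scale `s`, and the later
points have little influence. -/
def IsTailBounded (S : Set (ℝ × ℝ × LipMap)) (z₀ κ θ s l : ℝ) (M : ℝ≥0∞) : Prop :=
  S ∩ Ioc 0 (3 / s) ×ˢ Ioc 0 l ×ˢ univ = ∅ ∧
    ∑' j, blockTerm S z₀ (3 / s) (1 / s) s ((1 + κ) * s) j ^ θ < M

theorem measurableSet_isTailBounded {Ω : Type*} {N : Ω → Set (ℝ × ℝ × LipMap)}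
    {z₀ κ θ s l : ℝ} {M : ℝ≥0∞} {R : Set (ℝ × ℝ × LipMap)}
    (hR₁ : Ioc 0 (3 / s) ×ˢ Ioc 0 l ×ˢ univ ⊆ R)
    (hR₂ : Ioi (3 / s) ×ˢ Icc 0 ((1 + κ) * s) ×ˢ univ ⊆ R) :
    MeasurableSet[countSigma N R] {ω | IsTailBounded (N ω) z₀ κ θ s l M} := by
  refine MeasurableSet.inter ?_ ?_
  · have := measurable_countSigma (N := N) (measurableSet_slab (Ioc 0 (3 / s)) (Ioc 0 l)
      measurableSet_Ioc measurableSet_Ioc) hR₁ (measurableSet_singleton 0)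
    have he : {ω | N ω ∩ Ioc 0 (3 / s) ×ˢ Ioc 0 l ×ˢ univ = ∅} =
        (fun ω => (N ω ∩ Ioc 0 (3 / s) ×ˢ Ioc 0 l ×ˢ univ).encard) ⁻¹' {0} := by
      ext ω
      simp
    rw [← he] at this
    exact this
  · have hm : Measurable[countSigma N R] fun ω =>
        ∑' j, blockTerm (N ω) z₀ (3 / s) (1 / s) s ((1 + κ) * s) j ^ θ :=
      letI := countSigma N R
      Measurable.tsum fun j => (measurable_blockTerm_countSigma
        ((prod_mono Ioc_subset_Ioi_self subset_rfl).trans hR₂)).pow_const θ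
    exact hm measurableSet_Iio

/-- Each of the two conditions fails with probability at most `e/2`: the low strip has intensity
`3q`, and Markov's inequality controls the sum of block terms. -/
theorem IsPoissonProcess.measureReal_not_isTailBounded_le
    (hN : IsPoissonProcess P N (halfLineIntensity ν)) {z₀ κ θ s q e : ℝ} (hs : 0 < s)
    (hq : 0 ≤ q) (he : 0 ≤ e) (hqe : 3 * q ≤ e / 2) {K M : ℝ≥0∞} (hM0 : M ≠ 0) (hM : M ≠ ∞)
    (hKM : K ≤ ENNReal.ofReal (e / 2) * M)
    (h : ∫⁻ ω, ∑' j, blockTerm (N ω) z₀ (3 / s) (1 / s) s ((1 + κ) * s) j ^ θ ∂P ≤ K) :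
    P.real {ω | IsTailBounded (N ω) z₀ κ θ s (q * s) M}ᶜ ≤ e := by
  have hmeas : ∀ j, Measurable fun ω =>
      blockTerm (N ω) z₀ (3 / s) (1 / s) s ((1 + κ) * s) j := fun j =>
    (measurable_blockTerm_countSigma (subset_univ _)).mono (hN.countSigma_le univ) le_rfl
  have hslab := measurableSet_slab (Ioc 0 (3 / s)) (Ioc 0 (q * s)) measurableSet_Ioc
    measurableSet_Ioc
  have hm : halfLineIntensity ν (Ioc 0 (3 / s) ×ˢ Ioc 0 (q * s) ×ˢ univ)
      = ENNReal.ofReal (3 * q) := by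
    rw [halfLineIntensity_prod, volume_restrict_Ici_Ioc le_rfl, volume_restrict_Ici_Ioc le_rfl,
      measure_univ, mul_one, ← ENNReal.ofReal_mul (by rw [sub_zero]; positivity)]
    congr 1
    field_simp
    ring
  have h₁ : P.real {ω | N ω ∩ Ioc 0 (3 / s) ×ˢ Ioc 0 (q * s) ×ˢ univ = ∅}ᶜ ≤ e / 2 := by
    have hms : MeasurableSet {ω | N ω ∩ Ioc 0 (3 / s) ×ˢ Ioc 0 (q * s) ×ˢ univ = ∅} := by
      have := hN.measurable_count _ hslab (measurableSet_singleton 0)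
      convert this using 1
      ext ω
      simp
    rw [probReal_compl_eq_one_sub hms, measureReal_def, hN.measure_count_zero hslab
      (by rw [hm]; exact ENNReal.ofReal_ne_top), hm, ENNReal.toReal_ofReal (Real.exp_pos _).le,
      ENNReal.toReal_ofReal (by positivity)]
    linarith [Real.add_one_le_exp (-(3 * q))]
  have h₂ : P.real {ω | M ≤ ∑' j, blockTerm (N ω) z₀ (3 / s) (1 / s) s ((1 + κ) * s) j ^ θ}
      ≤ e / 2 := by
    refine ENNReal.toReal_le_of_le_ofReal (by positivity) ?_
    refine (meas_ge_le_lintegral_div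
      (Measurable.tsum fun j => (hmeas j).pow_const θ).aemeasurable hM0 hM).trans ?_
    exact ENNReal.div_le_of_le_mul (h.trans hKM)
  calc _ ≤ P.real ({ω | N ω ∩ Ioc 0 (3 / s) ×ˢ Ioc 0 (q * s) ×ˢ univ = ∅}ᶜ ∪
        {ω | M ≤ ∑' j, blockTerm (N ω) z₀ (3 / s) (1 / s) s ((1 + κ) * s) j ^ θ}) := by
        refine measureReal_mono fun ω hω => ?_
        by_contra hcon
        rw [mem_union, not_or, mem_compl_iff, not_not] at hcon
        exact hω ⟨hcon.1, not_le.1 hcon.2⟩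
    _ ≤ e / 2 + e / 2 := (measureReal_union_le _ _).trans (add_le_add h₁ h₂)
    _ = e := by ring

/-- Up to an event of small probability, at some scale the pattern occurs with a bounded tail. -/
theorem IsPoissonProcess.measureReal_forall_not_good_le
    (hN : IsPoissonProcess P N (halfLineIntensity ν)) {z₀ κ θ q e : ℝ} {U V : Set LipMap} {k : ℕ}
    (hU : MeasurableSet U) (hV : MeasurableSet V) (hU0 : ν U ≠ 0) (hV0 : ν V ≠ 0) (hκ : 0 < κ)
    (hq : 0 < q) (hq1 : q < 1) (he : 0 ≤ e) (hqe : 3 * q ≤ e / 2) {K M : ℝ≥0∞} (hM0 : M ≠ 0)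
    (hM : M ≠ ∞) (hKM : K ≤ ENNReal.ofReal (e / 2) * M)
    (h : ∀ s > 0, ∀ T ≥ 0,
      ∫⁻ ω, ∑' j, blockTerm (N ω) z₀ T (1 / s) s ((1 + κ) * s) j ^ θ ∂P ≤ K) :
    P.real {ω | ∀ s > 0, ¬ (HasPattern (N ω) κ s (q * s) U V k ∧
      IsTailBounded (N ω) z₀ κ θ s (q * s) M)} ≤ e := by
  -- With this ratio of consecutive scales, `(1+κ) s_j ≤ q s_n` for `j < n`: all events of earlier
  -- scales concern heights below the region `D n` of the pattern at scale `s_n`.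
  set c := (1 + κ) / q with hc
  have hc1 : 1 < c := by
    rw [hc, lt_div_iff₀ hq]
    linarith
  have hc0 : 0 < c := by linarith
  set s : ℕ → ℝ := fun n => c ^ n with hsdef
  have hs : ∀ n, 0 < s n := fun n => pow_pos hc0 n
  have hl : ∀ n, q * s n ≤ s n := fun n => by nlinarith [hs n]
  have hsep : ∀ j n, j < n → (1 + κ) * s j ≤ q * s n := by
    intro j n hjn
    have h1 : c * s j ≤ s n := by
      calc c * s j = c ^ (j + 1) := by rw [pow_succ, mul_comm]
        _ ≤ c ^ n := pow_le_pow_right₀ hc1.le hjn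
    calc (1 + κ) * s j = q * (c * s j) := by rw [hc]; field_simp
      _ ≤ _ := by gcongr
  set A : ℕ → Set Ω := fun n => {ω | HasPattern (N ω) κ (s n) (q * s n) U V k} with hAdef
  set C : ℕ → Set Ω := fun n => {ω | IsTailBounded (N ω) z₀ κ θ (s n) (q * s n) M} with hCdef
  set D : ℕ → Set (ℝ × ℝ × LipMap) := fun n =>
    Ioc 0 (3 / s n) ×ˢ Ioc (q * s n) ((1 + κ) * s n) ×ˢ univ with hDdef
  have hD : ∀ n, MeasurableSet (D n) := fun n =>
    measurableSet_slab _ _ measurableSet_Ioc measurableSet_Ioc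
  have hA : ∀ n, MeasurableSet[countSigma N (D n)] (A n) := fun n =>
    measurableSet_hasPattern hκ (hs n) (hl n) hU hV subset_rfl
  -- The tail condition looks only at heights up to `q s` and at times after `3/s`, hence outside `D
  -- n`.
  have hC : ∀ n, MeasurableSet[countSigma N (D n)ᶜ] (C n) := fun n =>
    measurableSet_isTailBounded (fun p hp hp' => not_lt.2 hp.2.1.2 hp'.2.1.1)
      (fun p hp hp' => not_lt.2 hp'.1.2 hp.1)
  have hind := fun n => (Indep_iff _ _ _).1
    (hN.indep_countSigma (hD n) (hD n).compl disjoint_compl_right)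
  have hlow : ∀ j n, j < n → MeasurableSet[countSigma N (D n)ᶜ] (A j ∩ C j)ᶜ := by
    intro j n hjn
    have hle : ∀ p : ℝ × ℝ × LipMap, p.2.1 ≤ (1 + κ) * s j → p ∈ (D n)ᶜ := fun p hp hp' =>
      not_lt.2 (hp.trans (hsep j n hjn)) hp'.2.1.1
    refine MeasurableSet.compl (MeasurableSet.inter ?_ ?_)
    · exact measurableSet_hasPattern hκ (hs j) (hl j) hU hV fun p hp => hle p hp.2.1.2
    · refine measurableSet_isTailBounded (fun p hp => hle p (hp.2.1.2.trans ?_))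
        fun p hp => hle p hp.2.1.2
      exact (hl j).trans (by nlinarith [hs j])
  have hu0 : 0 < ν.real U := ENNReal.toReal_pos hU0 (measure_ne_top _ _)
  have hv0 : 0 < ν.real V := ENNReal.toReal_pos hV0 (measure_ne_top _ _)
  have hq' : 0 < 1 - q := by linarith
  set p : ℝ := Real.exp (-((1 - q) * ν.real U)) * ((1 - q) * ν.real U) ^ k / k.factorial
      * (Real.exp (-(κ / 2 * ν.real V)) * (κ / 2 * ν.real V))
      * (Real.exp (-(κ / 2 * ν.real U)) * (κ / 2 * ν.real U) ^ k / k.factorial)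
      * Real.exp (-(3 * (1 + κ))) with hp
  have hp0 : 0 < p := by positivity
  have hpA : ∀ n, p ≤ P.real (A n) := fun n =>
    hN.le_measureReal_hasPattern hU hV hκ (hs n) hq.le hq1.le rfl rfl rfl
  have hbound := measureReal_iInter_compl_le (P := P) (A := A) (C := C)
    (fun n => hN.countSigma_le _ _ (hA n)) he hpA
    (fun n => hN.measureReal_not_isTailBounded_le (hs n) hq.le he hqe hM0 hM hKM
      (h (s n) (hs n) (3 / s n) (div_nonneg (by norm_num) (hs n).le)))
    (fun n => by
      rw [measureReal_def, hind n _ _ (hA n) (hC n).compl, ENNReal.toReal_mul]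
      rfl)
    (fun n => by
      rw [measureReal_def, hind n _ _ (hA n).compl (Finset.measurableSet_biInter _ fun j hj =>
        hlow j n (Finset.mem_range.1 hj)), ENNReal.toReal_mul]
      rfl)
  have hp1 : p ≤ 1 := (hpA 0).trans measureReal_le_one
  have hlim : Tendsto (fun n : ℕ => e + (1 - p) ^ n) atTop (𝓝 (e + 0)) :=
    (tendsto_pow_atTop_nhds_zero_of_lt_one (by linarith) (by linarith)).const_add e
  rw [add_zero] at hlim
  refine ge_of_tendsto' hlim fun n => le_trans (measureReal_mono fun ω hω => ?_) (hbound n)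
  simp only [mem_iInter]
  exact fun j _ => hω (s j) (hs j)

/-- The order of choices matters: `c`, `δ`, `ℓ` and `η` depend on `ν` only; then the error `e` fixes
the tail level `M` and thus `R`; last comes the number `k` of contractions, large enough to absorb
`R`. -/
theorem IsPoissonProcess.ae_jump_and_not_monotone
    (hN : IsPoissonProcess P N (halfLineIntensity ν)) (hν : IsContractiveInMean ν)
    (hfix : ∀ c : ℝ, ¬ ∀ᵐ f ∂ν, f c = c) {z₀ θ κ : ℝ} (hθ : 0 < θ) (hθ1 : θ ≤ 1) (hκ : 0 < κ)
    {K : ℝ≥0∞} (hK : K ≠ ∞)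
    (h : ∀ s > 0, ∀ T ≥ 0,
      ∫⁻ ω, ∑' j, blockTerm (N ω) z₀ T (1 / s) s ((1 + κ) * s) j ^ θ ∂P ≤ K) :
    ∀ᵐ ω ∂P, (∃ t x f, IsLowerRecord (N ω) (t, x, f) ∧ ∃ v : ℝ,
        Tendsto (zetaProcess (N ω) z₀) (𝓝[<] x) (𝓝 v) ∧ zetaProcess (N ω) z₀ x ≠ v) ∧
      ¬ MonotoneOn (zetaProcess (N ω) z₀) (Ioi 0) ∧
      ¬ AntitoneOn (zetaProcess (N ω) z₀) (Ioi 0) := by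
  obtain ⟨ρ, hρ0, hρ1, c, hc⟩ := hν.exists_center
  obtain ⟨δ, hδ, ℓ, hℓ, hV0⟩ := exists_measure_displacement_pos (hfix c)
  set V : Set LipMap := {f | ENNReal.ofReal δ ≤ edist (f c) c ∧ edist (f c) c ≤ ENNReal.ofReal ℓ ∧
    lipConst f ≤ ENNReal.ofReal ℓ} with hVdef
  -- Makes the total error `ℓ * (2 * η) + 2 * η` equal to `δ / 2`.
  set η := δ / (4 * (ℓ + 1)) with hη
  have hη0 : 0 < η := by positivity
  have hδη : ℓ * (2 * η) + 2 * η < δ := by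
    have : ℓ * (2 * η) + 2 * η = δ / 2 := by rw [hη]; field_simp; ring
    linarith
  -- The displacement `(1 - ρ) * η` is what keeps the ball of radius `η` around `c` invariant under
  -- contraction by `ρ`.
  set U : Set LipMap := {f | lipConst f ≤ ENNReal.ofReal ρ ∧
    edist (f c) c ≤ ENNReal.ofReal ((1 - ρ) * η)} with hUdef
  have hρη : 0 < (1 - ρ) * η := mul_pos (by linarith) hη0
  have hU0 : ν U ≠ 0 := hc _ hρη
  have hmL := LipMap.measurable_lipConst
  have hmd := LipMap.measurable_edist_eval c c
  have hU : MeasurableSet U := (measurableSet_le hmL measurable_const).inter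
    (measurableSet_le hmd measurable_const)
  have hV : MeasurableSet V := (measurableSet_le measurable_const hmd).inter
    ((measurableSet_le hmd measurable_const).inter (measurableSet_le hmL measurable_const))
  have hlip : ∀ (f : LipMap) (r : ℝ), 0 ≤ r → lipConst f ≤ ENNReal.ofReal r →
      ∀ z w, dist (f z) (f w) ≤ r * dist z w := by
    intro f r hr hf z w
    have h1 := (f.edist_apply_le z w).trans (mul_le_mul_left hf _)
    rwa [edist_dist, edist_dist, ← ENNReal.ofReal_mul hr,
      ENNReal.ofReal_le_ofReal_iff (mul_nonneg hr dist_nonneg)] at h1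
  have hUc : ∀ f ∈ U, ∀ z, dist (f z) c ≤ ρ * dist z c + (1 - ρ) * η := by
    rintro f ⟨h1, h2⟩ z
    rw [edist_dist, ENNReal.ofReal_le_ofReal_iff hρη.le] at h2
    exact (dist_triangle _ (f c) _).trans (add_le_add (hlip f ρ hρ0 h1 z c) h2)
  have hVc : ∀ f ∈ V, δ ≤ dist (f c) c ∧ dist (f c) c ≤ ℓ ∧
      ∀ z w, dist (f z) (f w) ≤ ℓ * dist z w := by
    rintro f ⟨h1, h2, h3⟩
    rw [edist_dist, ENNReal.ofReal_le_ofReal_iff dist_nonneg] at h1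
    rw [edist_dist, ENNReal.ofReal_le_ofReal_iff hℓ] at h2
    exact ⟨h1, h2, hlip f ℓ hℓ h3⟩
  have hgood := hN.ae_isSummableConfig hθ hθ1 hK h
  have hsmall : ∀ e : ℝ, 0 < e → e < 1 → P {ω | ¬ ((∃ t x f, IsLowerRecord (N ω) (t, x, f) ∧
      ∃ v : ℝ, Tendsto (zetaProcess (N ω) z₀) (𝓝[<] x) (𝓝 v) ∧ zetaProcess (N ω) z₀ x ≠ v) ∧
      ¬ MonotoneOn (zetaProcess (N ω) z₀) (Ioi 0) ∧
      ¬ AntitoneOn (zetaProcess (N ω) z₀) (Ioi 0))} ≤ ENNReal.ofReal e := by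
    intro e he he1
    -- Markov's inequality needs `K ≤ (e/2) M`; the added `1` keeps `M` nonzero.
    set M : ℝ≥0∞ := K / ENNReal.ofReal (e / 2) + 1 with hMdef
    have he2 : ENNReal.ofReal (e / 2) ≠ 0 := by simpa using he
    have hM0 : M ≠ 0 := by simp [hMdef]
    have hM : M ≠ ∞ := ENNReal.add_ne_top.2 ⟨ENNReal.div_ne_top hK he2, ENNReal.one_ne_top⟩
    have hKM : K ≤ ENNReal.ofReal (e / 2) * M := by
      rw [hMdef, mul_add, ENNReal.mul_div_cancel he2 ENNReal.ofReal_ne_top]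
      exact le_self_add
    have hMR : M ^ (1 / θ) ≠ ∞ := ENNReal.rpow_ne_top_of_nonneg (by positivity) hM
    set R := (M ^ (1 / θ)).toReal with hR
    have hR0 : 0 ≤ R := ENNReal.toReal_nonneg
    set B := (R + dist z₀ c) + (ℓ * (2 * η) + ℓ) with hB
    have hB0 : 0 ≤ B := by positivity
    obtain ⟨k, hk⟩ := exists_pow_lt_of_lt_one (show 0 < η / (B + 1) by positivity) hρ1
    rw [lt_div_iff₀ (by positivity)] at hk
    have hρk : 0 ≤ ρ ^ k := pow_nonneg hρ0 k
    have hk₁ : ρ ^ k * (R + dist z₀ c) ≤ η := by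
      refine le_trans (mul_le_mul_of_nonneg_left ?_ hρk) hk.le
      rw [hB]
      linarith [mul_nonneg hℓ (mul_nonneg zero_le_two hη0.le)]
    have hk₂ : ρ ^ k * (ℓ * (2 * η) + ℓ) ≤ η := by
      refine le_trans (mul_le_mul_of_nonneg_left ?_ hρk) hk.le
      rw [hB]
      linarith [dist_nonneg (x := z₀) (y := c)]
    have hbad := hN.measureReal_forall_not_good_le (k := k) hU hV hU0 hV0 hκ (q := e / 6)
      (by positivity) (by linarith) he.le (by linarith) hM0 hM hKM h
    rw [measureReal_def, ← ENNReal.le_ofReal_iff_toReal_le (measure_ne_top _ _) he.le] at hbad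
    -- On summable configurations, a path violating the claim has no good scale. Only monotonicity
    -- of the measure is used, so measurability of the path event is not needed.
    refine le_trans (measure_mono_ae ?_) hbad
    filter_upwards [hgood] with ω hω hωbad s hs hsgood
    refine hωbad (hω.jump_and_not_monotone hκ hs hρ0 hη0.le hℓ hR0 hUc hVc hsgood.1
      hsgood.2.1 ?_ hk₁ hk₂ hδη)
    rw [hR, ENNReal.ofReal_toReal hMR]
    exact ENNReal.tsum_rpow_le_rpow_tsum hθ hθ1 hsgood.2.2.le
  rw [ae_iff]
  refine le_antisymm (ge_of_tendsto' (f := fun n : ℕ => ENNReal.ofReal (1 / ((n : ℝ) + 1) / 2))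
    (x := atTop) ?_ fun n => hsmall _ (by positivity) ?_) zero_le
  · have := ENNReal.tendsto_ofReal ((tendsto_one_div_add_atTop_nhds_zero_nat (𝕜 := ℝ)).div_const 2)
    simpa using this
  · have : 1 / ((n : ℝ) + 1) ≤ 1 := by
      rw [div_le_one (by positivity)]
      linarith [(Nat.cast_nonneg n : (0 : ℝ) ≤ n)]
    linarith

end GoodScale

/-! ### Conclusion -/

theorem mainTheorem3 {Ω : Type*} [MeasurableSpace Ω] (P : Measure Ω) [IsProbabilityMeasure P]
    (ν : Measure LipMap) [IsProbabilityMeasure ν]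
    (hν : IsContractiveInMean ν)
    (hz : ∃ z : ℝ, ∫⁻ f, edist (f z) z ∂ν < ∞)
    (N : Ω → Set (ℝ × ℝ × LipMap))
    (hN : IsPoissonProcess P N (halfLineIntensity ν))
    (z₀ : ℝ) :
    -- almost surely, the limits defining the process exist for all `x > 0` simultaneously
    (∀ᵐ ω ∂P, ∀ x > 0,
      Tendsto (sievedIterate (N ω) z₀ (Icc 0 x)) atTop (𝓝 (zetaProcess (N ω) z₀ x))) ∧
    -- almost sure continuity at every fixed point
    (∀ x > 0, ∀ᵐ ω ∂P, ContinuousAt (zetaProcess (N ω) z₀) x) ∧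
    -- càdlàg paths
    (∀ᵐ ω ∂P, IsCadlagOnPos (zetaProcess (N ω) z₀)) ∧
    -- at every lower record `(t, x, f)` one has `x > 0` and `ζ(x) = f(ζ(x-))`
    (∀ᵐ ω ∂P, ∀ t x f, IsLowerRecord (N ω) (t, x, f) →
      0 < x ∧ ∃ l : ℝ, Tendsto (zetaProcess (N ω) z₀) (𝓝[<] x) (𝓝 l) ∧
        zetaProcess (N ω) z₀ x = f l) ∧
    -- if the functions have no common deterministic fixed point, then almost surely there is a
    -- jump at some lower record, and the path is neither continuous nor monotone
    ((∀ c : ℝ, ¬ ∀ᵐ f ∂ν, f c = c) →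
      (∀ᵐ ω ∂P, ∃ t x f, IsLowerRecord (N ω) (t, x, f) ∧
        ∃ l : ℝ, Tendsto (zetaProcess (N ω) z₀) (𝓝[<] x) (𝓝 l) ∧
          zetaProcess (N ω) z₀ x ≠ l) ∧
      (∀ᵐ ω ∂P, ¬ ContinuousOn (zetaProcess (N ω) z₀) (Ioi 0)) ∧
      (∀ᵐ ω ∂P, ¬ MonotoneOn (zetaProcess (N ω) z₀) (Ioi 0) ∧
        ¬ AntitoneOn (zetaProcess (N ω) z₀) (Ioi 0))) := by
  obtain ⟨θ, hθ, hθ1, κ, hκ, K, hK, h⟩ := hN.exists_lintegral_tsum_blockTerm_le hν hz z₀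
  have hgood := hN.ae_isSummableConfig hθ hθ1 hK h
  refine ⟨?_, fun x hx => ?_, ?_, ?_, fun hfix => ?_⟩
  · filter_upwards [hgood] with ω hω x hx using hω.tendsto_zetaProcess hκ hx
  · filter_upwards [hgood, hN.ae_height_ne x] with ω hω hne
    exact hω.continuousAt_zetaProcess hκ hx hne
  · filter_upwards [hgood] with ω hω using hω.isCadlagOnPos hκ
  · filter_upwards [hgood] with ω hω t x f hrec
    obtain ⟨h0, he⟩ := hω.zetaProcess_lowerRecord hκ hrec
    exact ⟨h0, _, hω.tendsto_zetaProcess_left hκ h0, he⟩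
  · have hjump := hN.ae_jump_and_not_monotone hν hfix hθ hθ1 hκ hK h
    refine ⟨?_, ?_, ?_⟩
    · filter_upwards [hjump] with ω hω using hω.1
    · filter_upwards [hjump, hgood] with ω hω hS hcont
      obtain ⟨t, x, f, hrec, v, hv, hne⟩ := hω.1
      have h0 : 0 < x := (hS.zetaProcess_lowerRecord hκ hrec).1
      have hc : ContinuousAt (zetaProcess (N ω) z₀) x := hcont.continuousAt (Ioi_mem_nhds h0)
      exact hne (tendsto_nhds_unique (hc.tendsto.mono_left nhdsWithin_le_nhds) hv)
    · filter_upwards [hjump] with ω hω using hω.2
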